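/- Let $(M,\eta,\xi,\varphi,g)$ be a $3$-dimensional regular Sasaki manifold: $\eta$ is a contact form with Reeb field $\xi$, one has $\varphi^2=-I+\eta\otimes\xi$, $g(\varphi X,\varphi Y)=g(X,Y)-\eta(X)\eta(Y)$, $g(\xi,\cdot)=\eta$, $d\eta(X,Y)=2g(X,\varphi Y)$ with $d\eta(X,Y)=X\eta(Y)-Y\eta(X)-\eta([X,Y])$, and $(\nabla_X\varphi)Y=g(X,Y)\xi-\eta(Y)X$; the field $\xi$ generates a one-parameter group $K$ of isometries that acts simply transitively on each of its orbits, and the orbit space $\overline M=M/K$ is a smooth surface for which the projection $\pi:M\to\overline M$ is a submersion. Give $\overline M$ the Riemannian metric that makes $\pi$ a Riemannian submersion, and the almost complex structure $J\bar X=\pi_*(\varphi\bar X^{*})$, where $\bar X^{*}$ is the horizontal lift of $\bar X$. Let $T\subseteq\mathbb R$ be an open interval and $\bar\gamma:T\to\overline M$ a smooth curve parametrised by arclength $s$, with signed curvature $\bar\kappa=\langle\overline\nabla_{\bar\gamma'}\bar\gamma',J\bar\gamma'\rangle$. Let $S=\pi^{-1}(\bar\gamma)$ be the Hopf cylinder over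 $\bar\gamma$, that is, the surface $\{(s,p)\in T\times M:\pi(p)=\bar\gamma(s)\}$ immersed in $M$ by $(s,p)\mapsto p$, with the induced metric. Let $\mathbb H=\frac12\operatorname{tr} I\!I$ be its mean curvature vector field and $$\Delta^{\perp}=-\sum_{i=1}^{2}\left(\nabla^{\perp}_{e_i}\nabla^{\perp}_{e_i}-\nabla^{\perp}_{\nabla^{S}_{e_i}e_i}\right)$$ the normal Laplacian of $S$ in $M$, where $(e_1,e_2)$ is a local orthonormal frame of $S$. Then $\Delta^{\perp}\mathbb H=0$ if and only if $\bar\gamma$ is one of the following: (1) a geodesic ($\overline\nabla_{\bar\gamma'}\bar\gamma'=0$); (2) a Riemannian circle ($\bar\kappa$ is a nonzero constant); (3) a Riemannian clothoid ($\bar\kappa(s)=as+c$ with constants $a\neq0$ and $c$). -/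

import Mathlib

open Bundle
open scoped Manifold ContDiff

noncomputable section

namespace SasakiHopf

section Riemannian

variable {E : Type*} [NormedAddCommGroup E] [NormedSpace ℝ E] [FiniteDimensional ℝ E]
  {H : Type*} [TopologicalSpace H]
  {E' : Type*} [NormedAddCommGroup E'] [NormedSpace ℝ E']
  {H' : Type*} [TopologicalSpace H']

instance tangentSpace_finiteDimensional (I : ModelWithCorners ℝ E H) {M : Type*}
    [TopologicalSpace M] [ChartedSpace H M] (x : M) : FiniteDimensional ℝ (TangentSpace I x) :=
  inferInstanceAs (FiniteDimensional ℝ E)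

/-- The Koszul expression `2 ⟨∇_X Y, Z⟩` at the point `x`. -/
def koszul (I : ModelWithCorners ℝ E H) {M : Type*} [TopologicalSpace M] [ChartedSpace H M]
    [IsManifold I ∞ M] [RiemannianBundle (fun x : M => TangentSpace I x)]
    (X Y Z : ∀ x : M, TangentSpace I x) (x : M) : ℝ :=
  mvfderiv I (fun y => inner ℝ (Y y) (Z y)) x (X x)
    + mvfderiv I (fun y => inner ℝ (X y) (Z y)) x (Y x)
    - mvfderiv I (fun y => inner ℝ (X y) (Y y)) x (Z x)
    + inner ℝ (VectorField.mlieBracket I X Y x) (Z x)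
    - inner ℝ (VectorField.mlieBracket I X Z x) (Y x)
    - inner ℝ (VectorField.mlieBracket I Y Z x) (X x)

/-- The Levi-Civita connection `(∇_X Y)(x)`, for vector fields `X`, `Y` that are smooth near `x`:
the vector whose scalar products are given by the Koszul formula, written in an orthonormal basis
of the tangent space. Each basis vector is extended to a vector field by constant
coefficients in the preferred chart at `x`. -/
def leviCivita (I : ModelWithCorners ℝ E H) {M : Type*} [TopologicalSpace M] [ChartedSpace H M]
    [IsManifold I ∞ M] [RiemannianBundle (fun x : M => TangentSpace I x)]
    (X Y : ∀ x : M, TangentSpace I x) (x : M) : TangentSpace I x :=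
  ∑ i, ((1 / 2 : ℝ) * koszul I X Y
      (FiberBundle.extend E (stdOrthonormalBasis ℝ (TangentSpace I x) i)) x) •
    stdOrthonormalBasis ℝ (TangentSpace I x) i

/-- The covariant derivative `∇_v W` at `q` of a vector field `W` along a map `f : N → M`, i.e. the
connection induced on `f^* TM` by the Levi-Civita connection of `M`. If `∂_k` is the coordinate
frame of the preferred chart at `f q` and `W = ∑ W^k (∂_k ∘ f)` near `q`, then
`∇_v W = ∑ v(W^k) ∂_k + ∑ W^k(q) ∇_{df(v)} ∂_k`. -/
def covAlong (I' : ModelWithCorners ℝ E' H') (I : ModelWithCorners ℝ E H)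
    {N : Type*} [TopologicalSpace N] [ChartedSpace H' N]
    {M : Type*} [TopologicalSpace M] [ChartedSpace H M]
    [IsManifold I ∞ M] [RiemannianBundle (fun x : M => TangentSpace I x)]
    (f : N → M) (W : ∀ q : N, TangentSpace I (f q)) (q : N) (v : TangentSpace I' q) :
    TangentSpace I (f q) :=
  (trivializationAt E (TangentSpace I) (f q)).symm (f q)
      (mvfderiv I' (fun q' : N =>
        (trivializationAt E (TangentSpace I) (f q) ⟨f q', W q'⟩).2) q v)
    + leviCivita I (FiberBundle.extend E (mfderiv I' I f q v)) (FiberBundle.extend E (W q)) (f q)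

end Riemannian

section Surfaces

/-! Geometry of an isometric immersion `ι : S → M` of a surface. -/

variable {E : Type*} [NormedAddCommGroup E] [NormedSpace ℝ E] [FiniteDimensional ℝ E]
  {H : Type*} [TopologicalSpace H] (I : ModelWithCorners ℝ E H)
  {M : Type*} [TopologicalSpace M] [ChartedSpace H M]
  [IsManifold I ∞ M] [RiemannianBundle (fun x : M => TangentSpace I x)]
  {S : Type*} [TopologicalSpace S] [ChartedSpace (EuclideanSpace ℝ (Fin 2)) S]
  [IsManifold (𝓡 2) ∞ S]

/-- The component of `w` normal to the immersed surface. -/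
def normalPart (ι : S → M) (q : S) (w : TangentSpace I (ι q)) : TangentSpace I (ι q) :=
  (LinearMap.range (mfderiv (𝓡 2) I ι q).toLinearMap)ᗮ.starProjection w

/-- The normal connection `∇^⊥_v W`: the normal component of `∇_v W`. -/
def normalConnection (ι : S → M) (W : ∀ q : S, TangentSpace I (ι q)) (q : S)
    (v : TangentSpace (𝓡 2) q) : TangentSpace I (ι q) :=
  normalPart I ι q (covAlong (𝓡 2) I ι W q v)

/-- The (vector valued) second fundamental form, the normal component of `∇_u dι(V)`, where `V` is
an extension of `v` to a vector field on the surface. -/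
def secondFundamentalForm (ι : S → M) (q : S) (u v : TangentSpace (𝓡 2) q) :
    TangentSpace I (ι q) :=
  normalConnection I ι (fun q' => mfderiv (𝓡 2) I ι q'
    (FiberBundle.extend (EuclideanSpace ℝ (Fin 2)) v q')) q u

variable [RiemannianBundle (fun q : S => TangentSpace (𝓡 2) q)]

/-- The mean curvature vector field: half the trace of the second fundamental form. -/
def meanCurvatureVector (ι : S → M) (q : S) : TangentSpace I (ι q) :=
  (1 / 2 : ℝ) • ∑ i, secondFundamentalForm I ι q
    (stdOrthonormalBasis ℝ (TangentSpace (𝓡 2) q) i)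
    (stdOrthonormalBasis ℝ (TangentSpace (𝓡 2) q) i)

/-- The second covariant derivative `∇^⊥_u ∇^⊥_V W - ∇^⊥_{∇^S_u V} W` of a section `W` of the
normal bundle, where `V` is an extension of `v` (and `u` is extended likewise). -/
def normalHessian (ι : S → M) (W : ∀ q : S, TangentSpace I (ι q)) (q : S)
    (u v : TangentSpace (𝓡 2) q) : TangentSpace I (ι q) :=
  normalConnection I ι (fun q' => normalConnection I ι W q'
      (FiberBundle.extend (EuclideanSpace ℝ (Fin 2)) v q')) q u
    - normalConnection I ι W q (leviCivita (𝓡 2)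
        (FiberBundle.extend (EuclideanSpace ℝ (Fin 2)) u)
        (FiberBundle.extend (EuclideanSpace ℝ (Fin 2)) v) q)

/-- The normal Laplacian `Δ^⊥ W = - ∑ (∇^⊥_{e_i} ∇^⊥_{e_i} W - ∇^⊥_{∇^S_{e_i} e_i} W)`. -/
def normalLaplacian (ι : S → M) (W : ∀ q : S, TangentSpace I (ι q)) (q : S) :
    TangentSpace I (ι q) :=
  - ∑ i, normalHessian I ι W q
    (stdOrthonormalBasis ℝ (TangentSpace (𝓡 2) q) i)
    (stdOrthonormalBasis ℝ (TangentSpace (𝓡 2) q) i)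

end Surfaces

section Sasaki

variable (M : Type*) [TopologicalSpace M] [ChartedSpace (EuclideanSpace ℝ (Fin 3)) M]
  [IsManifold (𝓡 3) ∞ M]

variable {M} in
/-- Smooth vector fields on a 3-manifold. -/
def IsSmoothField (X : ∀ x : M, TangentSpace (𝓡 3) x) : Prop :=
  ContMDiff (𝓡 3) (𝓡 3).tangent ∞
    (fun x => (⟨x, X x⟩ : TotalSpace (EuclideanSpace ℝ (Fin 3)) (TangentSpace (𝓡 3) (M := M))))

variable {M} in
/-- The exterior derivative `dη(X, Y) = X(η(Y)) - Y(η(X)) - η([X, Y])` of a one-form. -/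
def dOneForm (η : ∀ x : M, TangentSpace (𝓡 3) x →L[ℝ] ℝ)
    (X Y : ∀ x : M, TangentSpace (𝓡 3) x) (x : M) : ℝ :=
  mvfderiv (𝓡 3) (fun y => η y (Y y)) x (X x) - mvfderiv (𝓡 3) (fun y => η y (X y)) x (Y x)
    - η x (VectorField.mlieBracket (𝓡 3) X Y x)

variable [RiemannianBundle (fun x : M => TangentSpace (𝓡 3) x)]

/-- A Sasaki structure `(η, ξ, φ, g)` on a 3-manifold, where `g` is the given Riemannian metric. -/
structure SasakiStructure where
  /-- the contact form -/
  η : ∀ x : M, TangentSpace (𝓡 3) x →L[ℝ] ℝ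
  /-- the Reeb vector field -/
  ξ : ∀ x : M, TangentSpace (𝓡 3) x
  /-- the endomorphism field -/
  φ : ∀ x : M, TangentSpace (𝓡 3) x →L[ℝ] TangentSpace (𝓡 3) x
  smooth_η : ∀ X, IsSmoothField X → ContMDiff (𝓡 3) 𝓘(ℝ, ℝ) ∞ (fun x => η x (X x))
  smooth_ξ : IsSmoothField ξ
  smooth_φ : ∀ X, IsSmoothField X → IsSmoothField (fun x => φ x (X x))
  /-- `η ∧ dη` vanishes nowhere -/
  contact : ∀ x, ∃ X Y Z, IsSmoothField X ∧ IsSmoothField Y ∧ IsSmoothField Z ∧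
    η x (X x) * dOneForm η Y Z x + η x (Y x) * dOneForm η Z X x
      + η x (Z x) * dOneForm η X Y x ≠ 0
  η_ξ : ∀ x, η x (ξ x) = 1
  dη_ξ : ∀ X, IsSmoothField X → ∀ x, dOneForm η ξ X x = 0
  φ_sq : ∀ x v, φ x (φ x v) = -v + η x v • ξ x
  metric_φ : ∀ x (v w : TangentSpace (𝓡 3) x),
    inner ℝ (φ x v) (φ x w) = inner ℝ v w - η x v * η x w
  metric_ξ : ∀ x (v : TangentSpace (𝓡 3) x), inner ℝ (ξ x) v = η x v
  associated : ∀ X Y, IsSmoothField X → IsSmoothField Y → ∀ x,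
    dOneForm η X Y x = 2 * inner ℝ (X x) (φ x (Y x))
  /-- `(∇_X φ) Y = g(X, Y) ξ - η(Y) X` -/
  sasaki : ∀ X Y, IsSmoothField X → IsSmoothField Y → ∀ x,
    leviCivita (𝓡 3) X (fun y => φ y (Y y)) x - φ x (leviCivita (𝓡 3) X Y x)
      = (inner ℝ (X x) (Y x) : ℝ) • ξ x - η x (Y x) • X x

variable {M}

/-- `Φ` is the flow of the Reeb field; it is a one-parameter group `K` of isometries, and `K` acts
simply transitively on each of its orbits. A Sasaki structure is regular if its Reeb field
generates such a group and the orbit space `M / K` is a manifold (see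
`IsBoothbyWangFibering`). -/
structure IsRegularFlow (σ : SasakiStructure M) (Φ : ℝ → M → M) : Prop where
  smooth : ContMDiff (𝓘(ℝ, ℝ).prod (𝓡 3)) (𝓡 3) ∞ (fun p : ℝ × M => Φ p.1 p.2)
  zero : ∀ x, Φ 0 x = x
  add : ∀ s t x, Φ (s + t) x = Φ s (Φ t x)
  generator : ∀ x, IsMIntegralCurve (I := 𝓡 3) (fun t => Φ t x) σ.ξ
  isometry : ∀ t x (v w : TangentSpace (𝓡 3) x),
    inner ℝ (mfderiv (𝓡 3) (𝓡 3) (Φ t) x v) (mfderiv (𝓡 3) (𝓡 3) (Φ t) x w) = inner ℝ v w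
  free : ∀ s t x, Φ s x = Φ t x → Φ s = Φ t

variable {B : Type*} [TopologicalSpace B] [ChartedSpace (EuclideanSpace ℝ (Fin 2)) B]

/-- The horizontal lift to `p` of a vector tangent to the base at `pr p`: the vector orthogonal to
`ξ` that `pr` maps to the given one. -/
def horizontalLift (σ : SasakiStructure M) (pr : M → B) (p : M)
    (u : TangentSpace (𝓡 2) (pr p)) : TangentSpace (𝓡 3) p :=
  Classical.epsilon (fun v => σ.η p v = 0 ∧ mfderiv (𝓡 3) (𝓡 2) pr p v = u)

/-- The almost complex structure `J X = pr_* (φ X^*)` of the base, computed at a point `p` of the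
fibre over `b`. -/
def complexStructure (σ : SasakiStructure M) (pr : M → B) (hpr : Function.Surjective pr) (b : B)
    (u : TangentSpace (𝓡 2) b) : TangentSpace (𝓡 2) b :=
  let p : M := Function.surjInv hpr b
  mfderiv (𝓡 3) (𝓡 2) pr p (σ.φ p (horizontalLift σ pr p u))

variable [RiemannianBundle (fun b : B => TangentSpace (𝓡 2) b)]

/-- `pr : M → B` exhibits the surface `B` as the orbit space of the Reeb flow `Φ`, with its quotient
smooth structure and the metric that makes `pr` a Riemannian submersion. -/
structure IsBoothbyWangFibering (σ : SasakiStructure M) (Φ : ℝ → M → M) (pr : M → B) : Prop where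
  surjective : Function.Surjective pr
  smooth : ContMDiff (𝓡 3) (𝓡 2) ∞ pr
  submersion : ∀ x, Function.Surjective (mfderiv (𝓡 3) (𝓡 2) pr x)
  fibre : ∀ x y, pr x = pr y ↔ ∃ t, Φ t x = y
  isometry : ∀ x (v w : TangentSpace (𝓡 3) x), σ.η x v = 0 → σ.η x w = 0 →
    inner ℝ (mfderiv (𝓡 3) (𝓡 2) pr x v) (mfderiv (𝓡 3) (𝓡 2) pr x w) = inner ℝ v w

end Sasaki

section Curves

variable {B : Type*} [TopologicalSpace B] [ChartedSpace (EuclideanSpace ℝ (Fin 2)) B]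

/-- The velocity of a curve. -/
def velocity (γ : ℝ → B) (s : ℝ) : TangentSpace (𝓡 2) (γ s) :=
  mfderiv 𝓘(ℝ, ℝ) (𝓡 2) γ s (1 : ℝ)

variable [IsManifold (𝓡 2) ∞ B] [RiemannianBundle (fun b : B => TangentSpace (𝓡 2) b)]

/-- A smooth curve on the open interval `T`, parametrised by arclength. -/
structure IsUnitSpeedCurve (T : Set ℝ) (γ : ℝ → B) : Prop where
  isOpen : IsOpen T
  ordConnected : T.OrdConnected
  smooth : ContMDiffOn 𝓘(ℝ, ℝ) (𝓡 2) ∞ γ T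
  unit_speed : ∀ s ∈ T, inner ℝ (velocity γ s) (velocity γ s) = (1 : ℝ)

/-- The acceleration `∇_{γ'} γ'` of a curve. -/
def acceleration (γ : ℝ → B) (s : ℝ) : TangentSpace (𝓡 2) (γ s) :=
  covAlong 𝓘(ℝ, ℝ) (𝓡 2) γ (velocity γ) s (1 : ℝ)

/-- The signed curvature `⟨∇_{γ'} γ', J γ'⟩` of a unit speed curve in a surface with
almost complex structure `J`. -/
def signedCurvature (J : ∀ b : B, TangentSpace (𝓡 2) b → TangentSpace (𝓡 2) b) (γ : ℝ → B)
    (s : ℝ) : ℝ :=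
  inner ℝ (acceleration γ s) (J (γ s) (velocity γ s))

/-- Geodesics: `∇_{γ'} γ' = 0`. -/
def IsGeodesic (T : Set ℝ) (γ : ℝ → B) : Prop := ∀ s ∈ T, acceleration γ s = 0

/-- Riemannian circles: the curvature is a nonzero constant. -/
def IsRiemannianCircle (J : ∀ b : B, TangentSpace (𝓡 2) b → TangentSpace (𝓡 2) b) (T : Set ℝ)
    (γ : ℝ → B) : Prop :=
  ∃ c : ℝ, c ≠ 0 ∧ ∀ s ∈ T, signedCurvature J γ s = c

/-- Riemannian clothoids: the curvature is a nonconstant linear function of the arclength. -/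
def IsRiemannianClothoid (J : ∀ b : B, TangentSpace (𝓡 2) b → TangentSpace (𝓡 2) b) (T : Set ℝ)
    (γ : ℝ → B) : Prop :=
  ∃ a c : ℝ, a ≠ 0 ∧ ∀ s ∈ T, signedCurvature J γ s = a * s + c

end Curves

/-- The immersed surface `ι : S → M` is the inverse image `pr⁻¹(γ)` of the curve `γ : T → B`. As `γ`
may cross itself, the inverse image is understood as the surface
`{(s, p) | s ∈ T, pr p = γ s}`, immersed in `M` by `(s, p) ↦ p` and endowed with the metric induced
by this immersion; the function `s` on `S` is the parameter of `γ`. -/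
structure IsHopfCylinder
    {M : Type*} [TopologicalSpace M] [ChartedSpace (EuclideanSpace ℝ (Fin 3)) M]
    [RiemannianBundle (fun x : M => TangentSpace (𝓡 3) x)]
    {B : Type*} (pr : M → B) (T : Set ℝ) (γ : ℝ → B)
    {S : Type*} [TopologicalSpace S] [ChartedSpace (EuclideanSpace ℝ (Fin 2)) S]
    [RiemannianBundle (fun q : S => TangentSpace (𝓡 2) q)]
    (s : S → ℝ) (ι : S → M) : Prop where
  embedding : Manifold.IsSmoothEmbedding (𝓡 2) (𝓘(ℝ, ℝ).prod (𝓡 3)) ∞ (fun q => (s q, ι q))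
  range_eq : Set.range (fun q => (s q, ι q)) = {z : ℝ × M | z.1 ∈ T ∧ pr z.2 = γ z.1}
  isometric : ∀ q (v w : TangentSpace (𝓡 2) q),
    inner ℝ (mfderiv (𝓡 2) (𝓡 3) ι q v) (mfderiv (𝓡 2) (𝓡 3) ι q w) = inner ℝ v w

end SasakiHopf

end

noncomputable section

namespace SasakiHopf

section Calculus

variable {E' : Type*} [NormedAddCommGroup E'] [NormedSpace ℝ E']
  {H' : Type*} [TopologicalSpace H'] {I' : ModelWithCorners ℝ E' H'}
  {N : Type*} [TopologicalSpace N] [ChartedSpace H' N]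
  {F : Type*} [NormedAddCommGroup F] [NormedSpace ℝ F]
  {G : Type*} [NormedAddCommGroup G] [NormedSpace ℝ G]

theorem mvfderiv_congr {f g : N → F} {q : N} (h : f =ᶠ[nhds q] g) :
    mvfderiv I' f q = mvfderiv I' g q := by
  have h1 := h.mfderiv_eq (I := I') (I' := 𝓘(ℝ, F))
  ext v
  exact congrArg (fun L : TangentSpace I' q →L[ℝ] F => L v) h1

theorem mvfderiv_clm_apply {A : N → F →L[ℝ] G} {u : N → F} {q : N}
    (hA : MDifferentiableAt I' 𝓘(ℝ, F →L[ℝ] G) A q) (hu : MDifferentiableAt I' 𝓘(ℝ, F) u q)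
    (v : TangentSpace I' q) :
    mvfderiv I' (fun q' => A q' (u q')) q v
      = mvfderiv I' A q v (u q) + A q (mvfderiv I' u q v) := by
  have hAu : MDifferentiableAt I' 𝓘(ℝ, G) (fun q' => A q' (u q')) q := hA.clm_apply hu
  have hU : UniqueDiffWithinAt ℝ (Set.range I') (extChartAt I' q q) :=
    I'.uniqueDiffOn _ (Set.mem_range_self _)
  have h1 := hA.differentiableWithinAt_writtenInExtChartAt
  have h2 := hu.differentiableWithinAt_writtenInExtChartAt
  have key := fderivWithin_clm_apply (x := extChartAt I' q q) hU h1 h2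
  have e0 := DFunLike.congr_fun hAu.mvfderiv v
  have e1 := DFunLike.congr_fun hA.mvfderiv v
  have e2 := DFunLike.congr_fun hu.mvfderiv v
  have e3 := DFunLike.congr_fun key v
  rw [e0, e1, e2]
  refine e3.trans ?_
  simp [writtenInExtChartAt, add_comm]
  rfl

theorem mvfderiv_comp_vector {E : Type*} [NormedAddCommGroup E] [NormedSpace ℝ E]
    {H : Type*} [TopologicalSpace H] {I : ModelWithCorners ℝ E H}
    {M : Type*} [TopologicalSpace M] [ChartedSpace H M]
    {g : M → F} {f : N → M} {q : N}
    (hg : MDifferentiableAt I 𝓘(ℝ, F) g (f q)) (hf : MDifferentiableAt I' I f q)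
    (v : TangentSpace I' q) :
    mvfderiv I' (fun q' => g (f q')) q v = mvfderiv I g (f q) (mfderiv I' I f q v) :=
  mfderiv_comp_apply q hg hf v

theorem mvfderiv_eventuallyEq_const {f : N → F} {c : F} {q : N} (h : ∀ᶠ q' in nhds q, f q' = c) :
    mvfderiv I' f q = 0 := by
  rw [mvfderiv_congr (g := fun _ => c) h, mvfderiv_const]

end Calculus

section Coordinates

variable (E : Type*) [NormedAddCommGroup E] [NormedSpace ℝ E]
  {M : Type*} [TopologicalSpace M] [ChartedSpace E M] [IsManifold 𝓘(ℝ, E) ∞ M]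

/-- The coordinates, in the chart at `x`, of vectors tangent at `y`. -/
def tangentCoord (x y : M) : TangentSpace 𝓘(ℝ, E) y →L[ℝ] E :=
  (trivializationAt E (TangentSpace 𝓘(ℝ, E)) x).continuousLinearMapAt ℝ y

/-- The vector tangent at `y` with given coordinates in the chart at `x`. -/
def coordFrame (x y : M) : E →L[ℝ] TangentSpace 𝓘(ℝ, E) y :=
  (trivializationAt E (TangentSpace 𝓘(ℝ, E)) x).symmL ℝ y

variable {E}

theorem trivializationAt_snd {x y : M} (hy : y ∈ (chartAt E x).source)
    (w : TangentSpace 𝓘(ℝ, E) y) :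
    (trivializationAt E (TangentSpace 𝓘(ℝ, E)) x ⟨y, w⟩).2 = tangentCoord E x y w := by
  rw [tangentCoord, Trivialization.continuousLinearMapAt_apply,
    Trivialization.coe_linearMapAt_of_mem _ (by simpa using hy)]

theorem coordFrame_tangentCoord {x y : M} (hy : y ∈ (chartAt E x).source)
    (w : TangentSpace 𝓘(ℝ, E) y) : coordFrame E x y (tangentCoord E x y w) = w :=
  Trivialization.symmL_continuousLinearMapAt _ (by simpa using hy) w

theorem tangentCoord_coordFrame {x y : M} (hy : y ∈ (chartAt E x).source) (e : E) :
    tangentCoord E x y (coordFrame E x y e) = e :=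
  Trivialization.continuousLinearMapAt_symmL _ (by simpa using hy) e

theorem tangentCoord_eq_mfderiv {x y : M} (hy : y ∈ (chartAt E x).source) :
    tangentCoord E x y = mfderiv 𝓘(ℝ, E) 𝓘(ℝ, E) (extChartAt 𝓘(ℝ, E) x) y :=
  TangentBundle.continuousLinearMapAt_trivializationAt hy

theorem coordFrame_eq_mfderiv {x y : M} (hy : y ∈ (chartAt E x).source) :
    coordFrame E x y = mfderiv 𝓘(ℝ, E) 𝓘(ℝ, E) (extChartAt 𝓘(ℝ, E) x).symm
      (extChartAt 𝓘(ℝ, E) x y) := by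
  have h := TangentBundle.symmL_trivializationAt (I := 𝓘(ℝ, E)) (𝕜 := ℝ) hy
  rw [modelWithCornersSelf_coe, Set.range_id, mfderivWithin_univ] at h
  exact h

theorem tangentCoord_self (x : M) (w : TangentSpace 𝓘(ℝ, E) x) : tangentCoord E x x w = w := by
  rw [tangentCoord_eq_mfderiv (mem_chart_source E x), mfderiv_extChartAt_self]
  rfl

theorem coordFrame_self (x : M) (e : E) : coordFrame E x x e = e := by
  have h := coordFrame_tangentCoord (mem_chart_source E x) (x := x) e
  rwa [tangentCoord_self (E := E) x e] at h

theorem extend_eq_coordFrame {x y : M} (hy : y ∈ (chartAt E x).source)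
    (v : TangentSpace 𝓘(ℝ, E) x) : FiberBundle.extend E v y = coordFrame E x y v := by
  have h := trivializationAt_snd (mem_chart_source E x) v
  rw [tangentCoord_self] at h
  rw [FiberBundle.extend, h]
  exact (Trivialization.symmL_apply (R := ℝ) (trivializationAt E (TangentSpace 𝓘(ℝ, E)) x) hy v).symm

theorem trivializationAt_symm_self (x : M) (e : E) :
    (trivializationAt E (TangentSpace 𝓘(ℝ, E)) x).symm x e = e :=
  (Trivialization.symmL_apply (R := ℝ) (trivializationAt E (TangentSpace 𝓘(ℝ, E)) x)
    (mem_chart_source E x) e).symm.trans (coordFrame_self x e)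

end Coordinates

section Bracket

variable {E : Type*} [NormedAddCommGroup E] [NormedSpace ℝ E]
  {M : Type*} [TopologicalSpace M] [ChartedSpace E M]
  {F : Type*} [NormedAddCommGroup F] [NormedSpace ℝ F]

theorem lieBracketWithin_congr_nhds {V W v w : E → E} {z : E} {s : Set E} (hs : s = Set.univ)
    (hV : V =ᶠ[nhds z] v) (hW : W =ᶠ[nhds z] w) :
    VectorField.lieBracketWithin ℝ V W s z = fderiv ℝ w z (v z) - fderiv ℝ v z (w z) := by
  rw [hs, VectorField.lieBracketWithin_univ, Filter.EventuallyEq.lieBracket_vectorField_eq hV hW,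
    VectorField.lieBracket_eq]

theorem fderiv_comp_extChartAt_symm {h : M → F} {x : M}
    (hh : MDifferentiableAt 𝓘(ℝ, E) 𝓘(ℝ, F) h x) :
    fderiv ℝ (h ∘ (extChartAt 𝓘(ℝ, E) x).symm) (extChartAt 𝓘(ℝ, E) x x)
      = mvfderiv 𝓘(ℝ, E) h x := by
  have h1 := hh.mvfderiv
  rw [modelWithCornersSelf_coe, Set.range_id, fderivWithin_univ] at h1
  exact h1.symm

variable (E) in
omit [NormedSpace ℝ E] in
theorem eventually_mem_chart_source (x : M) : ∀ᶠ y in nhds x, y ∈ (chartAt E x).source :=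
  (chartAt E x).open_source.mem_nhds (mem_chart_source E x)

variable [IsManifold 𝓘(ℝ, E) ∞ M]

theorem mpullbackWithin_extChartAt_symm (x : M) (Z : ∀ y : M, TangentSpace 𝓘(ℝ, E) y) :
    (VectorField.mpullbackWithin 𝓘(ℝ, E) 𝓘(ℝ, E) (extChartAt 𝓘(ℝ, E) x).symm Z
        (Set.range 𝓘(ℝ, E)) : E → E)
      =ᶠ[nhds (extChartAt 𝓘(ℝ, E) x x)]
        ((fun y => tangentCoord E x y (Z y)) ∘ (extChartAt 𝓘(ℝ, E) x).symm : E → E) := by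
  filter_upwards [extChartAt_target_mem_nhds (I := 𝓘(ℝ, E)) x] with z hz
  have hs : (extChartAt 𝓘(ℝ, E) x).symm z ∈ (chartAt E x).source := by
    simpa using (extChartAt 𝓘(ℝ, E) x).map_target hz
  have e1 := mfderiv_extChartAt_comp_mfderivWithin_extChartAt_symm hz
  have e2 := mfderivWithin_extChartAt_symm_comp_mfderiv_extChartAt hz
  change (mfderivWithin 𝓘(ℝ, E) 𝓘(ℝ, E) (extChartAt 𝓘(ℝ, E) x).symm
      (Set.range 𝓘(ℝ, E)) z).inverse (Z ((extChartAt 𝓘(ℝ, E) x).symm z))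
    = tangentCoord E x _ (Z ((extChartAt 𝓘(ℝ, E) x).symm z))
  rw [ContinuousLinearMap.inverse_eq e2 e1, tangentCoord_eq_mfderiv hs]
  rfl

/-- The Lie bracket in coordinates. -/
theorem mlieBracket_eq_mvfderiv_tangentCoord (X Y : ∀ y : M, TangentSpace 𝓘(ℝ, E) y) (x : M)
    (hX : MDifferentiableAt 𝓘(ℝ, E) 𝓘(ℝ, E) (fun y => tangentCoord E x y (X y)) x)
    (hY : MDifferentiableAt 𝓘(ℝ, E) 𝓘(ℝ, E) (fun y => tangentCoord E x y (Y y)) x) :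
    VectorField.mlieBracket 𝓘(ℝ, E) X Y x
      = mvfderiv 𝓘(ℝ, E) (fun y => tangentCoord E x y (Y y)) x (X x)
        - mvfderiv 𝓘(ℝ, E) (fun y => tangentCoord E x y (X y)) x (Y x) := by
  have hid : (mfderiv 𝓘(ℝ, E) 𝓘(ℝ, E) (extChartAt 𝓘(ℝ, E) x) x : E →L[ℝ] E).inverse
      = ContinuousLinearMap.id ℝ E :=
    (congrArg ContinuousLinearMap.inverse
      (mfderiv_extChartAt_self (I := 𝓘(ℝ, E)) (x := x) : (_ : E →L[ℝ] E) = _)).trans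
      ContinuousLinearMap.inverse_id
  have key := lieBracketWithin_congr_nhds
    (s := (extChartAt 𝓘(ℝ, E) x).symm ⁻¹' Set.univ ∩ Set.range 𝓘(ℝ, E))
    (by simp) (mpullbackWithin_extChartAt_symm x X) (mpullbackWithin_extChartAt_symm x Y)
  have e (Z : ∀ y : M, TangentSpace 𝓘(ℝ, E) y) :
      ((fun y => tangentCoord E x y (Z y)) ∘ (extChartAt 𝓘(ℝ, E) x).symm : E → E)
        (extChartAt 𝓘(ℝ, E) x x) = Z x := by
    have h0 : (extChartAt 𝓘(ℝ, E) x).symm (extChartAt 𝓘(ℝ, E) x x) = x := extChartAt_to_inv x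
    change tangentCoord E x _ (Z ((extChartAt 𝓘(ℝ, E) x).symm (extChartAt 𝓘(ℝ, E) x x))) = Z x
    rw [h0]
    exact tangentCoord_self x (Z x)
  rw [fderiv_comp_extChartAt_symm hX, fderiv_comp_extChartAt_symm hY, e X, e Y] at key
  exact (VectorField.mlieBracketWithin_apply.trans (DFunLike.congr_fun hid _)).trans key

theorem tangentCoord_extend {x : M} (v : TangentSpace 𝓘(ℝ, E) x) :
    ∀ᶠ y in nhds x, tangentCoord E x y (FiberBundle.extend E v y) = v := by
  filter_upwards [eventually_mem_chart_source E x] with y hy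
  rw [extend_eq_coordFrame hy]
  exact tangentCoord_coordFrame (E := E) hy v

theorem mlieBracket_extend {x : M} (u v : TangentSpace 𝓘(ℝ, E) x) :
    VectorField.mlieBracket 𝓘(ℝ, E) (FiberBundle.extend E u) (FiberBundle.extend E v) x = 0 := by
  have hc (e : E) : MDifferentiableAt 𝓘(ℝ, E) 𝓘(ℝ, E) (fun _ : M => e) x :=
    mdifferentiableAt_const
  have h (w : TangentSpace 𝓘(ℝ, E) x) : MDifferentiableAt 𝓘(ℝ, E) 𝓘(ℝ, E)
      (fun y : M => tangentCoord E x y (FiberBundle.extend E w y)) x :=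
    (hc w).congr_of_eventuallyEq (tangentCoord_extend (E := E) w)
  have h0 (w : TangentSpace 𝓘(ℝ, E) x) : mvfderiv 𝓘(ℝ, E)
      (fun y : M => tangentCoord E x y (FiberBundle.extend E w y)) x = 0 :=
    mvfderiv_eventuallyEq_const (F := E) (c := (w : E)) (tangentCoord_extend (E := E) w)
  rw [mlieBracket_eq_mvfderiv_tangentCoord _ _ x (h u) (h v), h0, h0]
  exact sub_self (0 : E)

end Bracket

section Metric

variable {E : Type*} [NormedAddCommGroup E] [NormedSpace ℝ E]
  {M : Type*} [TopologicalSpace M] [ChartedSpace E M] [IsManifold 𝓘(ℝ, E) ∞ M]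
  [RiemannianBundle (fun x : M => TangentSpace 𝓘(ℝ, E) x)]

variable (E) in
/-- The coefficients of the metric in the chart at `x`. -/
def metricCoord (x y : M) : E →L[ℝ] E →L[ℝ] ℝ :=
  (innerSL ℝ : TangentSpace 𝓘(ℝ, E) y →L[ℝ] TangentSpace 𝓘(ℝ, E) y →L[ℝ] ℝ).bilinearComp
    (coordFrame E x y) (coordFrame E x y)

theorem metricCoord_apply (x y : M) (a b : E) :
    metricCoord E x y a b = inner ℝ (coordFrame E x y a) (coordFrame E x y b) := rfl

theorem metricCoord_self (x : M) (a b : TangentSpace 𝓘(ℝ, E) x) :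
    metricCoord E x x a b = inner ℝ a b := by
  exact congrArg₂ (fun p q : TangentSpace 𝓘(ℝ, E) x => (inner ℝ p q : ℝ))
    (coordFrame_self (E := E) x a) (coordFrame_self (E := E) x b)

theorem metricCoord_tangentCoord {x y : M} (hy : y ∈ (chartAt E x).source)
    (a b : TangentSpace 𝓘(ℝ, E) y) :
    metricCoord E x y (tangentCoord E x y a) (tangentCoord E x y b) = inner ℝ a b := by
  rw [metricCoord_apply, coordFrame_tangentCoord hy, coordFrame_tangentCoord hy]

theorem contMDiffAt_metricCoord
    [h : IsContMDiffRiemannianBundle 𝓘(ℝ, E) ∞ E (fun x : M => TangentSpace 𝓘(ℝ, E) x)] (x : M) :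
    ContMDiffAt 𝓘(ℝ, E) 𝓘(ℝ, E →L[ℝ] E →L[ℝ] ℝ) ∞ (metricCoord E x) x := by
  obtain ⟨g, hg, hgi⟩ := h.exists_contMDiff
  have h1 := ((contMDiffAt_hom_bundle _).1 (hg x)).2
  refine h1.congr_of_eventuallyEq ?_
  filter_upwards [eventually_mem_chart_source E x] with y hy
  ext a b
  have h2 := inCoordinates_apply_eq₂ (F₁ := E) (F₂ := E) (F₃ := ℝ) (𝕜 := ℝ)
    (E₁ := fun x : M => TangentSpace 𝓘(ℝ, E) x) (E₂ := fun x : M => TangentSpace 𝓘(ℝ, E) x)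
    (E₃ := Bundle.Trivial M ℝ) (x₀ := x) (x := y) (ϕ := g y) (v := a) (w := b)
    hy hy (Set.mem_univ _)
  refine Eq.trans ?_ h2.symm
  rw [metricCoord_apply, hgi, coordFrame, Trivialization.symmL_apply (R := ℝ)
    (trivializationAt E (TangentSpace 𝓘(ℝ, E)) x) hy a, Trivialization.symmL_apply (R := ℝ)
    (trivializationAt E (TangentSpace 𝓘(ℝ, E)) x) hy b]
  simp

end Metric

section Christoffel

variable {E : Type*} [NormedAddCommGroup E] [NormedSpace ℝ E] [FiniteDimensional ℝ E]
  {M : Type*} [TopologicalSpace M] [ChartedSpace E M] [IsManifold 𝓘(ℝ, E) ∞ M]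
  [RiemannianBundle (fun x : M => TangentSpace 𝓘(ℝ, E) x)]

/-- The first derivatives of the metric coefficients at the centre of a chart. -/
def metricDeriv (x : M) (a v w : TangentSpace 𝓘(ℝ, E) x) : ℝ :=
  mvfderiv 𝓘(ℝ, E) (metricCoord E x) x a v w

/-- The Levi-Civita derivative of coordinate fields at the centre of a chart. -/
def christoffel (x : M) (u v : TangentSpace 𝓘(ℝ, E) x) : TangentSpace 𝓘(ℝ, E) x :=
  leviCivita 𝓘(ℝ, E) (FiberBundle.extend E u) (FiberBundle.extend E v) x

omit [FiniteDimensional ℝ E] in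
theorem metricDeriv_add_left (x : M) (a b v w : TangentSpace 𝓘(ℝ, E) x) :
    metricDeriv x (a + b) v w = metricDeriv x a v w + metricDeriv x b v w :=
  LinearMap.congr_fun₂ (congrArg (fun L : E →L[ℝ] E →L[ℝ] ℝ => L.toLinearMap₁₂)
    (map_add (mvfderiv 𝓘(ℝ, E) (metricCoord E x) x) a b)) v w

omit [FiniteDimensional ℝ E] in
theorem metricDeriv_smul_left (x : M) (c : ℝ) (a v w : TangentSpace 𝓘(ℝ, E) x) :
    metricDeriv x (c • a) v w = c * metricDeriv x a v w :=
  LinearMap.congr_fun₂ (congrArg (fun L : E →L[ℝ] E →L[ℝ] ℝ => L.toLinearMap₁₂)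
    (map_smul (mvfderiv 𝓘(ℝ, E) (metricCoord E x) x) c a)) v w

omit [FiniteDimensional ℝ E] in
theorem metricDeriv_add_right (x : M) (a v w z : TangentSpace 𝓘(ℝ, E) x) :
    metricDeriv x a v (w + z) = metricDeriv x a v w + metricDeriv x a v z :=
  map_add (mvfderiv 𝓘(ℝ, E) (metricCoord E x) x a v) w z

omit [FiniteDimensional ℝ E] in
theorem metricDeriv_smul_right (x : M) (c : ℝ) (a v w : TangentSpace 𝓘(ℝ, E) x) :
    metricDeriv x a v (c • w) = c * metricDeriv x a v w :=
  map_smul (mvfderiv 𝓘(ℝ, E) (metricCoord E x) x a v) c w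

omit [FiniteDimensional ℝ E] in
theorem metricDeriv_symm (x : M) (a v w : TangentSpace 𝓘(ℝ, E) x)
    (hD : MDifferentiableAt 𝓘(ℝ, E) 𝓘(ℝ, E →L[ℝ] E →L[ℝ] ℝ) (metricCoord E x) x) :
    metricDeriv x a v w = metricDeriv x a w v := by
  have h (e f : E) : mvfderiv 𝓘(ℝ, E) (metricCoord E x) x a e f
      = mvfderiv 𝓘(ℝ, E) (fun y => metricCoord E x y e f) x a := by
    have h1 := mvfderiv_clm_apply (G := E →L[ℝ] ℝ) (u := fun _ => e) hD mdifferentiableAt_const a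
    have h2 := mvfderiv_clm_apply (u := fun _ => f) (hD.clm_apply (f := fun _ => e)
      mdifferentiableAt_const) mdifferentiableAt_const a
    rw [mvfderiv_const] at h1 h2
    rw [h2, h1]
    simp
  refine (h v w).trans (Eq.trans ?_ (h w v).symm)
  congr 2
  ext y
  exact real_inner_comm (F := TangentSpace 𝓘(ℝ, E) y) _ _

variable [IsContMDiffRiemannianBundle 𝓘(ℝ, E) ∞ E (fun x : M => TangentSpace 𝓘(ℝ, E) x)]

omit [FiniteDimensional ℝ E] in
theorem mdifferentiableAt_metricCoord (x : M) :
    MDifferentiableAt 𝓘(ℝ, E) 𝓘(ℝ, E →L[ℝ] E →L[ℝ] ℝ) (metricCoord E x) x :=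
  (contMDiffAt_metricCoord x).mdifferentiableAt (by simp)

omit [FiniteDimensional ℝ E] in
theorem mvfderiv_inner_extend (x : M) (a v w : TangentSpace 𝓘(ℝ, E) x) :
    mvfderiv 𝓘(ℝ, E) (fun y : M => (inner ℝ (FiberBundle.extend E v y)
      (FiberBundle.extend E w y) : ℝ)) x a = metricDeriv x a v w := by
  have hD := mdifferentiableAt_metricCoord x (E := E)
  have key (e f : E) : mvfderiv 𝓘(ℝ, E) (fun y => metricCoord E x y e f) x a
      = mvfderiv 𝓘(ℝ, E) (metricCoord E x) x a e f := by
    have h1 := mvfderiv_clm_apply (G := E →L[ℝ] ℝ) (u := fun _ => e) hD mdifferentiableAt_const a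
    have h2 := mvfderiv_clm_apply (u := fun _ => f) (hD.clm_apply (f := fun _ => e)
      mdifferentiableAt_const) mdifferentiableAt_const a
    rw [mvfderiv_const] at h1 h2
    rw [h2, h1]
    simp
  refine Eq.trans ?_ (key v w)
  refine DFunLike.congr_fun (mvfderiv_congr ?_) a
  filter_upwards [eventually_mem_chart_source E x] with y hy
  rw [extend_eq_coordFrame hy, extend_eq_coordFrame hy]
  rfl

theorem inner_christoffel (x : M) (u v w : TangentSpace 𝓘(ℝ, E) x) :
    2 * inner ℝ (christoffel x u v) w
      = metricDeriv x u v w + metricDeriv x v u w - metricDeriv x w u v := by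
  have hk (z : TangentSpace 𝓘(ℝ, E) x) : koszul 𝓘(ℝ, E) (FiberBundle.extend E u)
      (FiberBundle.extend E v) (FiberBundle.extend E z) x
      = metricDeriv x u v z + metricDeriv x v u z - metricDeriv x z u v := by
    rw [koszul, mvfderiv_inner_extend, mvfderiv_inner_extend, mvfderiv_inner_extend,
      mlieBracket_extend, mlieBracket_extend, mlieBracket_extend]
    simp
  let L : TangentSpace 𝓘(ℝ, E) x →ₗ[ℝ] ℝ :=
    { toFun := fun z => metricDeriv x u v z + metricDeriv x v u z - metricDeriv x z u v
      map_add' := fun z z' => by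
        simp only [metricDeriv_add_left, metricDeriv_add_right]; ring
      map_smul' := fun c z => by
        simp only [metricDeriv_smul_left, metricDeriv_smul_right, RingHom.id_apply, smul_eq_mul]
        ring }
  have hL : L w = ∑ i, inner ℝ (stdOrthonormalBasis ℝ (TangentSpace 𝓘(ℝ, E) x) i) w
      * L (stdOrthonormalBasis ℝ (TangentSpace 𝓘(ℝ, E) x) i) := by
    conv_lhs => rw [← (stdOrthonormalBasis ℝ (TangentSpace 𝓘(ℝ, E) x)).sum_repr' w]
    simp only [map_sum, map_smul, smul_eq_mul]
  refine Eq.trans ?_ hL.symm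
  rw [christoffel, leviCivita]
  simp only [hk, sum_inner, real_inner_smul_left, Finset.mul_sum]
  refine Finset.sum_congr rfl fun i _ => ?_
  simp only [L, LinearMap.coe_mk, AddHom.coe_mk]
  ring

theorem christoffel_symm (x : M) (u v : TangentSpace 𝓘(ℝ, E) x) :
    christoffel x u v = christoffel x v u := by
  refine ext_inner_right ℝ fun w => ?_
  have h1 := inner_christoffel x u v w
  have h2 := inner_christoffel x v u w
  rw [metricDeriv_symm x w v u (mdifferentiableAt_metricCoord x)] at h2
  linarith

theorem metricDeriv_eq (x : M) (a v w : TangentSpace 𝓘(ℝ, E) x) :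
    metricDeriv x a v w = inner ℝ (christoffel x a v) w + inner ℝ v (christoffel x a w) := by
  have h1 := inner_christoffel x a v w
  have h2 := inner_christoffel x a w v
  have hD := mdifferentiableAt_metricCoord (E := E) x
  rw [real_inner_comm] at h2
  rw [metricDeriv_symm x w a v hD] at h1
  rw [metricDeriv_symm x a w v hD, metricDeriv_symm x v a w hD] at h2
  rw [metricDeriv_symm x v a w hD, metricDeriv_symm x w v a hD] at *
  linarith

theorem christoffel_add_right (x : M) (u v w : TangentSpace 𝓘(ℝ, E) x) :
    christoffel x u (v + w) = christoffel x u v + christoffel x u w := by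
  refine ext_inner_right ℝ fun z => ?_
  have h1 := inner_christoffel x u v z
  have h2 := inner_christoffel x u w z
  have h3 := inner_christoffel x u (v + w) z
  have hD := mdifferentiableAt_metricCoord (E := E) x
  rw [metricDeriv_add_left, metricDeriv_add_right, metricDeriv_symm x u _ _ hD,
    metricDeriv_add_right] at h3
  rw [metricDeriv_symm x u _ _ hD] at h1 h2
  rw [inner_add_left]
  linarith

theorem christoffel_smul_right (x : M) (c : ℝ) (u v : TangentSpace 𝓘(ℝ, E) x) :
    christoffel x u (c • v) = c • christoffel x u v := by
  refine ext_inner_right ℝ fun z => ?_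
  have h1 := inner_christoffel x u v z
  have h3 := inner_christoffel x u (c • v) z
  have hD := mdifferentiableAt_metricCoord (E := E) x
  rw [metricDeriv_smul_left, metricDeriv_smul_right, metricDeriv_symm x u _ _ hD,
    metricDeriv_smul_right] at h3
  rw [metricDeriv_symm x u _ _ hD] at h1
  rw [real_inner_smul_left]
  linear_combination (1 / 2) * h3 - (c / 2) * h1

theorem christoffel_smul_left (x : M) (c : ℝ) (u v : TangentSpace 𝓘(ℝ, E) x) :
    christoffel x (c • u) v = c • christoffel x u v := by
  simp only [christoffel_symm x _ v, christoffel_smul_right]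

end Christoffel

section Along

variable {E' : Type*} [NormedAddCommGroup E'] [NormedSpace ℝ E']
  {H' : Type*} [TopologicalSpace H'] {I' : ModelWithCorners ℝ E' H'}
  {N : Type*} [TopologicalSpace N] [ChartedSpace H' N]
  {E : Type*} [NormedAddCommGroup E] [NormedSpace ℝ E]
  {M : Type*} [TopologicalSpace M] [ChartedSpace E M] [IsManifold 𝓘(ℝ, E) ∞ M]

/-- The coordinates of a vector field along `f` in the chart at `f q`. -/
def coordAlong (f : N → M) (W : ∀ q : N, TangentSpace 𝓘(ℝ, E) (f q)) (q q' : N) : E :=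
  tangentCoord E (f q) (f q') (W q')

/-- `W` is a vector field of class `C^n` along `f`, at the point `q`. -/
def ContMDiffAlongAt (I' : ModelWithCorners ℝ E' H') (n : ℕ∞ω) (f : N → M)
    (W : ∀ q : N, TangentSpace 𝓘(ℝ, E) (f q)) (q : N) : Prop :=
  ContMDiffAt I' 𝓘(ℝ, E).tangent n
    (fun q' => (⟨f q', W q'⟩ : TotalSpace E (TangentSpace 𝓘(ℝ, E) (M := M)))) q

/-- `W` is a differentiable vector field along `f`, at the point `q`. -/
structure MDiffAlongAt (I' : ModelWithCorners ℝ E' H') (f : N → M)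
    (W : ∀ q : N, TangentSpace 𝓘(ℝ, E) (f q)) (q : N) : Prop where
  base : MDifferentiableAt I' 𝓘(ℝ, E) f q
  coord : MDifferentiableAt I' 𝓘(ℝ, E) (coordAlong f W q) q

omit [NormedSpace ℝ E] [IsManifold 𝓘(ℝ, E) ∞ M] in
theorem eventually_map_mem_chart_source {f : N → M} {q : N} (hf : ContinuousAt f q) :
    ∀ᶠ q' in nhds q, f q' ∈ (chartAt E (f q)).source :=
  hf.eventually (eventually_mem_chart_source E (f q))

variable {f : N → M} {W : ∀ q : N, TangentSpace 𝓘(ℝ, E) (f q)} {q : N}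

theorem contMDiffAlongAt_iff {n : ℕ∞ω} :
    ContMDiffAlongAt I' n f W q ↔ ContMDiffAt I' 𝓘(ℝ, E) n f q
      ∧ ContMDiffAt I' 𝓘(ℝ, E) n (coordAlong f W q) q := by
  rw [ContMDiffAlongAt, contMDiffAt_totalSpace]
  refine and_congr_right fun hf => ?_
  have h : (fun q' => (trivializationAt E (TangentSpace 𝓘(ℝ, E)) (f q) ⟨f q', W q'⟩).2)
      =ᶠ[nhds q] coordAlong f W q := by
    filter_upwards [eventually_map_mem_chart_source (E := E) hf.continuousAt] with q' hq'
    exact trivializationAt_snd hq' (W q')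
  exact ⟨fun h1 => h1.congr_of_eventuallyEq h.symm, fun h1 => h1.congr_of_eventuallyEq h⟩

theorem ContMDiffAlongAt.mdiff {n : ℕ∞ω} (h : ContMDiffAlongAt I' n f W q) (hn : n ≠ 0) :
    MDiffAlongAt I' f W q :=
  ⟨(contMDiffAlongAt_iff.1 h).1.mdifferentiableAt hn,
    (contMDiffAlongAt_iff.1 h).2.mdifferentiableAt hn⟩

theorem ContMDiffAlongAt.smul {n : ℕ∞ω} {g : N → ℝ} (hg : ContMDiffAt I' 𝓘(ℝ, ℝ) n g q)
    (hW : ContMDiffAlongAt I' n f W q) : ContMDiffAlongAt I' n f (fun q' => g q' • W q') q := by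
  rw [contMDiffAlongAt_iff] at *
  refine ⟨hW.1, (hg.smul hW.2).congr_of_eventuallyEq (Filter.Eventually.of_forall fun q' => ?_)⟩
  exact map_smul (tangentCoord E (f q) (f q')) (g q') (W q')

theorem ContMDiffAlongAt.congr {n : ℕ∞ω} {V : ∀ q : N, TangentSpace 𝓘(ℝ, E) (f q)}
    (hW : ContMDiffAlongAt I' n f W q) (h : ∀ᶠ q' in nhds q, V q' = W q') :
    ContMDiffAlongAt I' n f V q := by
  refine ContMDiffAt.congr_of_eventuallyEq hW ?_
  filter_upwards [h] with q' hq'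
  rw [hq']

theorem contMDiffAlongAt_extend {n : ℕ∞ω} (x : M) (v : TangentSpace 𝓘(ℝ, E) x) :
    ContMDiffAlongAt 𝓘(ℝ, E) n (fun y : M => y) (FiberBundle.extend E v) x := by
  rw [contMDiffAlongAt_iff]
  have hc (e : E) : ContMDiffAt 𝓘(ℝ, E) 𝓘(ℝ, E) n (fun _ : M => e) x := contMDiffAt_const
  exact ⟨contMDiffAt_id, (hc v).congr_of_eventuallyEq (tangentCoord_extend (E := E) v)⟩

theorem ContMDiffAlongAt.comp {N' : Type*} [TopologicalSpace N'] {E'' H'' : Type*}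
    [NormedAddCommGroup E''] [NormedSpace ℝ E''] [TopologicalSpace H'']
    {I'' : ModelWithCorners ℝ E'' H''} [ChartedSpace H'' N'] {n : ℕ∞ω} {h : N' → N} {q' : N'}
    (hW : ContMDiffAlongAt I' n f W (h q')) (hh : ContMDiffAt I'' I' n h q') :
    ContMDiffAlongAt I'' n (fun p => f (h p)) (fun p => W (h p)) q' :=
  ContMDiffAt.comp q' hW hh

theorem MDiffAlongAt.smul {g : N → ℝ} (hg : MDifferentiableAt I' 𝓘(ℝ, ℝ) g q)
    (hW : MDiffAlongAt I' f W q) : MDiffAlongAt I' f (fun q' => g q' • W q') q := by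
  refine ⟨hW.1, (hg.smul hW.2).congr_of_eventuallyEq (Filter.Eventually.of_forall fun q' => ?_)⟩
  exact map_smul (tangentCoord E (f q) (f q')) (g q') (W q')

variable (I') in
/-- The derivative of the coordinates of a vector field along `f`. -/
def coordDeriv (f : N → M) (W : ∀ q : N, TangentSpace 𝓘(ℝ, E) (f q)) (q : N) :
    TangentSpace I' q →L[ℝ] TangentSpace 𝓘(ℝ, E) (f q) :=
  mvfderiv I' (coordAlong f W q) q

theorem coordDeriv_smul {g : N → ℝ} (hg : MDifferentiableAt I' 𝓘(ℝ, ℝ) g q)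
    (hW : MDiffAlongAt I' f W q) (v : TangentSpace I' q) :
    coordDeriv I' f (fun q' => g q' • W q') q v
      = mvfderiv I' g q v • W q + g q • coordDeriv I' f W q v := by
  have h1 : coordAlong f (fun q' => g q' • W q') q = g • coordAlong f W q := by
    ext1 q'
    exact map_smul (tangentCoord E (f q) (f q')) (g q') (W q')
  have h2 := DFunLike.congr_fun (mvfderiv_smul hg hW.2) v
  have h3 : coordAlong f W q q = W q := tangentCoord_self (E := E) (f q) (W q)
  rw [coordDeriv, h1]
  refine h2.trans ?_
  rw [h3, add_comm]
  rfl

variable [FiniteDimensional ℝ E] [RiemannianBundle (fun x : M => TangentSpace 𝓘(ℝ, E) x)]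

theorem covAlong_eq (hf : ContinuousAt f q) (v : TangentSpace I' q) :
    covAlong I' 𝓘(ℝ, E) f W q v
      = coordDeriv I' f W q v + christoffel (f q) (mfderiv I' 𝓘(ℝ, E) f q v) (W q) := by
  rw [covAlong, christoffel]
  congr 1
  have h := trivializationAt_symm_self (E := E) (f q) (mvfderiv I' (fun q' : N =>
    (trivializationAt E (TangentSpace 𝓘(ℝ, E)) (f q) ⟨f q', W q'⟩).2) q v)
  have h1 : (fun q' : N => (trivializationAt E (TangentSpace 𝓘(ℝ, E)) (f q) ⟨f q', W q'⟩).2)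
      =ᶠ[nhds q] coordAlong f W q := by
    filter_upwards [eventually_map_mem_chart_source (E := E) hf] with q' hq'
    exact trivializationAt_snd hq' (W q')
  have h2 := mvfderiv_congr (I' := I') (F := E) h1
  exact h.trans (DFunLike.congr_fun h2 v)

variable [IsContMDiffRiemannianBundle 𝓘(ℝ, E) ∞ E (fun x : M => TangentSpace 𝓘(ℝ, E) x)]

theorem covAlong_smul {g : N → ℝ} (hg : MDifferentiableAt I' 𝓘(ℝ, ℝ) g q)
    (hW : MDiffAlongAt I' f W q) (v : TangentSpace I' q) :
    covAlong I' 𝓘(ℝ, E) f (fun q' => g q' • W q') q v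
      = mvfderiv I' g q v • W q + g q • covAlong I' 𝓘(ℝ, E) f W q v := by
  have hf := hW.base.continuousAt
  rw [covAlong_eq hf, covAlong_eq hf, coordDeriv_smul hg hW, christoffel_smul_right, smul_add]
  exact add_assoc _ _ _

theorem covAlong_smul_vector (hf : ContinuousAt f q) (c : ℝ) (v : TangentSpace I' q) :
    covAlong I' 𝓘(ℝ, E) f W q (c • v) = c • covAlong I' 𝓘(ℝ, E) f W q v := by
  rw [covAlong_eq hf, covAlong_eq hf, map_smul, map_smul, christoffel_smul_left, smul_add]

/-- Metric compatibility. -/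
theorem mvfderiv_inner_along {V : ∀ q : N, TangentSpace 𝓘(ℝ, E) (f q)}
    (hV : MDiffAlongAt I' f V q) (hW : MDiffAlongAt I' f W q) (v : TangentSpace I' q) :
    mvfderiv I' (fun q' => (inner ℝ (V q') (W q') : ℝ)) q v
      = inner ℝ (covAlong I' 𝓘(ℝ, E) f V q v) (W q)
        + inner ℝ (V q) (covAlong I' 𝓘(ℝ, E) f W q v) := by
  have hf := hV.base
  have h0 : (fun q' => (inner ℝ (V q') (W q') : ℝ)) =ᶠ[nhds q]
      fun q' => metricCoord E (f q) (f q') (coordAlong f V q q') (coordAlong f W q q') := by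
    filter_upwards [eventually_map_mem_chart_source (E := E) hf.continuousAt] with q' hq'
    exact (metricCoord_tangentCoord hq' (V q') (W q')).symm
  have hD := mdifferentiableAt_metricCoord (E := E) (f q)
  have hDf : MDifferentiableAt I' 𝓘(ℝ, E →L[ℝ] E →L[ℝ] ℝ)
      (fun q' => metricCoord E (f q) (f q')) q := hD.comp q hf
  have h1 := mvfderiv_clm_apply (hDf.clm_apply hV.2) hW.2 v
  have h2 := mvfderiv_clm_apply (G := E →L[ℝ] ℝ) hDf hV.2 v
  have h3 := mvfderiv_comp_vector hD hf v
  rw [mvfderiv_congr h0, h1, h2, h3]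
  have e1 : coordAlong f W q q = W q := tangentCoord_self (E := E) (f q) (W q)
  have e2 : coordAlong f V q q = V q := tangentCoord_self (E := E) (f q) (V q)
  rw [e1, e2]
  have h4 : metricDeriv (f q) (mfderiv I' 𝓘(ℝ, E) f q v) (V q) (W q)
      + inner ℝ (coordDeriv I' f V q v) (W q) + inner ℝ (V q) (coordDeriv I' f W q v)
      = inner ℝ (covAlong I' 𝓘(ℝ, E) f V q v) (W q)
        + inner ℝ (V q) (covAlong I' 𝓘(ℝ, E) f W q v) := by
    rw [covAlong_eq hf.continuousAt, covAlong_eq hf.continuousAt, inner_add_left, inner_add_right,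
      metricDeriv_eq]
    ring
  rw [← h4, ← metricCoord_self (E := E) (f q) (coordDeriv I' f V q v) (W q),
    ← metricCoord_self (E := E) (f q) (V q) (coordDeriv I' f W q v)]
  rfl

end Along

section SecondDerivative

variable {E : Type*} [NormedAddCommGroup E] [NormedSpace ℝ E]
  {M : Type*} [TopologicalSpace M] [ChartedSpace E M] [IsManifold 𝓘(ℝ, E) ∞ M]
  {E₂ : Type*} [NormedAddCommGroup E₂] [NormedSpace ℝ E₂]
  {B : Type*} [TopologicalSpace B] [ChartedSpace E₂ B] [IsManifold 𝓘(ℝ, E₂) ∞ B]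

variable (E E₂) in
/-- The differential of `g` in the charts at `x` and `g x`. -/
def mapJacobian (g : M → B) (x y : M) : E →L[ℝ] E₂ :=
  (tangentCoord E₂ (g x) (g y)).comp ((mfderiv 𝓘(ℝ, E) 𝓘(ℝ, E₂) g y).comp (coordFrame E x y))

variable (E E₂) in
/-- The second derivative of `g` in the charts at `x` and `g x`. -/
def coordHessian (g : M → B) (x : M) (a b : TangentSpace 𝓘(ℝ, E) x) :
    TangentSpace 𝓘(ℝ, E₂) (g x) :=
  mvfderiv 𝓘(ℝ, E) (mapJacobian E E₂ g x) x a b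

variable {g : M → B} {x : M}

theorem contMDiffAt_mapJacobian (hg : ContMDiffAt 𝓘(ℝ, E) 𝓘(ℝ, E₂) ∞ g x) :
    ContMDiffAt 𝓘(ℝ, E) 𝓘(ℝ, E →L[ℝ] E₂) ∞ (mapJacobian E E₂ g x) x := by
  have h1 := ContMDiffAt.mfderiv_const (m := ∞) hg (by simp)
  refine h1.congr_of_eventuallyEq ?_
  filter_upwards [eventually_mem_chart_source E x,
    eventually_map_mem_chart_source (E := E₂) hg.continuousAt] with y hy hy'
  have h2 := inTangentCoordinates_eq_mfderiv_comp (I := 𝓘(ℝ, E)) (I' := 𝓘(ℝ, E₂)) (f := id)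
    (g := g) (ϕ := fun y => mfderiv 𝓘(ℝ, E) 𝓘(ℝ, E₂) g y) (x₀ := x) (x := y) hy hy'
  refine Eq.trans ?_ h2.symm
  rw [modelWithCornersSelf_coe, Set.range_id, mfderivWithin_univ, mapJacobian,
    tangentCoord_eq_mfderiv hy', coordFrame_eq_mfderiv hy]
  rfl

theorem coordHessian_symm (hg : ContMDiffAt 𝓘(ℝ, E) 𝓘(ℝ, E₂) ∞ g x)
    (a b : TangentSpace 𝓘(ℝ, E) x) : coordHessian E E₂ g x a b = coordHessian E E₂ g x b a := by
  have h1 := fderiv_comp_extChartAt_symm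
    ((contMDiffAt_mapJacobian hg).mdifferentiableAt (by simp))
  have hc : ContDiffAt ℝ ∞ (writtenInExtChartAt 𝓘(ℝ, E) 𝓘(ℝ, E₂) x g)
      (extChartAt 𝓘(ℝ, E) x x) := by
    have h2 := (contMDiffAt_iff.1 hg).2
    rw [modelWithCornersSelf_coe, Set.range_id, contDiffWithinAt_univ] at h2
    exact h2
  have h2 : (mapJacobian E E₂ g x ∘ (extChartAt 𝓘(ℝ, E) x).symm)
      =ᶠ[nhds (extChartAt 𝓘(ℝ, E) x x)] fderiv ℝ (writtenInExtChartAt 𝓘(ℝ, E) 𝓘(ℝ, E₂) x g) := by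
    have hev : ∀ᶠ y in nhds x, MDifferentiableAt 𝓘(ℝ, E) 𝓘(ℝ, E₂) g y := by
      filter_upwards [(contMDiffAt_iff_contMDiffAt_nhds (n := 1) (by simp)).1
        (hg.of_le (by simp))] with y hy
      exact hy.mdifferentiableAt (by simp)
    have hcont : Filter.Tendsto (extChartAt 𝓘(ℝ, E) x).symm (nhds (extChartAt 𝓘(ℝ, E) x x))
        (nhds x) := by
      have := continuousAt_extChartAt_symm (I := 𝓘(ℝ, E)) x
      rwa [ContinuousAt, extChartAt_to_inv] at this
    filter_upwards [extChartAt_target_mem_nhds (I := 𝓘(ℝ, E)) x, hcont.eventually hev,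
      hcont.eventually (eventually_map_mem_chart_source (E := E₂) hg.continuousAt)]
      with z hz hz1 hz2
    have hs : (extChartAt 𝓘(ℝ, E) x).symm z ∈ (chartAt E x).source := by
      simpa using (extChartAt 𝓘(ℝ, E) x).map_target hz
    have hd1 : MDifferentiableAt 𝓘(ℝ, E) 𝓘(ℝ, E) (extChartAt 𝓘(ℝ, E) x).symm z := by
      have h3 := mdifferentiableWithinAt_extChartAt_symm hz
      rwa [modelWithCornersSelf_coe, Set.range_id, mdifferentiableWithinAt_univ] at h3
    have hd2 := mdifferentiableAt_extChartAt (I := 𝓘(ℝ, E₂)) hz2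
    have h4 := mfderiv_comp z (hd2.comp _ hz1) hd1
    rw [mfderiv_comp _ hd2 hz1, mfderiv_eq_fderiv] at h4
    refine Eq.trans ?_ h4.symm
    change mapJacobian E E₂ g x ((extChartAt 𝓘(ℝ, E) x).symm z) = _
    rw [mapJacobian, tangentCoord_eq_mfderiv hz2, coordFrame_eq_mfderiv hs,
      (extChartAt 𝓘(ℝ, E) x).right_inv hz]
    rfl
  rw [h2.fderiv_eq] at h1
  have h3 := (hc.isSymmSndFDerivAt (by
    rw [minSmoothness_of_isRCLikeNormedField]; exact ENat.LEInfty.out)).eq (a : E) (b : E)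
  rw [h1] at h3
  exact h3

variable {E' : Type*} [NormedAddCommGroup E'] [NormedSpace ℝ E']
  {H' : Type*} [TopologicalSpace H'] {I' : ModelWithCorners ℝ E' H'}
  {N : Type*} [TopologicalSpace N] [ChartedSpace H' N]
  {f : N → M} {W : ∀ q : N, TangentSpace 𝓘(ℝ, E) (f q)} {q : N}

theorem coordAlong_map (hf : ContinuousAt f q) :
    coordAlong (fun q' => g (f q')) (fun q' => mfderiv 𝓘(ℝ, E) 𝓘(ℝ, E₂) g (f q') (W q')) q
      =ᶠ[nhds q] fun q' => mapJacobian E E₂ g (f q) (f q') (coordAlong f W q q') := by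
  filter_upwards [eventually_map_mem_chart_source (E := E) hf] with q' hq'
  have h := coordFrame_tangentCoord hq' (W q')
  change _ = tangentCoord E₂ _ _ (mfderiv 𝓘(ℝ, E) 𝓘(ℝ, E₂) g (f q')
    (coordFrame E (f q) (f q') (tangentCoord E (f q) (f q') (W q'))))
  rw [h]
  rfl

theorem ContMDiffAlongAt.map (hg : ContMDiffAt 𝓘(ℝ, E) 𝓘(ℝ, E₂) ∞ g (f q))
    (hW : ContMDiffAlongAt I' ∞ f W q) :
    ContMDiffAlongAt I' ∞ (fun q' => g (f q'))
      (fun q' => mfderiv 𝓘(ℝ, E) 𝓘(ℝ, E₂) g (f q') (W q')) q := by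
  rw [contMDiffAlongAt_iff] at *
  exact ⟨hg.comp q hW.1, (((contMDiffAt_mapJacobian hg).comp q hW.1).clm_apply
    hW.2).congr_of_eventuallyEq (coordAlong_map hW.1.continuousAt)⟩

theorem MDiffAlongAt.map (hg : ContMDiffAt 𝓘(ℝ, E) 𝓘(ℝ, E₂) ∞ g (f q))
    (hW : MDiffAlongAt I' f W q) :
    MDiffAlongAt I' (fun q' => g (f q'))
      (fun q' => mfderiv 𝓘(ℝ, E) 𝓘(ℝ, E₂) g (f q') (W q')) q :=
  ⟨(hg.mdifferentiableAt (by simp)).comp q hW.1,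
    ((((contMDiffAt_mapJacobian hg).mdifferentiableAt (by simp)).comp q hW.1).clm_apply
      hW.2).congr_of_eventuallyEq (coordAlong_map hW.1.continuousAt)⟩

theorem coordDeriv_map (hg : ContMDiffAt 𝓘(ℝ, E) 𝓘(ℝ, E₂) ∞ g (f q))
    (hW : MDiffAlongAt I' f W q) (v : TangentSpace I' q) :
    coordDeriv I' (fun q' => g (f q'))
        (fun q' => mfderiv 𝓘(ℝ, E) 𝓘(ℝ, E₂) g (f q') (W q')) q v
      = coordHessian E E₂ g (f q) (mfderiv I' 𝓘(ℝ, E) f q v) (W q)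
        + mfderiv 𝓘(ℝ, E) 𝓘(ℝ, E₂) g (f q) (coordDeriv I' f W q v) := by
  have hJ := (contMDiffAt_mapJacobian hg).mdifferentiableAt (by simp)
  have h1 := mvfderiv_clm_apply (hJ.comp q hW.1) hW.2 v
  have h2 := mvfderiv_comp_vector hJ hW.1 v
  have h3 := mvfderiv_congr (I' := I') (coordAlong_map (E₂ := E₂) (g := g) (W := W) hW.1.continuousAt)
  have e1 : coordAlong f W q q = W q := tangentCoord_self (E := E) (f q) (W q)
  have e2 (e : E) : mapJacobian E E₂ g (f q) (f q) e = mfderiv 𝓘(ℝ, E) 𝓘(ℝ, E₂) g (f q) e := by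
    refine (tangentCoord_self (E := E₂) (g (f q)) _).trans ?_
    exact congrArg (mfderiv 𝓘(ℝ, E) 𝓘(ℝ, E₂) g (f q)) (coordFrame_self (E := E) (f q) e)
  refine (DFunLike.congr_fun h3 v).trans (h1.trans ?_)
  have h4 : mvfderiv I' (mapJacobian E E₂ g (f q) ∘ f) q v
      = mvfderiv 𝓘(ℝ, E) (mapJacobian E E₂ g (f q)) (f q) (mfderiv I' 𝓘(ℝ, E) f q v) := h2
  rw [h4, e1]
  exact congrArg₂ (fun a b : E₂ => a + b) rfl (e2 _)

end SecondDerivative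

section Composition

variable {E : Type*} [NormedAddCommGroup E] [NormedSpace ℝ E] [FiniteDimensional ℝ E]
  {M : Type*} [TopologicalSpace M] [ChartedSpace E M] [IsManifold 𝓘(ℝ, E) ∞ M]
  [RiemannianBundle (fun x : M => TangentSpace 𝓘(ℝ, E) x)]
  {E₂ : Type*} [NormedAddCommGroup E₂] [NormedSpace ℝ E₂] [FiniteDimensional ℝ E₂]
  {B : Type*} [TopologicalSpace B] [ChartedSpace E₂ B] [IsManifold 𝓘(ℝ, E₂) ∞ B]
  [RiemannianBundle (fun x : B => TangentSpace 𝓘(ℝ, E₂) x)]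
  {E' : Type*} [NormedAddCommGroup E'] [NormedSpace ℝ E']
  {H' : Type*} [TopologicalSpace H'] {I' : ModelWithCorners ℝ E' H'}
  {N : Type*} [TopologicalSpace N] [ChartedSpace H' N]

variable (E E₂) in
/-- The covariant second derivative (Hessian) of a map between Riemannian manifolds. -/
def mapHessian (g : M → B) (x : M) (a b : TangentSpace 𝓘(ℝ, E) x) :
    TangentSpace 𝓘(ℝ, E₂) (g x) :=
  coordHessian E E₂ g x a b
    + christoffel (g x) (mfderiv 𝓘(ℝ, E) 𝓘(ℝ, E₂) g x a) (mfderiv 𝓘(ℝ, E) 𝓘(ℝ, E₂) g x b)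
    - mfderiv 𝓘(ℝ, E) 𝓘(ℝ, E₂) g x (christoffel x a b)

/-- Covariant differentiation along `g ∘ f`. -/
theorem covAlong_map {g : M → B} {f : N → M} {W : ∀ q : N, TangentSpace 𝓘(ℝ, E) (f q)} {q : N}
    (hg : ContMDiffAt 𝓘(ℝ, E) 𝓘(ℝ, E₂) ∞ g (f q)) (hW : MDiffAlongAt I' f W q)
    (v : TangentSpace I' q) :
    covAlong I' 𝓘(ℝ, E₂) (fun q' => g (f q'))
        (fun q' => mfderiv 𝓘(ℝ, E) 𝓘(ℝ, E₂) g (f q') (W q')) q v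
      = mapHessian E E₂ g (f q) (mfderiv I' 𝓘(ℝ, E) f q v) (W q)
        + mfderiv 𝓘(ℝ, E) 𝓘(ℝ, E₂) g (f q) (covAlong I' 𝓘(ℝ, E) f W q v) := by
  have hgd := hg.mdifferentiableAt (by simp)
  have h1 := mfderiv_comp_apply q hgd hW.1 v
  have h2 : mfderiv I' 𝓘(ℝ, E₂) (fun q' => g (f q')) q v
      = mfderiv 𝓘(ℝ, E) 𝓘(ℝ, E₂) g (f q) (mfderiv I' 𝓘(ℝ, E) f q v) := h1
  have h3 : ContinuousAt (fun q' => g (f q')) q :=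
    ContinuousAt.comp (f := f) hg.continuousAt hW.1.continuousAt
  rw [covAlong_eq h3, covAlong_eq hW.1.continuousAt, coordDeriv_map hg hW, map_add,
    mapHessian, h2]
  abel

variable [IsContMDiffRiemannianBundle 𝓘(ℝ, E) ∞ E (fun x : M => TangentSpace 𝓘(ℝ, E) x)]
  [IsContMDiffRiemannianBundle 𝓘(ℝ, E₂) ∞ E₂ (fun x : B => TangentSpace 𝓘(ℝ, E₂) x)]

theorem mapHessian_symm {g : M → B} {x : M} (hg : ContMDiffAt 𝓘(ℝ, E) 𝓘(ℝ, E₂) ∞ g x)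
    (a b : TangentSpace 𝓘(ℝ, E) x) : mapHessian E E₂ g x a b = mapHessian E E₂ g x b a := by
  rw [mapHessian, mapHessian, coordHessian_symm hg, christoffel_symm x, christoffel_symm (g x)]

end Composition

section HorizontalIsometry

variable {E : Type*} [NormedAddCommGroup E] [NormedSpace ℝ E] [FiniteDimensional ℝ E]
  {M : Type*} [TopologicalSpace M] [ChartedSpace E M] [IsManifold 𝓘(ℝ, E) ∞ M]
  [RiemannianBundle (fun x : M => TangentSpace 𝓘(ℝ, E) x)]
  [IsContMDiffRiemannianBundle 𝓘(ℝ, E) ∞ E (fun x : M => TangentSpace 𝓘(ℝ, E) x)]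
  {E₂ : Type*} [NormedAddCommGroup E₂] [NormedSpace ℝ E₂] [FiniteDimensional ℝ E₂]
  {B : Type*} [TopologicalSpace B] [ChartedSpace E₂ B] [IsManifold 𝓘(ℝ, E₂) ∞ B]
  [RiemannianBundle (fun x : B => TangentSpace 𝓘(ℝ, E₂) x)]
  [IsContMDiffRiemannianBundle 𝓘(ℝ, E₂) ∞ E₂ (fun x : B => TangentSpace 𝓘(ℝ, E₂) x)]

/-- Covariant derivative of a vector field on `M`. -/
def covField (Z : ∀ y : M, TangentSpace 𝓘(ℝ, E) y) (x : M) (a : TangentSpace 𝓘(ℝ, E) x) :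
    TangentSpace 𝓘(ℝ, E) x :=
  covAlong 𝓘(ℝ, E) 𝓘(ℝ, E) (fun y => y) Z x a

theorem mvfderiv_inner_field {Y Z : ∀ y : M, TangentSpace 𝓘(ℝ, E) y} {x : M}
    (hY : MDiffAlongAt 𝓘(ℝ, E) (fun y => y) Y x) (hZ : MDiffAlongAt 𝓘(ℝ, E) (fun y => y) Z x)
    (a : TangentSpace 𝓘(ℝ, E) x) :
    mvfderiv 𝓘(ℝ, E) (fun y => (inner ℝ (Y y) (Z y) : ℝ)) x a
      = inner ℝ (covField Y x a) (Z x) + inner ℝ (Y x) (covField Z x a) :=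
  mvfderiv_inner_along hY hZ a

omit [IsContMDiffRiemannianBundle 𝓘(ℝ, E) ∞ E (fun x : M => TangentSpace 𝓘(ℝ, E) x)]
  [IsContMDiffRiemannianBundle 𝓘(ℝ, E₂) ∞ E₂ (fun x : B => TangentSpace 𝓘(ℝ, E₂) x)] in
/-- Covariant derivative, along `g`, of the image of a vector field. -/
theorem covAlong_map_field {g : M → B} {Y : ∀ y : M, TangentSpace 𝓘(ℝ, E) y} {x : M}
    (hg : ContMDiffAt 𝓘(ℝ, E) 𝓘(ℝ, E₂) ∞ g x) (hY : MDiffAlongAt 𝓘(ℝ, E) (fun y => y) Y x)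
    (a : TangentSpace 𝓘(ℝ, E) x) :
    covAlong 𝓘(ℝ, E) 𝓘(ℝ, E₂) g (fun y => mfderiv 𝓘(ℝ, E) 𝓘(ℝ, E₂) g y (Y y)) x a
      = mapHessian E E₂ g x a (Y x) + mfderiv 𝓘(ℝ, E) 𝓘(ℝ, E₂) g x (covField Y x a) := by
  have h := covAlong_map (f := fun y : M => y) (q := x) hg hY a
  have h0 : mfderiv 𝓘(ℝ, E) 𝓘(ℝ, E) (fun y : M => y) x a = a :=
    DFunLike.congr_fun mfderiv_id a
  rw [h0] at h
  exact h

omit [FiniteDimensional ℝ E] in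
theorem mdifferentiableAt_inner_along {E' : Type*} [NormedAddCommGroup E'] [NormedSpace ℝ E']
    {H' : Type*} [TopologicalSpace H'] {I' : ModelWithCorners ℝ E' H'}
    {N : Type*} [TopologicalSpace N] [ChartedSpace H' N] {f : N → M}
    {V W : ∀ q : N, TangentSpace 𝓘(ℝ, E) (f q)} {q : N}
    (hV : MDiffAlongAt I' f V q) (hW : MDiffAlongAt I' f W q) :
    MDifferentiableAt I' 𝓘(ℝ, ℝ) (fun q' => (inner ℝ (V q') (W q') : ℝ)) q := by
  have h0 : (fun q' => (inner ℝ (V q') (W q') : ℝ)) =ᶠ[nhds q]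
      fun q' => metricCoord E (f q) (f q') (coordAlong f V q q') (coordAlong f W q q') := by
    filter_upwards [eventually_map_mem_chart_source (E := E) hV.base.continuousAt] with q' hq'
    exact (metricCoord_tangentCoord hq' (V q') (W q')).symm
  have hD := mdifferentiableAt_metricCoord (E := E) (f q)
  exact (((hD.comp q hV.base).clm_apply hV.2).clm_apply hW.2).congr_of_eventuallyEq h0

/-- The Hessian of a map which is isometric up to the square of the one-form dual to `Z`. -/
theorem inner_mapHessian_add {g : M → B} {x : M} (hg : ContMDiffAt 𝓘(ℝ, E) 𝓘(ℝ, E₂) ∞ g x)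
    {Z : ∀ y : M, TangentSpace 𝓘(ℝ, E) y} (hZ : MDiffAlongAt 𝓘(ℝ, E) (fun y => y) Z x)
    (hiso : ∀ y (u v : TangentSpace 𝓘(ℝ, E) y),
      (inner ℝ (mfderiv 𝓘(ℝ, E) 𝓘(ℝ, E₂) g y u) (mfderiv 𝓘(ℝ, E) 𝓘(ℝ, E₂) g y v) : ℝ)
        = inner ℝ u v - inner ℝ (Z y) u * inner ℝ (Z y) v)
    (a b c : TangentSpace 𝓘(ℝ, E) x) :
    inner ℝ (mapHessian E E₂ g x a b) (mfderiv 𝓘(ℝ, E) 𝓘(ℝ, E₂) g x c)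
        + inner ℝ (mfderiv 𝓘(ℝ, E) 𝓘(ℝ, E₂) g x b) (mapHessian E E₂ g x a c)
      = -(inner ℝ (covField Z x a) b * inner ℝ (Z x) c
          + inner ℝ (Z x) b * inner ℝ (covField Z x a) c) := by
  have hU := (contMDiffAlongAt_extend (n := ∞) x b).mdiff (by simp)
  have hV := (contMDiffAlongAt_extend (n := ∞) x c).mdiff (by simp)
  have h1 := mvfderiv_inner_along (hU.map hg) (hV.map hg) a
  rw [covAlong_map_field hg hU, covAlong_map_field hg hV] at h1
  have hZU := mdifferentiableAt_inner_along hZ hU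
  have hZV := mdifferentiableAt_inner_along hZ hV
  have h2 : mvfderiv 𝓘(ℝ, E) (fun y => (inner ℝ (FiberBundle.extend E b y)
        (FiberBundle.extend E c y) : ℝ)
      - inner ℝ (Z y) (FiberBundle.extend E b y) * inner ℝ (Z y) (FiberBundle.extend E c y)) x a
      = mvfderiv 𝓘(ℝ, E) (fun y => (inner ℝ (FiberBundle.extend E b y)
        (FiberBundle.extend E c y) : ℝ)) x a
        - (inner ℝ (Z x) (FiberBundle.extend E b x)
            * mvfderiv 𝓘(ℝ, E) (fun y => (inner ℝ (Z y) (FiberBundle.extend E c y) : ℝ)) x a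
          + inner ℝ (Z x) (FiberBundle.extend E c x)
            * mvfderiv 𝓘(ℝ, E) (fun y => (inner ℝ (Z y) (FiberBundle.extend E b y) : ℝ)) x a) := by
    have hm : MDifferentiableAt 𝓘(ℝ, E) 𝓘(ℝ, ℝ) (fun y => (inner ℝ (Z y)
        (FiberBundle.extend E b y) : ℝ) * inner ℝ (Z y) (FiberBundle.extend E c y)) x :=
      hZU.mul hZV
    rw [mvfderiv_fun_sub (mdifferentiableAt_inner_along hU hV) hm, mvfderiv_fun_mul hZU hZV]
    rfl
  rw [mvfderiv_inner_field hU hV, mvfderiv_inner_field hZ hU, mvfderiv_inner_field hZ hV] at h2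
  simp only [hiso] at h1
  rw [h2] at h1
  simp only [FiberBundle.extend_apply_self, inner_add_left, inner_add_right, hiso] at h1
  linarith

/-- The Hessian of an isometric immersion is normal. -/
theorem inner_mapHessian_eq_zero_of_isometry {g : M → B} {x : M}
    (hg : ContMDiffAt 𝓘(ℝ, E) 𝓘(ℝ, E₂) ∞ g x)
    (hiso : ∀ y (u v : TangentSpace 𝓘(ℝ, E) y),
      (inner ℝ (mfderiv 𝓘(ℝ, E) 𝓘(ℝ, E₂) g y u) (mfderiv 𝓘(ℝ, E) 𝓘(ℝ, E₂) g y v) : ℝ)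
        = inner ℝ u v)
    (a b c : TangentSpace 𝓘(ℝ, E) x) :
    inner ℝ (mapHessian E E₂ g x a b) (mfderiv 𝓘(ℝ, E) 𝓘(ℝ, E₂) g x c) = (0 : ℝ) := by
  have hZ : MDiffAlongAt 𝓘(ℝ, E) (fun y : M => y) (fun y => (0 : TangentSpace 𝓘(ℝ, E) y)) x := by
    refine ⟨mdifferentiableAt_id, ?_⟩
    have hc : MDifferentiableAt 𝓘(ℝ, E) 𝓘(ℝ, E) (fun _ : M => (0 : E)) x :=
      mdifferentiableAt_const
    refine hc.congr_of_eventuallyEq (Filter.Eventually.of_forall fun y => ?_)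
    exact map_zero (tangentCoord E x y)
  have key (a b c : TangentSpace 𝓘(ℝ, E) x) :
      (inner ℝ (mapHessian E E₂ g x a b) (mfderiv 𝓘(ℝ, E) 𝓘(ℝ, E₂) g x c) : ℝ)
        = - inner ℝ (mapHessian E E₂ g x a c) (mfderiv 𝓘(ℝ, E) 𝓘(ℝ, E₂) g x b) := by
    have h := inner_mapHessian_add hg hZ (by simpa using hiso) a b c
    rw [real_inner_comm (mapHessian E E₂ g x a c)] at h
    simp only [inner_zero_left, mul_zero, zero_mul, add_zero, neg_zero] at h
    linarith
  have h1 := key a b c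
  have h2 := key c a b
  have h3 := key b c a
  rw [mapHessian_symm hg a c] at h1
  rw [mapHessian_symm hg c b] at h2
  rw [mapHessian_symm hg b a] at h3
  linarith

/-- The Hessian of a Riemannian submersion vanishes on horizontal vectors. -/
theorem inner_mapHessian_eq_zero_of_horizontal {g : M → B} {x : M}
    (hg : ContMDiffAt 𝓘(ℝ, E) 𝓘(ℝ, E₂) ∞ g x)
    {Z : ∀ y : M, TangentSpace 𝓘(ℝ, E) y} (hZ : MDiffAlongAt 𝓘(ℝ, E) (fun y => y) Z x)
    (hiso : ∀ y (u v : TangentSpace 𝓘(ℝ, E) y),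
      (inner ℝ (mfderiv 𝓘(ℝ, E) 𝓘(ℝ, E₂) g y u) (mfderiv 𝓘(ℝ, E) 𝓘(ℝ, E₂) g y v) : ℝ)
        = inner ℝ u v - inner ℝ (Z y) u * inner ℝ (Z y) v)
    {a b c : TangentSpace 𝓘(ℝ, E) x} (ha : inner ℝ (Z x) a = (0 : ℝ))
    (hb : inner ℝ (Z x) b = (0 : ℝ)) (hc : inner ℝ (Z x) c = (0 : ℝ)) :
    inner ℝ (mapHessian E E₂ g x a b) (mfderiv 𝓘(ℝ, E) 𝓘(ℝ, E₂) g x c) = (0 : ℝ) := by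
  have key (a b c : TangentSpace 𝓘(ℝ, E) x) (hb : inner ℝ (Z x) b = (0 : ℝ))
      (hc : inner ℝ (Z x) c = (0 : ℝ)) :
      (inner ℝ (mapHessian E E₂ g x a b) (mfderiv 𝓘(ℝ, E) 𝓘(ℝ, E₂) g x c) : ℝ)
        = - inner ℝ (mapHessian E E₂ g x a c) (mfderiv 𝓘(ℝ, E) 𝓘(ℝ, E₂) g x b) := by
    have h := inner_mapHessian_add hg hZ hiso a b c
    rw [real_inner_comm (mapHessian E E₂ g x a c)] at h
    simp only [hb, hc, mul_zero, zero_mul, add_zero, neg_zero] at h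
    linarith
  have h1 := key a b c hb hc
  have h2 := key c a b ha hb
  have h3 := key b c a hc ha
  rw [mapHessian_symm hg a c] at h1
  rw [mapHessian_symm hg c b] at h2
  rw [mapHessian_symm hg b a] at h3
  linarith

end HorizontalIsometry

section Bilinearity

variable {E : Type*} [NormedAddCommGroup E] [NormedSpace ℝ E] [FiniteDimensional ℝ E]
  {M : Type*} [TopologicalSpace M] [ChartedSpace E M] [IsManifold 𝓘(ℝ, E) ∞ M]
  [RiemannianBundle (fun x : M => TangentSpace 𝓘(ℝ, E) x)]
  [IsContMDiffRiemannianBundle 𝓘(ℝ, E) ∞ E (fun x : M => TangentSpace 𝓘(ℝ, E) x)]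
  {E₂ : Type*} [NormedAddCommGroup E₂] [NormedSpace ℝ E₂] [FiniteDimensional ℝ E₂]
  {B : Type*} [TopologicalSpace B] [ChartedSpace E₂ B] [IsManifold 𝓘(ℝ, E₂) ∞ B]
  [RiemannianBundle (fun x : B => TangentSpace 𝓘(ℝ, E₂) x)]
  [IsContMDiffRiemannianBundle 𝓘(ℝ, E₂) ∞ E₂ (fun x : B => TangentSpace 𝓘(ℝ, E₂) x)]

theorem mapHessian_add_right (g : M → B) (x : M) (a b c : TangentSpace 𝓘(ℝ, E) x) :
    mapHessian E E₂ g x a (b + c) = mapHessian E E₂ g x a b + mapHessian E E₂ g x a c := by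
  have h : coordHessian E E₂ g x a (b + c) = coordHessian E E₂ g x a b + coordHessian E E₂ g x a c :=
    map_add (mvfderiv 𝓘(ℝ, E) (mapJacobian E E₂ g x) x a) b c
  simp only [mapHessian, h, map_add, christoffel_add_right]
  abel

theorem mapHessian_smul_right (g : M → B) (x : M) (t : ℝ) (a b : TangentSpace 𝓘(ℝ, E) x) :
    mapHessian E E₂ g x a (t • b) = t • mapHessian E E₂ g x a b := by
  have h : coordHessian E E₂ g x a (t • b) = t • coordHessian E E₂ g x a b :=
    map_smul (mvfderiv 𝓘(ℝ, E) (mapJacobian E E₂ g x) x a) t b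
  simp only [mapHessian, h, map_smul, christoffel_smul_right, smul_sub, smul_add]

theorem mapHessian_self_combination {g : M → B} {x : M} (hg : ContMDiffAt 𝓘(ℝ, E) 𝓘(ℝ, E₂) ∞ g x)
    {a b : TangentSpace 𝓘(ℝ, E) x} (ha : mapHessian E E₂ g x a a = 0)
    (hb : mapHessian E E₂ g x b b = 0) (s t : ℝ) :
    mapHessian E E₂ g x (s • a + t • b) (s • a + t • b)
      = (2 * (s * t)) • mapHessian E E₂ g x a b := by
  have h (c : TangentSpace 𝓘(ℝ, E) x) : mapHessian E E₂ g x (s • a + t • b) c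
      = s • mapHessian E E₂ g x a c + t • mapHessian E E₂ g x b c := by
    rw [mapHessian_symm hg, mapHessian_add_right, mapHessian_smul_right, mapHessian_smul_right,
      mapHessian_symm hg c a, mapHessian_symm hg c b]
  rw [h, mapHessian_add_right, mapHessian_add_right]
  simp only [mapHessian_smul_right, ha, hb, mapHessian_symm hg b a]
  module

/-- The Levi-Civita connection is torsion-free. -/
theorem mlieBracket_eq_covField {X Y : ∀ y : M, TangentSpace 𝓘(ℝ, E) y} {x : M}
    (hX : MDiffAlongAt 𝓘(ℝ, E) (fun y => y) X x) (hY : MDiffAlongAt 𝓘(ℝ, E) (fun y => y) Y x) :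
    VectorField.mlieBracket 𝓘(ℝ, E) X Y x = covField Y x (X x) - covField X x (Y x) := by
  have h0 (a : TangentSpace 𝓘(ℝ, E) x) :
      mfderiv 𝓘(ℝ, E) 𝓘(ℝ, E) (fun y : M => y) x a = a := DFunLike.congr_fun mfderiv_id a
  have h1 := mlieBracket_eq_mvfderiv_tangentCoord X Y x hX.2 hY.2
  have h2 : covField Y x (X x) - covField X x (Y x)
      = coordDeriv 𝓘(ℝ, E) (fun y => y) Y x (X x) - coordDeriv 𝓘(ℝ, E) (fun y => y) X x (Y x) := by
    rw [covField, covField, covAlong_eq hX.base.continuousAt, covAlong_eq hX.base.continuousAt,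
      h0, h0, christoffel_symm x (Y x)]
    abel
  exact h1.trans h2.symm

end Bilinearity

section SmoothFields

variable {E : Type*} [NormedAddCommGroup E] [NormedSpace ℝ E] [FiniteDimensional ℝ E]
  {M : Type*} [TopologicalSpace M] [ChartedSpace E M] [IsManifold 𝓘(ℝ, E) ∞ M] [T2Space M]

/-- Coordinate fields are restrictions of globally defined smooth vector fields. -/
theorem exists_smooth_field_eq_extend (x : M) (v : TangentSpace 𝓘(ℝ, E) x) :
    ∃ Y : ∀ y : M, TangentSpace 𝓘(ℝ, E) y,
      (∀ y, ContMDiffAlongAt 𝓘(ℝ, E) ∞ (fun y : M => y) Y y)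
        ∧ ∀ᶠ y in nhds x, Y y = FiberBundle.extend E v y := by
  let f : SmoothBumpFunction 𝓘(ℝ, E) x := Classical.choice inferInstance
  refine ⟨fun y => f y • FiberBundle.extend E v y, fun y => ?_, ?_⟩
  · by_cases hy : y ∈ (chartAt E x).source
    · refine ContMDiffAlongAt.smul f.contMDiffAt ?_
      have hy' : y ∈ (trivializationAt E (TangentSpace 𝓘(ℝ, E)) x).baseSet := hy
      refine ((trivializationAt E (TangentSpace 𝓘(ℝ, E)) x).contMDiffAt_section_iff hy').2 ?_
      have hc (e : E) : ContMDiffAt 𝓘(ℝ, E) 𝓘(ℝ, E) ∞ (fun _ : M => e) y := contMDiffAt_const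
      refine (hc v).congr_of_eventuallyEq ?_
      filter_upwards [(chartAt E x).open_source.mem_nhds hy] with z hz
      rw [trivializationAt_snd hz, extend_eq_coordFrame hz]
      exact tangentCoord_coordFrame (E := E) hz v
    · have h0 : ∀ᶠ z in nhds y, f z = 0 := by
        have : y ∉ tsupport f := fun h => hy (f.tsupport_subset_chartAt_source h)
        exact notMem_tsupport_iff_eventuallyEq.1 this
      have hz : ContMDiffAlongAt 𝓘(ℝ, E) ∞ (fun y : M => y)
          (fun y => (0 : TangentSpace 𝓘(ℝ, E) y)) y := by
        rw [contMDiffAlongAt_iff]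
        have hc : ContMDiffAt 𝓘(ℝ, E) 𝓘(ℝ, E) ∞ (fun _ : M => (0 : E)) y := contMDiffAt_const
        refine ⟨contMDiffAt_id, hc.congr_of_eventuallyEq (Filter.Eventually.of_forall fun z => ?_)⟩
        exact map_zero (tangentCoord E y z)
      refine hz.congr ?_
      filter_upwards [h0] with z h
      rw [h, zero_smul]
  · filter_upwards [f.eventuallyEq_one] with y hy
    rw [hy]
    exact one_smul ℝ _

end SmoothFields

section SasakiAlgebra

variable {M : Type*} [TopologicalSpace M] [ChartedSpace (EuclideanSpace ℝ (Fin 3)) M]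
  [IsManifold (𝓡 3) ∞ M] [RiemannianBundle (fun x : M => TangentSpace (𝓡 3) x)]
  (σ : SasakiStructure M)

theorem inner_reeb_self (x : M) : (inner ℝ (σ.ξ x) (σ.ξ x) : ℝ) = 1 := by
  rw [σ.metric_ξ, σ.η_ξ]

theorem phi_reeb (x : M) : σ.φ x (σ.ξ x) = 0 := by
  have h := σ.metric_φ x (σ.ξ x) (σ.ξ x)
  rw [inner_reeb_self, σ.η_ξ] at h
  exact inner_self_eq_zero.1 (h.trans (by norm_num))

theorem eta_phi (x : M) (v : TangentSpace (𝓡 3) x) : σ.η x (σ.φ x v) = 0 := by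
  have h := σ.φ_sq x (σ.φ x v)
  rw [σ.φ_sq x v, map_add, map_neg, map_smul, phi_reeb, smul_zero, add_zero] at h
  have h1 : σ.η x (σ.φ x v) • σ.ξ x = 0 := by
    have := congrArg (fun w => σ.φ x v + w) h
    simpa using this.symm
  have h2 : (inner ℝ (σ.ξ x) (σ.η x (σ.φ x v) • σ.ξ x) : ℝ) = 0 := by rw [h1, inner_zero_right]
  rwa [real_inner_smul_right, inner_reeb_self, mul_one] at h2

theorem inner_phi_self (x : M) (v : TangentSpace (𝓡 3) x) :
    (inner ℝ (σ.φ x v) v : ℝ) = 0 := by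
  have h := σ.metric_φ x (σ.φ x v) v
  rw [σ.φ_sq, eta_phi, inner_add_left, inner_neg_left, real_inner_smul_left, σ.metric_ξ,
    eta_phi, real_inner_comm] at h
  linarith

theorem inner_reeb_phi (x : M) (v : TangentSpace (𝓡 3) x) :
    (inner ℝ (σ.ξ x) (σ.φ x v) : ℝ) = 0 := by
  rw [σ.metric_ξ, eta_phi]

theorem eta_sub_reeb (x : M) (v : TangentSpace (𝓡 3) x) :
    σ.η x (v - σ.η x v • σ.ξ x) = 0 := by
  rw [map_sub, map_smul, σ.η_ξ, smul_eq_mul, mul_one, sub_self]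

theorem mdiff_reeb (x : M) : MDiffAlongAt (𝓡 3) (fun y : M => y) σ.ξ x :=
  ContMDiffAlongAt.mdiff (σ.smooth_ξ x) (by simp)

variable [IsContMDiffRiemannianBundle (𝓡 3) ∞ (EuclideanSpace ℝ (Fin 3))
      (fun x : M => TangentSpace (𝓡 3) x)]

theorem inner_covField_reeb_reeb (x : M) (a : TangentSpace (𝓡 3) x) :
    (inner ℝ (covField σ.ξ x a) (σ.ξ x) : ℝ) = 0 := by
  have h := mvfderiv_inner_field (mdiff_reeb σ x) (mdiff_reeb σ x) a
  have h0 : (fun y => (inner ℝ (σ.ξ y) (σ.ξ y) : ℝ)) = fun _ => 1 := funext (inner_reeb_self σ)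
  rw [h0, mvfderiv_const, real_inner_comm (σ.ξ x)] at h
  have h1 : (0 : ℝ) = inner ℝ (σ.ξ x) (covField σ.ξ x a) + inner ℝ (σ.ξ x) (covField σ.ξ x a) := h
  rw [real_inner_comm]
  linarith

/-- The integral curves of the Reeb field are geodesics. -/
theorem covField_reeb_self [T2Space M] (x : M) : covField σ.ξ x (σ.ξ x) = 0 := by
  refine ext_inner_right ℝ fun v => ?_
  obtain ⟨Y, hY, hYx⟩ := exists_smooth_field_eq_extend x v
  have hYv : Y x = v := by rw [hYx.self_of_nhds, FiberBundle.extend_apply_self]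
  have hYd := (hY x).mdiff (by simp)
  have h := σ.dη_ξ Y hY x
  rw [dOneForm] at h
  simp only [σ.η_ξ, mvfderiv_const, ← σ.metric_ξ] at h
  rw [mvfderiv_inner_field (mdiff_reeb σ x) hYd,
    mlieBracket_eq_covField (mdiff_reeb σ x) hYd, inner_sub_right,
    real_inner_comm (covField σ.ξ x (Y x)), inner_covField_reeb_reeb, hYv] at h
  have h1 : (inner ℝ (covField σ.ξ x (σ.ξ x)) v : ℝ)
      + inner ℝ (σ.ξ x) (covField Y x (σ.ξ x)) - 0
      - (inner ℝ (σ.ξ x) (covField Y x (σ.ξ x)) - 0) = 0 := h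
  rw [inner_zero_left]
  linarith

end SasakiAlgebra

section Fibering

variable {M : Type*} [TopologicalSpace M] [ChartedSpace (EuclideanSpace ℝ (Fin 3)) M]
  [IsManifold (𝓡 3) ∞ M] [RiemannianBundle (fun x : M => TangentSpace (𝓡 3) x)]
  {B : Type*} [TopologicalSpace B] [ChartedSpace (EuclideanSpace ℝ (Fin 2)) B]
  [RiemannianBundle (fun b : B => TangentSpace (𝓡 2) b)]
  {σ : SasakiStructure M} {Φ : ℝ → M → M} {pr : M → B}

theorem mfderiv_pr_reeb (hΦ : IsRegularFlow σ Φ) (hpr : IsBoothbyWangFibering σ Φ pr) (x : M) :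
    mfderiv (𝓡 3) (𝓡 2) pr x (σ.ξ x) = 0 := by
  have h1 := hΦ.generator x 0
  have h0 : Φ 0 x = x := hΦ.zero x
  have hd : MDifferentiableAt (𝓡 3) (𝓡 2) pr (Φ 0 x) := hpr.smooth.mdifferentiableAt (by simp)
  have h2 := hd.hasMFDerivAt.comp 0 h1
  have h3 : pr ∘ (fun t => Φ t x) = fun _ => pr x := by
    ext1 t
    exact ((hpr.fibre x (Φ t x)).2 ⟨t, rfl⟩).symm
  rw [h3] at h2
  have h4 := hasMFDerivAt_unique h2 (hasMFDerivAt_const (pr x) (0 : ℝ))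
  have h5 := DFunLike.congr_fun h4 (1 : ℝ)
  have h6 : mfderiv (𝓡 3) (𝓡 2) pr (Φ 0 x) ((1 : ℝ) • σ.ξ (Φ 0 x)) = 0 := h5
  rw [one_smul, h0] at h6
  exact h6

theorem mfderiv_pr_sub_reeb (hΦ : IsRegularFlow σ Φ) (hpr : IsBoothbyWangFibering σ Φ pr) (x : M)
    (v : TangentSpace (𝓡 3) x) (t : ℝ) :
    mfderiv (𝓡 3) (𝓡 2) pr x (v - t • σ.ξ x) = mfderiv (𝓡 3) (𝓡 2) pr x v := by
  rw [map_sub, map_smul, mfderiv_pr_reeb hΦ hpr, smul_zero, sub_zero]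

theorem inner_mfderiv_pr (hΦ : IsRegularFlow σ Φ) (hpr : IsBoothbyWangFibering σ Φ pr) (x : M)
    (u v : TangentSpace (𝓡 3) x) :
    (inner ℝ (mfderiv (𝓡 3) (𝓡 2) pr x u) (mfderiv (𝓡 3) (𝓡 2) pr x v) : ℝ)
      = inner ℝ u v - inner ℝ (σ.ξ x) u * inner ℝ (σ.ξ x) v := by
  rw [← mfderiv_pr_sub_reeb hΦ hpr x u (σ.η x u), ← mfderiv_pr_sub_reeb hΦ hpr x v (σ.η x v),
    hpr.isometry x _ _ (eta_sub_reeb σ x u) (eta_sub_reeb σ x v)]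
  rw [inner_sub_left, inner_sub_right, inner_sub_right, real_inner_smul_left,
    real_inner_smul_left, real_inner_smul_right, real_inner_smul_right, inner_reeb_self,
    real_inner_comm (σ.ξ x) u, σ.metric_ξ, σ.metric_ξ]
  ring

theorem exists_horizontal_lift (hΦ : IsRegularFlow σ Φ) (hpr : IsBoothbyWangFibering σ Φ pr)
    (x : M) (u : TangentSpace (𝓡 2) (pr x)) :
    ∃ v : TangentSpace (𝓡 3) x, σ.η x v = 0 ∧ mfderiv (𝓡 3) (𝓡 2) pr x v = u := by
  obtain ⟨v, hv⟩ := hpr.submersion x u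
  exact ⟨v - σ.η x v • σ.ξ x, eta_sub_reeb σ x v, by rw [mfderiv_pr_sub_reeb hΦ hpr, hv]⟩

variable [IsManifold (𝓡 2) ∞ B]
  [IsContMDiffRiemannianBundle (𝓡 3) ∞ (EuclideanSpace ℝ (Fin 3))
      (fun x : M => TangentSpace (𝓡 3) x)]
  [IsContMDiffRiemannianBundle (𝓡 2) ∞ (EuclideanSpace ℝ (Fin 2))
      (fun b : B => TangentSpace (𝓡 2) b)]

theorem mapHessian_pr_reeb [T2Space M] (hΦ : IsRegularFlow σ Φ)
    (hpr : IsBoothbyWangFibering σ Φ pr) (x : M) :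
    mapHessian (EuclideanSpace ℝ (Fin 3)) (EuclideanSpace ℝ (Fin 2)) pr x (σ.ξ x) (σ.ξ x) = 0 := by
  refine ext_inner_right ℝ fun w => ?_
  obtain ⟨c, -, rfl⟩ := exists_horizontal_lift hΦ hpr x w
  have h := inner_mapHessian_add (hpr.smooth x) (mdiff_reeb σ x) (inner_mfderiv_pr hΦ hpr)
    (σ.ξ x) (σ.ξ x) c
  rw [mfderiv_pr_reeb hΦ hpr, covField_reeb_self] at h
  simpa using h

theorem mapHessian_pr_horizontal (hΦ : IsRegularFlow σ Φ)
    (hpr : IsBoothbyWangFibering σ Φ pr) (x : M) {a b : TangentSpace (𝓡 3) x}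
    (ha : σ.η x a = 0) (hb : σ.η x b = 0) :
    mapHessian (EuclideanSpace ℝ (Fin 3)) (EuclideanSpace ℝ (Fin 2)) pr x a b = 0 := by
  refine ext_inner_right ℝ fun w => ?_
  obtain ⟨c, hc, rfl⟩ := exists_horizontal_lift hΦ hpr x w
  rw [inner_zero_left]
  rw [← σ.metric_ξ] at ha hb hc
  exact inner_mapHessian_eq_zero_of_horizontal (hpr.smooth x) (mdiff_reeb σ x)
    (inner_mfderiv_pr hΦ hpr) ha hb hc

end Fibering

section Sums

variable {E' : Type*} [NormedAddCommGroup E'] [NormedSpace ℝ E']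
  {H' : Type*} [TopologicalSpace H'] {I' : ModelWithCorners ℝ E' H'}
  {N : Type*} [TopologicalSpace N] [ChartedSpace H' N]
  {E : Type*} [NormedAddCommGroup E] [NormedSpace ℝ E]
  {M : Type*} [TopologicalSpace M] [ChartedSpace E M] [IsManifold 𝓘(ℝ, E) ∞ M]
  {f : N → M} {q : N}

theorem ContMDiffAlongAt.sum {n : ℕ∞ω} {k : Type*} [Fintype k]
    {W : k → ∀ q : N, TangentSpace 𝓘(ℝ, E) (f q)} (hf : ContMDiffAt I' 𝓘(ℝ, E) n f q)
    (hW : ∀ i, ContMDiffAlongAt I' n f (W i) q) :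
    ContMDiffAlongAt I' n f (fun q' => ∑ i, W i q') q := by
  simp only [contMDiffAlongAt_iff] at *
  refine ⟨hf, (ContMDiffAt.sum (t := Finset.univ)
    fun i _ => (hW i).2).congr_of_eventuallyEq (Filter.Eventually.of_forall fun q' => ?_)⟩
  refine (map_sum (tangentCoord E (f q) (f q')) (fun i => W i q') Finset.univ).trans ?_
  rfl

/-- An endomorphism field that maps smooth vector fields to smooth vector fields maps smooth
vector fields along a map to smooth vector fields along the map. -/
theorem ContMDiffAlongAt.endomorphism [T2Space M] [FiniteDimensional ℝ E]
    {A : ∀ x : M, TangentSpace 𝓘(ℝ, E) x →L[ℝ] TangentSpace 𝓘(ℝ, E) x}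
    (hA : ∀ Y : ∀ x : M, TangentSpace 𝓘(ℝ, E) x,
      (∀ x, ContMDiffAlongAt 𝓘(ℝ, E) ∞ (fun y : M => y) Y x) →
      ∀ x, ContMDiffAlongAt 𝓘(ℝ, E) ∞ (fun y : M => y) (fun y => A y (Y y)) x)
    {W : ∀ q : N, TangentSpace 𝓘(ℝ, E) (f q)} (hW : ContMDiffAlongAt I' ∞ f W q) :
    ContMDiffAlongAt I' ∞ f (fun q' => A (f q') (W q')) q := by
  obtain ⟨hf, hc⟩ := contMDiffAlongAt_iff.1 hW
  let b := Module.finBasis ℝ E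
  have hex (i) := exists_smooth_field_eq_extend (f q) (show TangentSpace 𝓘(ℝ, E) (f q) from b i)
  choose Y hY hYb using hex
  let c (i) (q' : N) : ℝ := LinearMap.toContinuousLinearMap (b.coord i) (coordAlong f W q q')
  have hcs (i) : ContMDiffAt I' 𝓘(ℝ, ℝ) ∞ (c i) q :=
    (LinearMap.toContinuousLinearMap (b.coord i)).contMDiff.contMDiffAt.comp q hc
  have h1 : ContMDiffAlongAt I' ∞ f (fun q' => ∑ i, c i q' • A (f q') (Y i (f q'))) q :=
    ContMDiffAlongAt.sum hf fun i => ContMDiffAlongAt.smul (hcs i)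
      (ContMDiffAlongAt.comp (f := fun y : M => y) (h := f) (hA (Y i) (hY i) (f q)) hf)
  refine h1.congr ?_
  have hY' : ∀ᶠ q' in nhds q, ∀ i, Y i (f q') = FiberBundle.extend E
      (show TangentSpace 𝓘(ℝ, E) (f q) from b i) (f q') :=
    Filter.eventually_all.2 fun i => hf.continuousAt.eventually (hYb i)
  filter_upwards [hY', eventually_map_mem_chart_source (E := E) hf.continuousAt] with q' h2 h3
  simp only [← map_smul, ← map_sum]
  congr 1
  have h4 := coordFrame_tangentCoord h3 (W q')
  have h5 : tangentCoord E (f q) (f q') (W q') = ∑ i, c i q' • b i := (b.sum_repr _).symm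
  rw [← h4, h5, map_sum]
  refine Finset.sum_congr rfl fun i _ => ?_
  rw [map_smul, h2 i, extend_eq_coordFrame h3]

/-- The differentials of a smooth family of maps. -/
theorem contMDiffAlongAt_mfderiv_family {F : N → M → M} {p : M}
    (w : TangentSpace 𝓘(ℝ, E) p) [IsManifold I' ∞ N]
    (hF : ContMDiffAt (I'.prod 𝓘(ℝ, E)) 𝓘(ℝ, E) ∞ (Function.uncurry F) (q, p)) :
    ContMDiffAlongAt I' ∞ (fun q' => F q' p)
      (fun q' => mfderiv 𝓘(ℝ, E) 𝓘(ℝ, E) (F q') p w) q := by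
  have h1 := ContMDiffAt.mfderiv (m := ∞) (x₀ := q) F (fun _ : N => p) hF
    contMDiffAt_const (by simp)
  have hf : ContMDiffAt I' 𝓘(ℝ, E) ∞ (fun q' => F q' p) q :=
    ContMDiffAt.comp (g := Function.uncurry F) (f := fun q' => (q', p)) q hF
      (contMDiffAt_id.prodMk contMDiffAt_const)
  rw [contMDiffAlongAt_iff]
  refine ⟨hf, ?_⟩
  have hc (e : E) : ContMDiffAt I' 𝓘(ℝ, E) ∞ (fun _ : N => e) q := contMDiffAt_const
  refine (h1.clm_apply (hc w)).congr_of_eventuallyEq ?_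
  filter_upwards [eventually_map_mem_chart_source (E := E) hf.continuousAt] with q' hq'
  have h2 := inTangentCoordinates_eq_mfderiv_comp (I := 𝓘(ℝ, E)) (I' := 𝓘(ℝ, E))
    (f := fun _ : N => p) (g := fun q' => F q' p)
    (ϕ := fun q' => mfderiv 𝓘(ℝ, E) 𝓘(ℝ, E) (F q') p) (x₀ := q) (x := q')
    (mem_chart_source E p) hq'
  refine Eq.trans ?_ (DFunLike.congr_fun h2.symm w)
  rw [modelWithCornersSelf_coe, Set.range_id, mfderivWithin_univ, coordAlong,
    tangentCoord_eq_mfderiv hq', ← coordFrame_eq_mfderiv (mem_chart_source E p)]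
  have h3 : coordFrame E p p w = w := coordFrame_self (E := E) p w
  change _ = mfderiv _ _ _ _ (mfderiv _ _ (F q') p (coordFrame E p p w))
  rw [h3]
  rfl

end Sums

theorem sq_inner_of_orthogonal {V : Type*} [NormedAddCommGroup V] [InnerProductSpace ℝ V]
    (hV : Module.finrank ℝ V = 2) {a c d : V} (ha : a ≠ 0) (hc : inner ℝ a c = (0 : ℝ))
    (hd : inner ℝ a d = (0 : ℝ)) :
    (inner ℝ c d : ℝ) ^ 2 = inner ℝ c c * inner ℝ d d := by
  have : Fact (Module.finrank ℝ V = 1 + 1) := ⟨hV⟩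
  obtain ⟨v, -, hv⟩ := finrank_eq_one_iff'.1 (Submodule.finrank_orthogonal_span_singleton (𝕜 := ℝ) ha)
  obtain ⟨x, hx⟩ := hv ⟨c, Submodule.mem_orthogonal_singleton_iff_inner_right.2 hc⟩
  obtain ⟨y, hy⟩ := hv ⟨d, Submodule.mem_orthogonal_singleton_iff_inner_right.2 hd⟩
  have hx' : x • (v : V) = c := congrArg Subtype.val hx
  have hy' : y • (v : V) = d := congrArg Subtype.val hy
  rw [← hx', ← hy']
  simp only [real_inner_smul_left, real_inner_smul_right]
  ring

section Fibering

variable {M : Type*} [TopologicalSpace M] [ChartedSpace (EuclideanSpace ℝ (Fin 3)) M]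
  [IsManifold (𝓡 3) ∞ M] [RiemannianBundle (fun x : M => TangentSpace (𝓡 3) x)]
  {B : Type*} [TopologicalSpace B] [ChartedSpace (EuclideanSpace ℝ (Fin 2)) B]
  [RiemannianBundle (fun b : B => TangentSpace (𝓡 2) b)]
  {σ : SasakiStructure M} {Φ : ℝ → M → M} {pr : M → B}

theorem inner_mfderiv_pr_phi (hΦ : IsRegularFlow σ Φ) (hpr : IsBoothbyWangFibering σ Φ pr) (x : M)
    (u v : TangentSpace (𝓡 3) x) :
    (inner ℝ (mfderiv (𝓡 3) (𝓡 2) pr x (σ.φ x u)) (mfderiv (𝓡 3) (𝓡 2) pr x v) : ℝ)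
      = inner ℝ (σ.φ x u) v := by
  rw [inner_mfderiv_pr hΦ hpr, inner_reeb_phi, zero_mul, sub_zero]

theorem inner_mfderiv_pr_phi_phi (hΦ : IsRegularFlow σ Φ) (hpr : IsBoothbyWangFibering σ Φ pr)
    (x : M) (u v : TangentSpace (𝓡 3) x) :
    (inner ℝ (mfderiv (𝓡 3) (𝓡 2) pr x (σ.φ x u)) (mfderiv (𝓡 3) (𝓡 2) pr x (σ.φ x v)) : ℝ)
      = inner ℝ (mfderiv (𝓡 3) (𝓡 2) pr x u) (mfderiv (𝓡 3) (𝓡 2) pr x v) := by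
  rw [inner_mfderiv_pr_phi hΦ hpr, inner_mfderiv_pr hΦ hpr, σ.metric_φ, σ.metric_ξ, σ.metric_ξ]

theorem mfderiv_pr_phi_congr (hΦ : IsRegularFlow σ Φ) (hpr : IsBoothbyWangFibering σ Φ pr)
    (x : M) {u v : TangentSpace (𝓡 3) x}
    (h : mfderiv (𝓡 3) (𝓡 2) pr x u = mfderiv (𝓡 3) (𝓡 2) pr x v) :
    mfderiv (𝓡 3) (𝓡 2) pr x (σ.φ x u) = mfderiv (𝓡 3) (𝓡 2) pr x (σ.φ x v) := by
  have h1 := inner_mfderiv_pr_phi_phi hΦ hpr x (u - v) (u - v)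
  rw [map_sub (mfderiv (𝓡 3) (𝓡 2) pr x) u v, h, sub_self, inner_zero_left] at h1
  have h2 := inner_self_eq_zero.1 h1
  rwa [map_sub, map_sub, sub_eq_zero] at h2

theorem pr_flow (hpr : IsBoothbyWangFibering σ Φ pr) (t : ℝ) : (fun x => pr (Φ t x)) = pr :=
  funext fun x => ((hpr.fibre x (Φ t x)).2 ⟨t, rfl⟩).symm

theorem contMDiff_flow (hΦ : IsRegularFlow σ Φ) (t : ℝ) : ContMDiff (𝓡 3) (𝓡 3) ∞ (Φ t) :=
  hΦ.smooth.comp (contMDiff_const.prodMk contMDiff_id)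

theorem mfderiv_pr_comp_flow (hΦ : IsRegularFlow σ Φ) (hpr : IsBoothbyWangFibering σ Φ pr)
    (t : ℝ) (p : M) (w : TangentSpace (𝓡 3) p) :
    mfderiv (𝓡 3) (𝓡 2) pr (Φ t p) (mfderiv (𝓡 3) (𝓡 3) (Φ t) p w)
      = mfderiv (𝓡 3) (𝓡 2) (fun x => pr (Φ t x)) p w :=
  (mfderiv_comp_apply (g := pr) p (hpr.smooth.mdifferentiableAt (by simp))
    ((contMDiff_flow hΦ t).mdifferentiableAt (by simp)) w).symm

theorem inner_mfderiv_pr_flow (hΦ : IsRegularFlow σ Φ) (hpr : IsBoothbyWangFibering σ Φ pr)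
    (t : ℝ) (p : M) (v w : TangentSpace (𝓡 3) p) :
    (inner ℝ (mfderiv (𝓡 3) (𝓡 2) pr (Φ t p) (mfderiv (𝓡 3) (𝓡 3) (Φ t) p v))
      (mfderiv (𝓡 3) (𝓡 2) pr (Φ t p) (mfderiv (𝓡 3) (𝓡 3) (Φ t) p w)) : ℝ)
      = inner ℝ (mfderiv (𝓡 3) (𝓡 2) pr p v) (mfderiv (𝓡 3) (𝓡 2) pr p w) := by
  have key (g : M → B) (hg : g = pr) :
      (inner ℝ (mfderiv (𝓡 3) (𝓡 2) g p v) (mfderiv (𝓡 3) (𝓡 2) g p w) : ℝ)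
      = inner ℝ (mfderiv (𝓡 3) (𝓡 2) pr p v) (mfderiv (𝓡 3) (𝓡 2) pr p w) := by
    subst hg
    rfl
  rw [mfderiv_pr_comp_flow hΦ hpr, mfderiv_pr_comp_flow hΦ hpr]
  exact key _ (pr_flow hpr t)

variable [T2Space M]

theorem ContMDiffAlongAt.phi {E' : Type*} [NormedAddCommGroup E'] [NormedSpace ℝ E']
    {H' : Type*} [TopologicalSpace H'] {I' : ModelWithCorners ℝ E' H'}
    {N : Type*} [TopologicalSpace N] [ChartedSpace H' N] {f : N → M} {q : N}
    {W : ∀ q : N, TangentSpace (𝓡 3) (f q)} (hW : ContMDiffAlongAt I' ∞ f W q) :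
    ContMDiffAlongAt I' ∞ f (fun q' => σ.φ (f q') (W q')) q :=
  ContMDiffAlongAt.endomorphism (A := σ.φ) (fun Y hY x => σ.smooth_φ Y (fun y => hY y) x) hW

variable [IsContMDiffRiemannianBundle (𝓡 3) ∞ (EuclideanSpace ℝ (Fin 3))
      (fun x : M => TangentSpace (𝓡 3) x)]

/-- Modulo vertical vectors, the Reeb flow commutes with `φ`. -/
theorem mfderiv_pr_phi_flow (hΦ : IsRegularFlow σ Φ) (hpr : IsBoothbyWangFibering σ Φ pr)
    (t : ℝ) (p : M) (v : TangentSpace (𝓡 3) p) :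
    mfderiv (𝓡 3) (𝓡 2) pr (Φ t p) (σ.φ (Φ t p) (mfderiv (𝓡 3) (𝓡 3) (Φ t) p v))
      = mfderiv (𝓡 3) (𝓡 2) pr (Φ t p) (mfderiv (𝓡 3) (𝓡 3) (Φ t) p (σ.φ p v)) := by
  let n : ℝ := inner ℝ (mfderiv (𝓡 3) (𝓡 2) pr p v) (mfderiv (𝓡 3) (𝓡 2) pr p v)
  let h (r : ℝ) : ℝ := inner ℝ (σ.φ (Φ r p) (mfderiv (𝓡 3) (𝓡 3) (Φ r) p v))
    (mfderiv (𝓡 3) (𝓡 3) (Φ r) p (σ.φ p v))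
  let A (r : ℝ) := mfderiv (𝓡 3) (𝓡 2) pr (Φ r p) (mfderiv (𝓡 3) (𝓡 3) (Φ r) p v)
  let C (r : ℝ) := mfderiv (𝓡 3) (𝓡 2) pr (Φ r p)
    (σ.φ (Φ r p) (mfderiv (𝓡 3) (𝓡 3) (Φ r) p v))
  let D (r : ℝ) := mfderiv (𝓡 3) (𝓡 2) pr (Φ r p) (mfderiv (𝓡 3) (𝓡 3) (Φ r) p (σ.φ p v))
  have hAA (r : ℝ) : (inner ℝ (A r) (A r) : ℝ) = n := inner_mfderiv_pr_flow hΦ hpr r p v v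
  have hCC (r : ℝ) : (inner ℝ (C r) (C r) : ℝ) = n :=
    (inner_mfderiv_pr_phi_phi hΦ hpr _ _ _).trans (hAA r)
  have hDD (r : ℝ) : (inner ℝ (D r) (D r) : ℝ) = n :=
    (inner_mfderiv_pr_flow hΦ hpr r p _ _).trans (inner_mfderiv_pr_phi_phi hΦ hpr _ _ _)
  have hCD (r : ℝ) : (inner ℝ (C r) (D r) : ℝ) = h r := inner_mfderiv_pr_phi hΦ hpr _ _ _
  have hAC (r : ℝ) : (inner ℝ (A r) (C r) : ℝ) = 0 := by
    rw [real_inner_comm]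
    exact (inner_mfderiv_pr_phi hΦ hpr _ _ _).trans (inner_phi_self σ _ _)
  have hAD (r : ℝ) : (inner ℝ (A r) (D r) : ℝ) = 0 := by
    rw [real_inner_comm]
    exact (inner_mfderiv_pr_flow hΦ hpr r p _ _).trans
      ((inner_mfderiv_pr_phi hΦ hpr _ _ _).trans (inner_phi_self σ _ _))
  have hsub : (inner ℝ (C t - D t) (C t - D t) : ℝ) = 2 * n - 2 * h t := by
    rw [inner_sub_left, inner_sub_right, inner_sub_right, hCC, hDD, hCD,
      real_inner_comm (C t) (D t), hCD]
    ring
  suffices hn : h t = n by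
    rw [hn, sub_self] at hsub
    exact sub_eq_zero.1 (inner_self_eq_zero.1 hsub)
  have hsq (r : ℝ) : h r ^ 2 = n * n := by
    by_cases hA : A r = 0
    · have hn0 : n = 0 := by rw [← hAA r, hA, inner_zero_left]
      have hC : C r = 0 := inner_self_eq_zero.1 ((hCC r).trans hn0)
      rw [← hCD, hC, inner_zero_left, hn0]
      norm_num
    · have h2 : Module.finrank ℝ (TangentSpace (𝓡 2) (pr (Φ r p))) = 2 :=
        finrank_euclideanSpace_fin (𝕜 := ℝ) (n := 2)
      rw [← hCD, sq_inner_of_orthogonal h2 hA (hAC r) (hAD r), hCC, hDD]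
  have hcont : Continuous h := by
    refine continuous_iff_continuousAt.2 fun r => ?_
    have hF : ContMDiffAt (𝓘(ℝ, ℝ).prod (𝓡 3)) (𝓡 3) ∞ (Function.uncurry Φ) (r, p) :=
      hΦ.smooth _
    have h1 := contMDiffAlongAt_mfderiv_family v hF
    have h2 := contMDiffAlongAt_mfderiv_family (σ.φ p v) hF
    exact (mdifferentiableAt_inner_along ((ContMDiffAlongAt.phi (σ := σ) h1).mdiff (by simp))
      (h2.mdiff (by simp))).continuousAt
  have h0 : h 0 = n := by
    have key (g : M → M) (hg : g = id) :
        (inner ℝ (σ.φ (g p) (mfderiv (𝓡 3) (𝓡 3) g p v)) (mfderiv (𝓡 3) (𝓡 3) g p (σ.φ p v)) : ℝ)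
        = inner ℝ (σ.φ p v) (σ.φ p v) := by
      subst hg
      rw [mfderiv_id]
      rfl
    refine (key (Φ 0) (funext hΦ.zero)).trans ?_
    rw [← inner_mfderiv_pr_phi hΦ hpr, inner_mfderiv_pr_phi_phi hΦ hpr]
  rcases sq_eq_sq_iff_eq_or_eq_neg.1 ((hsq t).trans (sq n).symm) with h1 | h1
  · exact h1
  · have hn : 0 ≤ n := real_inner_self_nonneg
    obtain ⟨r, hr⟩ := mem_range_of_exists_le_of_exists_ge (c := (0 : ℝ)) hcont
      ⟨t, by linarith⟩ ⟨0, by linarith⟩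
    have h2 := hsq r
    rw [hr] at h2
    have h3 : n = 0 := by
      rcases mul_self_eq_zero.1 (show n * n = 0 by rw [← h2]; norm_num) with h
      exact h
    rw [h1, h3, neg_zero]

/-- The almost complex structure of the base can be computed at any point of the fibre. -/
theorem complexStructure_mfderiv_pr (hΦ : IsRegularFlow σ Φ)
    (hpr : IsBoothbyWangFibering σ Φ pr) (x : M) (v : TangentSpace (𝓡 3) x) :
    complexStructure σ pr hpr.surjective (pr x) (mfderiv (𝓡 3) (𝓡 2) pr x v)
      = mfderiv (𝓡 3) (𝓡 2) pr x (σ.φ x v) := by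
  have hp : pr (Function.surjInv hpr.surjective (pr x)) = pr x := Function.surjInv_eq _ _
  rw [complexStructure]
  generalize Function.surjInv hpr.surjective (pr x) = p at hp
  obtain ⟨t, rfl⟩ := (hpr.fibre p x).1 hp
  have hw := Classical.epsilon_spec (exists_horizontal_lift hΦ hpr p
    (mfderiv (𝓡 3) (𝓡 2) pr (Φ t p) v))
  change mfderiv (𝓡 3) (𝓡 2) pr p (σ.φ p (horizontalLift σ pr p
    (mfderiv (𝓡 3) (𝓡 2) pr (Φ t p) v))) = _
  have hw' : mfderiv (𝓡 3) (𝓡 2) pr p (horizontalLift σ pr p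
    (mfderiv (𝓡 3) (𝓡 2) pr (Φ t p) v)) = mfderiv (𝓡 3) (𝓡 2) pr (Φ t p) v := hw.2
  generalize horizontalLift σ pr p (mfderiv (𝓡 3) (𝓡 2) pr (Φ t p) v) = w at hw'
  have h1 (w : TangentSpace (𝓡 3) p) : mfderiv (𝓡 3) (𝓡 2) pr (Φ t p)
      (mfderiv (𝓡 3) (𝓡 3) (Φ t) p w) = mfderiv (𝓡 3) (𝓡 2) pr p w := by
    rw [mfderiv_pr_comp_flow hΦ hpr, pr_flow hpr t]
    rfl
  have h2 := mfderiv_pr_phi_congr hΦ hpr (Φ t p) ((h1 w).trans hw')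
  rw [← h2, mfderiv_pr_phi_flow hΦ hpr]
  exact (h1 _).symm

end Fibering

section AlongCalculus

variable {E' : Type*} [NormedAddCommGroup E'] [NormedSpace ℝ E']
  {H' : Type*} [TopologicalSpace H'] {I' : ModelWithCorners ℝ E' H'}
  {N : Type*} [TopologicalSpace N] [ChartedSpace H' N]
  {E : Type*} [NormedAddCommGroup E] [NormedSpace ℝ E]
  {M : Type*} [TopologicalSpace M] [ChartedSpace E M] [IsManifold 𝓘(ℝ, E) ∞ M]

theorem contMDiffAlongAt_vectorSpace {f : N → E} {W : ∀ q : N, TangentSpace 𝓘(ℝ, E) (f q)} {q : N}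
    {n : ℕ∞ω} : ContMDiffAlongAt I' n f W q ↔
      ContMDiffAt I' 𝓘(ℝ, E) n f q ∧ ContMDiffAt I' 𝓘(ℝ, E) n (fun q' => (W q' : E)) q := by
  rw [contMDiffAlongAt_iff]
  have h : coordAlong f W q = fun q' => (W q' : E) := by
    ext1 q'
    rw [coordAlong, tangentCoord, TangentBundle.continuousLinearMapAt_model_space]
    rfl
  rw [h]

/-- The derivative of a smooth function in the direction of a smooth vector field is smooth. -/
theorem contMDiffAt_mvfderiv_apply {F : Type*} [NormedAddCommGroup F] [NormedSpace ℝ F]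
    {k : M → F} {V : ∀ x : M, TangentSpace 𝓘(ℝ, E) x} {x : M}
    (hk : ContMDiffAt 𝓘(ℝ, E) 𝓘(ℝ, F) ∞ k x)
    (hV : ContMDiffAlongAt 𝓘(ℝ, E) ∞ (fun y : M => y) V x) :
    ContMDiffAt 𝓘(ℝ, E) 𝓘(ℝ, F) ∞ (fun y => mvfderiv 𝓘(ℝ, E) k y (V y)) x :=
  (contMDiffAlongAt_vectorSpace.1 (ContMDiffAlongAt.map (f := fun y : M => y) hk hV)).2

variable [FiniteDimensional ℝ E] [RiemannianBundle (fun x : M => TangentSpace 𝓘(ℝ, E) x)]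

theorem covAlong_congr {f g : N → M} {W : ∀ q : N, TangentSpace 𝓘(ℝ, E) (f q)}
    {V : ∀ q : N, TangentSpace 𝓘(ℝ, E) (g q)} {q : N} (hf : ContinuousAt f q)
    (hfg : f =ᶠ[nhds q] g) (hWV : ∀ᶠ q' in nhds q, (W q' : E) = V q') (v : TangentSpace I' q) :
    (covAlong I' 𝓘(ℝ, E) f W q v : E) = covAlong I' 𝓘(ℝ, E) g V q v := by
  have ht {x x' y y' : M} {w w' : E} (hx : x = x') (hy : y = y') (hw : w = w') :
      (tangentCoord E x y w : E) = tangentCoord E x' y' w' := by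
    subst hx hy hw
    rfl
  have hc {x x' : M} {a b a' b' : E} (hx : x = x') (ha : a = a') (hb : b = b') :
      (christoffel x a b : E) = christoffel x' a' b' := by
    subst hx ha hb
    rfl
  rw [covAlong_eq hf, covAlong_eq (hf.congr hfg)]
  refine congrArg₂ (fun a b : E => a + b) ?_ ?_
  · refine DFunLike.congr_fun (mvfderiv_congr ?_) v
    filter_upwards [hfg, hWV] with q' h1 h2
    exact ht hfg.self_of_nhds h1 h2
  · exact hc hfg.self_of_nhds
      (congrArg (fun L : E' →L[ℝ] E => L v) (hfg.mfderiv_eq (I := I') (I' := 𝓘(ℝ, E))))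
      hWV.self_of_nhds

theorem covAlong_comp {N' : Type*} [TopologicalSpace N'] {E'' H'' : Type*}
    [NormedAddCommGroup E''] [NormedSpace ℝ E''] [TopologicalSpace H'']
    {I'' : ModelWithCorners ℝ E'' H''} [ChartedSpace H'' N'] {f : N → M}
    {W : ∀ q : N, TangentSpace 𝓘(ℝ, E) (f q)} {h : N' → N} {p : N'}
    (hW : MDiffAlongAt I' f W (h p)) (hh : MDifferentiableAt I'' I' h p) (v : TangentSpace I'' p) :
    covAlong I'' 𝓘(ℝ, E) (fun p' => f (h p')) (fun p' => W (h p')) p v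
      = covAlong I' 𝓘(ℝ, E) f W (h p) (mfderiv I'' I' h p v) := by
  have h1 : mfderiv I'' 𝓘(ℝ, E) (fun p' => f (h p')) p v
      = mfderiv I' 𝓘(ℝ, E) f (h p) (mfderiv I'' I' h p v) := mfderiv_comp_apply p hW.base hh v
  have h2 : coordDeriv I'' (fun p' => f (h p')) (fun p' => W (h p')) p v
      = coordDeriv I' f W (h p) (mfderiv I'' I' h p v) := mvfderiv_comp_vector hW.coord hh v
  have h3 : ContinuousAt (fun p' => f (h p')) p :=
    ContinuousAt.comp (f := h) hW.base.continuousAt hh.continuousAt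
  rw [covAlong_eq h3, covAlong_eq hW.base.continuousAt, h1, h2]

end AlongCalculus

theorem sum_columns_of_orthonormal_rows {k : Type*} [Fintype k] (hk : Fintype.card k = 2)
    {x y : k → ℝ} (h : ∀ i j, x i * x j + y i * y j = open Classical in if i = j then 1 else 0) :
    ∑ i, x i * x i = 1 ∧ ∑ i, x i * y i = 0 := by
  classical
  let A : Matrix k (Fin 2) ℝ := Matrix.of fun i => ![x i, y i]
  have hA : A * A.transpose = 1 := by
    ext i j
    rw [Matrix.mul_apply, Fin.sum_univ_two, Matrix.one_apply]
    refine (h i j).trans ?_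
    congr
  have hA' : A.transpose * A = 1 :=
    (Matrix.mul_eq_one_comm_of_card_eq _ _ _ (by simpa using hk)).1 hA
  constructor
  · have := congrFun (congrFun hA' 0) 0
    rwa [Matrix.mul_apply, Matrix.one_apply_eq] at this
  · have := congrFun (congrFun hA' 0) 1
    rwa [Matrix.mul_apply, Matrix.one_apply_ne (by simp)] at this

section Surface

variable {M : Type*} [TopologicalSpace M] [ChartedSpace (EuclideanSpace ℝ (Fin 3)) M]
  [RiemannianBundle (fun x : M => TangentSpace (𝓡 3) x)]
  {S : Type*} [TopologicalSpace S] [ChartedSpace (EuclideanSpace ℝ (Fin 2)) S]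
  {ι : S → M} {q : S}

theorem normalPart_eq (hinj : Function.Injective (mfderiv (𝓡 2) (𝓡 3) ι q))
    {n : TangentSpace (𝓡 3) (ι q)} (hn : (inner ℝ n n : ℝ) = 1)
    (hnt : ∀ v, (inner ℝ (mfderiv (𝓡 2) (𝓡 3) ι q v) n : ℝ) = 0)
    (w : TangentSpace (𝓡 3) (ι q)) :
    normalPart (𝓡 3) ι q w = (inner ℝ n w : ℝ) • n := by
  let K := LinearMap.range (mfderiv (𝓡 2) (𝓡 3) ι q).toLinearMap
  have hnK : n ∈ Kᗮ := by
    rintro _ ⟨v, rfl⟩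
    exact hnt v
  have h2 : Module.finrank ℝ K = 2 :=
    (LinearMap.finrank_range_of_inj hinj).trans (finrank_euclideanSpace_fin (𝕜 := ℝ) (n := 2))
  have h3 : Module.finrank ℝ (TangentSpace (𝓡 3) (ι q)) = 3 :=
    finrank_euclideanSpace_fin (𝕜 := ℝ) (n := 3)
  have h1 : Module.finrank ℝ Kᗮ = 1 := by
    have := K.finrank_add_finrank_orthogonal
    omega
  have hn0 : (⟨n, hnK⟩ : Kᗮ) ≠ 0 := fun h => by
    rw [show n = 0 from congrArg Subtype.val h, inner_zero_left] at hn
    norm_num at hn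
  refine Submodule.eq_starProjection_of_mem_of_inner_eq_zero (Kᗮ.smul_mem _ hnK) fun z hz => ?_
  obtain ⟨c, hc⟩ := (finrank_eq_one_iff_of_nonzero' _ hn0).1 h1 ⟨z, hz⟩
  have hc' : c • n = z := congrArg Subtype.val hc
  rw [← hc', real_inner_smul_right, inner_sub_left, real_inner_smul_left, hn, mul_one,
    real_inner_comm, sub_self, mul_zero]

end Surface

section Transport

variable {E : Type*} [NormedAddCommGroup E] [NormedSpace ℝ E]
  {B : Type*} [TopologicalSpace B] [ChartedSpace E B]

theorem inner_tangent_congr [RiemannianBundle (fun b : B => TangentSpace 𝓘(ℝ, E) b)]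
    {b b' : B} (h : b = b') (u v : E) :
    (inner ℝ (show TangentSpace 𝓘(ℝ, E) b from u) (show TangentSpace 𝓘(ℝ, E) b from v) : ℝ)
      = inner ℝ (show TangentSpace 𝓘(ℝ, E) b' from u) (show TangentSpace 𝓘(ℝ, E) b' from v) := by
  subst h
  rfl

theorem totalSpace_mk_congr {b b' : B} (h : b = b') (u : E) :
    (⟨b, u⟩ : TotalSpace E (TangentSpace 𝓘(ℝ, E) (M := B))) = ⟨b', u⟩ := by
  subst h
  rfl

end Transport

section Curve

variable {B : Type*} [TopologicalSpace B] [ChartedSpace (EuclideanSpace ℝ (Fin 2)) B]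
  [IsManifold (𝓡 2) ∞ B] [RiemannianBundle (fun b : B => TangentSpace (𝓡 2) b)]
  {T : Set ℝ} {γ : ℝ → B}

omit [IsManifold (𝓡 2) ∞ B] in
theorem IsUnitSpeedCurve.contMDiffAt (hγ : IsUnitSpeedCurve T γ) {t : ℝ} (ht : t ∈ T) :
    ContMDiffAt 𝓘(ℝ, ℝ) (𝓡 2) ∞ γ t :=
  hγ.smooth.contMDiffAt (hγ.isOpen.mem_nhds ht)

theorem IsUnitSpeedCurve.contMDiffAlongAt_velocity (hγ : IsUnitSpeedCurve T γ) {t : ℝ}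
    (ht : t ∈ T) : ContMDiffAlongAt 𝓘(ℝ, ℝ) ∞ γ (velocity γ) t := by
  have h : ContMDiffAlongAt 𝓘(ℝ, ℝ) ∞ (fun r : ℝ => r)
      (fun r => (show TangentSpace 𝓘(ℝ, ℝ) r from (1 : ℝ))) t :=
    contMDiffAlongAt_vectorSpace.2 ⟨contMDiffAt_id, contMDiffAt_const⟩
  exact ContMDiffAlongAt.map (f := fun r : ℝ => r) (hγ.contMDiffAt ht) h

theorem IsUnitSpeedCurve.inner_acceleration_velocity
    [IsContMDiffRiemannianBundle (𝓡 2) ∞ (EuclideanSpace ℝ (Fin 2))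
      (fun b : B => TangentSpace (𝓡 2) b)]
    (hγ : IsUnitSpeedCurve T γ) {t : ℝ}
    (ht : t ∈ T) : (inner ℝ (acceleration γ t) (velocity γ t) : ℝ) = 0 := by
  have hv := (hγ.contMDiffAlongAt_velocity ht).mdiff (by simp)
  have h1 := mvfderiv_inner_along hv hv (1 : ℝ)
  have h0 : ∀ᶠ r in nhds t, (inner ℝ (velocity γ r) (velocity γ r) : ℝ) = 1 := by
    filter_upwards [hγ.isOpen.mem_nhds ht] with r hr
    exact hγ.unit_speed r hr
  rw [mvfderiv_eventuallyEq_const h0, real_inner_comm (velocity γ t)] at h1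
  have h2 : (0 : ℝ) = inner ℝ (velocity γ t) (acceleration γ t)
      + inner ℝ (velocity γ t) (acceleration γ t) := h1
  rw [real_inner_comm]
  linarith

end Curve

section HopfCylinder

variable {M : Type*} [TopologicalSpace M] [ChartedSpace (EuclideanSpace ℝ (Fin 3)) M]
  [RiemannianBundle (fun x : M => TangentSpace (𝓡 3) x)]
  {B : Type*} {pr : M → B} {T : Set ℝ} {γ : ℝ → B}
  {S : Type*} [TopologicalSpace S] [ChartedSpace (EuclideanSpace ℝ (Fin 2)) S]
  [RiemannianBundle (fun q : S => TangentSpace (𝓡 2) q)]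
  {s : S → ℝ} {ι : S → M}

theorem IsHopfCylinder.mem (hι : IsHopfCylinder pr T γ s ι) (q : S) :
    s q ∈ T ∧ pr (ι q) = γ (s q) := by
  have h : (s q, ι q) ∈ {z : ℝ × M | z.1 ∈ T ∧ pr z.2 = γ z.1} :=
    hι.range_eq ▸ Set.mem_range_self q
  exact h

theorem IsHopfCylinder.contMDiff_param [IsManifold (𝓡 3) ∞ M] [IsManifold (𝓡 2) ∞ S]
    (hι : IsHopfCylinder pr T γ s ι) : ContMDiff (𝓡 2) 𝓘(ℝ, ℝ) ∞ s :=
  contMDiff_fst.comp hι.embedding.contMDiff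

theorem IsHopfCylinder.contMDiff_immersion [IsManifold (𝓡 3) ∞ M] [IsManifold (𝓡 2) ∞ S]
    (hι : IsHopfCylinder pr T γ s ι) : ContMDiff (𝓡 2) (𝓡 3) ∞ ι :=
  contMDiff_snd.comp hι.embedding.contMDiff

theorem IsHopfCylinder.injective (hι : IsHopfCylinder pr T γ s ι) (q : S) :
    Function.Injective (mfderiv (𝓡 2) (𝓡 3) ι q) := by
  refine (injective_iff_map_eq_zero _).2 fun v hv => ?_
  have h := hι.isometric q v v
  rw [hv, inner_zero_left] at h
  exact inner_self_eq_zero.1 h.symm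

variable [TopologicalSpace B] [ChartedSpace (EuclideanSpace ℝ (Fin 2)) B]

variable (pr γ s ι) in
/-- The velocity of the base curve, as a vector field along the projection of the surface. -/
def baseVelocity (q : S) : TangentSpace (𝓡 2) (pr (ι q)) := velocity γ (s q)

variable (pr γ s ι) in
/-- The acceleration of the base curve, as a vector field along the projection of the surface. -/
def baseAcceleration [IsManifold (𝓡 2) ∞ B] [RiemannianBundle (fun b : B => TangentSpace (𝓡 2) b)]
    (q : S) : TangentSpace (𝓡 2) (pr (ι q)) := acceleration γ (s q)

theorem inner_baseVelocity_self [RiemannianBundle (fun b : B => TangentSpace (𝓡 2) b)]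
    (hγ : IsUnitSpeedCurve T γ) (hι : IsHopfCylinder pr T γ s ι)
    (q : S) : (inner ℝ (baseVelocity pr γ s ι q) (baseVelocity pr γ s ι q) : ℝ) = 1 :=
  (inner_tangent_congr (E := EuclideanSpace ℝ (Fin 2)) (hι.mem q).2 _ _).trans (hγ.unit_speed _ (hι.mem q).1)

theorem inner_baseAcceleration_baseVelocity [IsManifold (𝓡 2) ∞ B]
    [RiemannianBundle (fun b : B => TangentSpace (𝓡 2) b)]
    [IsContMDiffRiemannianBundle (𝓡 2) ∞ (EuclideanSpace ℝ (Fin 2))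
      (fun b : B => TangentSpace (𝓡 2) b)] (hγ : IsUnitSpeedCurve T γ)
    (hι : IsHopfCylinder pr T γ s ι) (q : S) :
    (inner ℝ (baseAcceleration pr γ s ι q) (baseVelocity pr γ s ι q) : ℝ) = 0 :=
  (inner_tangent_congr (E := EuclideanSpace ℝ (Fin 2)) (hι.mem q).2 _ _).trans (hγ.inner_acceleration_velocity (hι.mem q).1)

section Base

variable [IsManifold (𝓡 3) ∞ M] [IsManifold (𝓡 2) ∞ S]
  [RiemannianBundle (fun b : B => TangentSpace (𝓡 2) b)]

theorem mfderiv_pr_immersion (hprs : ContMDiff (𝓡 3) (𝓡 2) ∞ pr) (hγ : IsUnitSpeedCurve T γ)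
    (hι : IsHopfCylinder pr T γ s ι) (q : S) (v : TangentSpace (𝓡 2) q) :
    mfderiv (𝓡 3) (𝓡 2) pr (ι q) (mfderiv (𝓡 2) (𝓡 3) ι q v)
      = mvfderiv (𝓡 2) s q v • baseVelocity pr γ s ι q := by
  have h1 := mfderiv_comp_apply (g := pr) q (hprs.mdifferentiableAt (by simp))
    (hι.contMDiff_immersion.mdifferentiableAt (by simp)) v
  have h2 := mfderiv_comp_apply (g := γ) q
    ((hγ.contMDiffAt (hι.mem q).1).mdifferentiableAt (by simp))
    (hι.contMDiff_param.mdifferentiableAt (by simp)) v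
  have h3 : pr ∘ ι = γ ∘ s := funext fun q => (hι.mem q).2
  have h4 (f g : S → B) (h : f = g) : (mfderiv (𝓡 2) (𝓡 2) f q v : EuclideanSpace ℝ (Fin 2))
      = mfderiv (𝓡 2) (𝓡 2) g q v := by
    subst h
    rfl
  refine h1.symm.trans ((h4 _ _ h3).trans (h2.trans ?_))
  have h5 := map_smul (mfderiv 𝓘(ℝ, ℝ) (𝓡 2) γ (s q)) (mvfderiv (𝓡 2) s q v) (1 : ℝ)
  rw [smul_eq_mul, mul_one] at h5
  exact h5

variable [IsManifold (𝓡 2) ∞ B]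

theorem contMDiffAlongAt_baseVelocity (hγ : IsUnitSpeedCurve T γ) (hι : IsHopfCylinder pr T γ s ι) (q : S) :
    ContMDiffAlongAt (𝓡 2) ∞ (fun q => pr (ι q)) (baseVelocity pr γ s ι) q := by
  have h := ContMDiffAlongAt.comp (hγ.contMDiffAlongAt_velocity (hι.mem q).1)
    (hι.contMDiff_param q)
  refine ContMDiffAt.congr_of_eventuallyEq h (Filter.Eventually.of_forall fun q' => ?_)
  exact totalSpace_mk_congr (hι.mem q').2 _

theorem covAlong_baseVelocity
    [IsContMDiffRiemannianBundle (𝓡 2) ∞ (EuclideanSpace ℝ (Fin 2))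
      (fun b : B => TangentSpace (𝓡 2) b)] (hγ : IsUnitSpeedCurve T γ)
    (hι : IsHopfCylinder pr T γ s ι) (q : S) (v : TangentSpace (𝓡 2) q) :
    covAlong (𝓡 2) (𝓡 2) (fun q => pr (ι q)) (baseVelocity pr γ s ι) q v
      = mvfderiv (𝓡 2) s q v • baseAcceleration pr γ s ι q := by
  have hG := (contMDiffAlongAt_baseVelocity hγ hι q).mdiff (by simp)
  have hv := (hγ.contMDiffAlongAt_velocity (hι.mem q).1).mdiff (by simp)
  have h1 := covAlong_congr (I' := 𝓡 2) (V := fun q => velocity γ (s q)) hG.base.continuousAt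
    (Filter.Eventually.of_forall fun q' => (hι.mem q').2)
    (Filter.Eventually.of_forall fun q' => rfl) v
  have h2 := covAlong_comp hv (hι.contMDiff_param.mdifferentiableAt (x := q) (by simp)) v
  have h3 := covAlong_smul_vector (I' := 𝓘(ℝ, ℝ)) (W := velocity γ)
    (hγ.contMDiffAt (hι.mem q).1).continuousAt (mvfderiv (𝓡 2) s q v) (1 : ℝ)
  have h4 : mvfderiv (𝓡 2) s q v • (1 : ℝ) = mvfderiv (𝓡 2) s q v := mul_one _
  have h5 : mfderiv (𝓡 2) 𝓘(ℝ, ℝ) s q v = mvfderiv (𝓡 2) s q v • (1 : ℝ) := h4.symm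
  rw [h5] at h2
  exact h1.trans (h2.trans h3)

end Base

end HopfCylinder

section Frame

set_option linter.unusedSectionVars false

variable {M : Type*} [TopologicalSpace M] [ChartedSpace (EuclideanSpace ℝ (Fin 3)) M]
  [IsManifold (𝓡 3) ∞ M] [RiemannianBundle (fun x : M => TangentSpace (𝓡 3) x)]
  {B : Type*} [TopologicalSpace B] [ChartedSpace (EuclideanSpace ℝ (Fin 2)) B]
  {S : Type*}
  {Φ : ℝ → M → M} {T : Set ℝ}

/-- The horizontal lift of the velocity of the base curve. -/
def hopfLift (σ : SasakiStructure M) (pr : M → B) (γ : ℝ → B) (s : S → ℝ) (ι : S → M) (q : S) :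
    TangentSpace (𝓡 3) (ι q) :=
  horizontalLift σ pr (ι q) (baseVelocity pr γ s ι q)

/-- The unit normal field of the Hopf cylinder. -/
def hopfNormal (σ : SasakiStructure M) (pr : M → B) (γ : ℝ → B) (s : S → ℝ) (ι : S → M) (q : S) :
    TangentSpace (𝓡 3) (ι q) :=
  σ.φ (ι q) (hopfLift σ pr γ s ι q)

variable {σ : SasakiStructure M} {pr : M → B} {γ : ℝ → B} {s : S → ℝ} {ι : S → M}
  [RiemannianBundle (fun b : B => TangentSpace (𝓡 2) b)]

theorem eta_hopfLift (hΦ : IsRegularFlow σ Φ) (hpr : IsBoothbyWangFibering σ Φ pr) (q : S) :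
    σ.η (ι q) (hopfLift σ pr γ s ι q) = 0 :=
  (Classical.epsilon_spec (exists_horizontal_lift hΦ hpr (ι q) (baseVelocity pr γ s ι q))).1

theorem mfderiv_pr_hopfLift (hΦ : IsRegularFlow σ Φ) (hpr : IsBoothbyWangFibering σ Φ pr) (q : S) :
    mfderiv (𝓡 3) (𝓡 2) pr (ι q) (hopfLift σ pr γ s ι q) = baseVelocity pr γ s ι q :=
  (Classical.epsilon_spec (exists_horizontal_lift hΦ hpr (ι q) (baseVelocity pr γ s ι q))).2

theorem eq_zero_of_mfderiv_pr (hpr : IsBoothbyWangFibering σ Φ pr) {x : M}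
    {z : TangentSpace (𝓡 3) x} (h : σ.η x z = 0) (h' : mfderiv (𝓡 3) (𝓡 2) pr x z = 0) : z = 0 := by
  have h1 := hpr.isometry x z z h h
  rw [h', inner_zero_left] at h1
  exact inner_self_eq_zero.1 h1.symm

variable [TopologicalSpace S] [ChartedSpace (EuclideanSpace ℝ (Fin 2)) S]
  [RiemannianBundle (fun q : S => TangentSpace (𝓡 2) q)]

theorem inner_hopfLift_self (hΦ : IsRegularFlow σ Φ) (hpr : IsBoothbyWangFibering σ Φ pr)
    (hγ : IsUnitSpeedCurve T γ) (hι : IsHopfCylinder pr T γ s ι) (q : S) :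
    (inner ℝ (hopfLift σ pr γ s ι q) (hopfLift σ pr γ s ι q) : ℝ) = 1 := by
  rw [← hpr.isometry _ _ _ (eta_hopfLift hΦ hpr q) (eta_hopfLift hΦ hpr q),
    mfderiv_pr_hopfLift hΦ hpr, inner_baseVelocity_self hγ hι]

theorem inner_hopfNormal_self (hΦ : IsRegularFlow σ Φ) (hpr : IsBoothbyWangFibering σ Φ pr)
    (hγ : IsUnitSpeedCurve T γ) (hι : IsHopfCylinder pr T γ s ι) (q : S) :
    (inner ℝ (hopfNormal σ pr γ s ι q) (hopfNormal σ pr γ s ι q) : ℝ) = 1 := by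
  rw [hopfNormal, σ.metric_φ, inner_hopfLift_self hΦ hpr hγ hι, eta_hopfLift hΦ hpr, mul_zero,
    sub_zero]

variable [IsManifold (𝓡 2) ∞ S]

theorem mfderiv_immersion_eq (hΦ : IsRegularFlow σ Φ) (hpr : IsBoothbyWangFibering σ Φ pr)
    (hγ : IsUnitSpeedCurve T γ) (hι : IsHopfCylinder pr T γ s ι) (q : S)
    (v : TangentSpace (𝓡 2) q) :
    mfderiv (𝓡 2) (𝓡 3) ι q v = mvfderiv (𝓡 2) s q v • hopfLift σ pr γ s ι q
      + σ.η (ι q) (mfderiv (𝓡 2) (𝓡 3) ι q v) • σ.ξ (ι q) := by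
  have hX := eta_hopfLift (γ := γ) (s := s) (ι := ι) hΦ hpr q
  have hX' := mfderiv_pr_hopfLift (γ := γ) (s := s) (ι := ι) hΦ hpr q
  have hv := mfderiv_pr_immersion hpr.smooth hγ hι q v
  generalize mfderiv (𝓡 2) (𝓡 3) ι q v = w at hv ⊢
  rw [← sub_eq_zero]
  refine eq_zero_of_mfderiv_pr hpr ?_ ?_
  · rw [map_sub, map_add, map_smul, map_smul, hX, σ.η_ξ, smul_zero, zero_add, smul_eq_mul, mul_one,
      sub_self]
  · rw [map_sub, map_add, map_smul, map_smul, hX', hv, mfderiv_pr_reeb hΦ hpr, smul_zero, add_zero,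
      sub_self]

theorem inner_eq_of_hopfCylinder (hΦ : IsRegularFlow σ Φ) (hpr : IsBoothbyWangFibering σ Φ pr)
    (hγ : IsUnitSpeedCurve T γ) (hι : IsHopfCylinder pr T γ s ι) (q : S)
    (u v : TangentSpace (𝓡 2) q) :
    (inner ℝ u v : ℝ) = mvfderiv (𝓡 2) s q u * mvfderiv (𝓡 2) s q v
      + σ.η (ι q) (mfderiv (𝓡 2) (𝓡 3) ι q u) * σ.η (ι q) (mfderiv (𝓡 2) (𝓡 3) ι q v) := by
  have hX := eta_hopfLift (γ := γ) (s := s) (ι := ι) hΦ hpr q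
  have h0 : (inner ℝ (σ.ξ (ι q)) (hopfLift σ pr γ s ι q) : ℝ) = 0 := by rw [σ.metric_ξ, hX]
  have h0' : (inner ℝ (hopfLift σ pr γ s ι q) (σ.ξ (ι q)) : ℝ) = 0 := by rw [real_inner_comm, h0]
  rw [← hι.isometric, mfderiv_immersion_eq hΦ hpr hγ hι q u, mfderiv_immersion_eq hΦ hpr hγ hι q v]
  simp only [inner_add_left, inner_add_right, real_inner_smul_left, real_inner_smul_right, h0, h0',
    inner_reeb_self, inner_hopfLift_self hΦ hpr hγ hι, map_add, map_smul, hX, σ.η_ξ, smul_eq_mul]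
  ring

theorem inner_immersion_hopfNormal (hΦ : IsRegularFlow σ Φ) (hpr : IsBoothbyWangFibering σ Φ pr)
    (hγ : IsUnitSpeedCurve T γ) (hι : IsHopfCylinder pr T γ s ι) (q : S)
    (v : TangentSpace (𝓡 2) q) :
    (inner ℝ (mfderiv (𝓡 2) (𝓡 3) ι q v) (hopfNormal σ pr γ s ι q) : ℝ) = 0 := by
  rw [mfderiv_immersion_eq hΦ hpr hγ hι, inner_add_left, real_inner_smul_left,
    real_inner_smul_left, hopfNormal, inner_reeb_phi, real_inner_comm, inner_phi_self, mul_zero,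
    mul_zero, add_zero]

theorem exists_mvfderiv_param_ne_zero (hΦ : IsRegularFlow σ Φ)
    (hpr : IsBoothbyWangFibering σ Φ pr) (hγ : IsUnitSpeedCurve T γ)
    (hι : IsHopfCylinder pr T γ s ι) (q : S) :
    ∃ v : TangentSpace (𝓡 2) q, mvfderiv (𝓡 2) s q v ≠ 0 := by
  by_contra! h
  let L : TangentSpace (𝓡 2) q →L[ℝ] ℝ := (σ.η (ι q)).comp (mfderiv (𝓡 2) (𝓡 3) ι q)
  have hL : Function.Injective L.toLinearMap := by
    refine (injective_iff_map_eq_zero _).2 fun v hv => ?_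
    refine (injective_iff_map_eq_zero _).1 (hι.injective q) v ?_
    have hv' : σ.η (ι q) (mfderiv (𝓡 2) (𝓡 3) ι q v) = 0 := hv
    rw [mfderiv_immersion_eq hΦ hpr hγ hι, h, hv', zero_smul, zero_smul, add_zero]
  have h1 := LinearMap.finrank_le_finrank_of_injective hL
  have h2 : Module.finrank ℝ (TangentSpace (𝓡 2) q) = 2 :=
    finrank_euclideanSpace_fin (𝕜 := ℝ) (n := 2)
  rw [h2, Module.finrank_self] at h1
  omega

theorem sum_mvfderiv_param (hΦ : IsRegularFlow σ Φ) (hpr : IsBoothbyWangFibering σ Φ pr)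
    (hγ : IsUnitSpeedCurve T γ) (hι : IsHopfCylinder pr T γ s ι) (q : S) :
    (∑ i, mvfderiv (𝓡 2) s q (stdOrthonormalBasis ℝ (TangentSpace (𝓡 2) q) i)
        * mvfderiv (𝓡 2) s q (stdOrthonormalBasis ℝ (TangentSpace (𝓡 2) q) i) = 1)
      ∧ ∑ i, mvfderiv (𝓡 2) s q (stdOrthonormalBasis ℝ (TangentSpace (𝓡 2) q) i)
        * σ.η (ι q) (mfderiv (𝓡 2) (𝓡 3) ι q
          (stdOrthonormalBasis ℝ (TangentSpace (𝓡 2) q) i)) = 0 := by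
  refine sum_columns_of_orthonormal_rows ?_ fun i j => ?_
  · rw [Fintype.card_fin]
    exact finrank_euclideanSpace_fin (𝕜 := ℝ) (n := 2)
  · rw [← inner_eq_of_hopfCylinder hΦ hpr hγ hι, OrthonormalBasis.inner_eq_ite]
    congr

theorem normalPart_hopfCylinder (hΦ : IsRegularFlow σ Φ) (hpr : IsBoothbyWangFibering σ Φ pr)
    (hγ : IsUnitSpeedCurve T γ) (hι : IsHopfCylinder pr T γ s ι) (q : S)
    (w : TangentSpace (𝓡 3) (ι q)) : normalPart (𝓡 3) ι q w
      = (inner ℝ (hopfNormal σ pr γ s ι q) w : ℝ) • hopfNormal σ pr γ s ι q :=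
  normalPart_eq (hι.injective q) (inner_hopfNormal_self hΦ hpr hγ hι q)
    (inner_immersion_hopfNormal hΦ hpr hγ hι q) w

theorem contMDiffAlongAt_mfderiv_extend (hι : IsHopfCylinder pr T γ s ι) (q : S)
    (v : TangentSpace (𝓡 2) q) : ContMDiffAlongAt (𝓡 2) ∞ ι (fun q' => mfderiv (𝓡 2) (𝓡 3) ι q'
      (FiberBundle.extend (EuclideanSpace ℝ (Fin 2)) v q')) q :=
  ContMDiffAlongAt.map (f := fun q : S => q) (hι.contMDiff_immersion q)
    (contMDiffAlongAt_extend q v)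

theorem contMDiffAt_mvfderiv_param_extend (hι : IsHopfCylinder pr T γ s ι) (q : S)
    (v : TangentSpace (𝓡 2) q) : ContMDiffAt (𝓡 2) 𝓘(ℝ, ℝ) ∞ (fun q' => mvfderiv (𝓡 2) s q'
      (FiberBundle.extend (EuclideanSpace ℝ (Fin 2)) v q')) q :=
  contMDiffAt_mvfderiv_apply (hι.contMDiff_param q) (contMDiffAlongAt_extend q v)

theorem contMDiffAlongAt_hopfNormal [T2Space M]
    (hΦ : IsRegularFlow σ Φ) (hpr : IsBoothbyWangFibering σ Φ pr)
    (hγ : IsUnitSpeedCurve T γ) (hι : IsHopfCylinder pr T γ s ι) (q : S) :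
    ContMDiffAlongAt (𝓡 2) ∞ ι (hopfNormal σ pr γ s ι) q := by
  obtain ⟨v, hv⟩ := exists_mvfderiv_param_ne_zero hΦ hpr hγ hι q
  have hd := contMDiffAt_mvfderiv_param_extend hι q v
  have hv' : mvfderiv (𝓡 2) s q (FiberBundle.extend (EuclideanSpace ℝ (Fin 2)) v q) ≠ 0 := by
    rwa [FiberBundle.extend_apply_self]
  refine (ContMDiffAlongAt.smul (hd.inv₀ hv') (ContMDiffAlongAt.phi (σ := σ)
    (contMDiffAlongAt_mfderiv_extend hι q v))).congr ?_
  filter_upwards [hd.continuousAt.eventually_ne hv'] with q' hq'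
  rw [mfderiv_immersion_eq hΦ hpr hγ hι, map_add, map_smul, map_smul, phi_reeb, smul_zero,
    add_zero, smul_smul, inv_mul_cancel₀ hq', one_smul]
  rfl

end Frame

section Hessian

variable {E : Type*} [NormedAddCommGroup E] [NormedSpace ℝ E] [FiniteDimensional ℝ E]
  {S : Type*} [TopologicalSpace S] [ChartedSpace E S] [IsManifold 𝓘(ℝ, E) ∞ S]
  [RiemannianBundle (fun x : S => TangentSpace 𝓘(ℝ, E) x)]

/-- The covariant second derivative of a function. -/
def scalarHessian (f : S → ℝ) (q : S) (u v : TangentSpace 𝓘(ℝ, E) q) : ℝ :=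
  mvfderiv 𝓘(ℝ, E) (fun q' => mvfderiv 𝓘(ℝ, E) f q' (FiberBundle.extend E v q')) q u
    - mvfderiv 𝓘(ℝ, E) f q (leviCivita 𝓘(ℝ, E) (FiberBundle.extend E u) (FiberBundle.extend E v) q)

theorem covField_extend (q : S) (u v : TangentSpace 𝓘(ℝ, E) q) :
    covField (FiberBundle.extend E v) q u
      = leviCivita 𝓘(ℝ, E) (FiberBundle.extend E u) (FiberBundle.extend E v) q := by
  have h0 : mfderiv 𝓘(ℝ, E) 𝓘(ℝ, E) (fun y : S => y) q u = u := DFunLike.congr_fun mfderiv_id u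
  have h1 : coordDeriv 𝓘(ℝ, E) (fun y : S => y) (FiberBundle.extend E v) q u = 0 :=
    DFunLike.congr_fun (mvfderiv_eventuallyEq_const (tangentCoord_extend (E := E) v)) u
  rw [covField, covAlong_eq (f := fun y : S => y) continuousAt_id, h1, h0, zero_add, FiberBundle.extend_apply_self]
  rfl

end Hessian

section SecondOrder

set_option linter.unusedSectionVars false

variable {M : Type*} [TopologicalSpace M] [ChartedSpace (EuclideanSpace ℝ (Fin 3)) M]
  [IsManifold (𝓡 3) ∞ M] [RiemannianBundle (fun x : M => TangentSpace (𝓡 3) x)]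
  [IsContMDiffRiemannianBundle (𝓡 3) ∞ (EuclideanSpace ℝ (Fin 3))
      (fun x : M => TangentSpace (𝓡 3) x)]
  {B : Type*} [TopologicalSpace B] [ChartedSpace (EuclideanSpace ℝ (Fin 2)) B]
  [IsManifold (𝓡 2) ∞ B] [RiemannianBundle (fun b : B => TangentSpace (𝓡 2) b)]
  [IsContMDiffRiemannianBundle (𝓡 2) ∞ (EuclideanSpace ℝ (Fin 2))
      (fun b : B => TangentSpace (𝓡 2) b)]
  {S : Type*} [TopologicalSpace S] [ChartedSpace (EuclideanSpace ℝ (Fin 2)) S]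
  [IsManifold (𝓡 2) ∞ S] [RiemannianBundle (fun q : S => TangentSpace (𝓡 2) q)]
  [IsContMDiffRiemannianBundle (𝓡 2) ∞ (EuclideanSpace ℝ (Fin 2))
      (fun q : S => TangentSpace (𝓡 2) q)]
  {σ : SasakiStructure M} {Φ : ℝ → M → M} {pr : M → B} {T : Set ℝ} {γ : ℝ → B}
  {s : S → ℝ} {ι : S → M}

theorem covAlong_mfderiv_extend (hι : IsHopfCylinder pr T γ s ι) (q : S)
    (u v : TangentSpace (𝓡 2) q) :
    covAlong (𝓡 2) (𝓡 3) ι (fun q' => mfderiv (𝓡 2) (𝓡 3) ι q'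
        (FiberBundle.extend (EuclideanSpace ℝ (Fin 2)) v q')) q u
      = mapHessian (EuclideanSpace ℝ (Fin 2)) (EuclideanSpace ℝ (Fin 3)) ι q u v
        + mfderiv (𝓡 2) (𝓡 3) ι q (leviCivita (𝓡 2)
          (FiberBundle.extend (EuclideanSpace ℝ (Fin 2)) u)
          (FiberBundle.extend (EuclideanSpace ℝ (Fin 2)) v) q) := by
  have h := covAlong_map_field (hι.contMDiff_immersion q)
    ((contMDiffAlongAt_extend (n := ∞) q v).mdiff (by simp)) u
  rwa [covField_extend, FiberBundle.extend_apply_self] at h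

theorem mapHessian_immersion_eq (hΦ : IsRegularFlow σ Φ) (hpr : IsBoothbyWangFibering σ Φ pr)
    (hγ : IsUnitSpeedCurve T γ) (hι : IsHopfCylinder pr T γ s ι) (q : S)
    (u v : TangentSpace (𝓡 2) q) :
    mapHessian (EuclideanSpace ℝ (Fin 2)) (EuclideanSpace ℝ (Fin 3)) ι q u v
      = (inner ℝ (hopfNormal σ pr γ s ι q)
        (mapHessian (EuclideanSpace ℝ (Fin 2)) (EuclideanSpace ℝ (Fin 3)) ι q u v) : ℝ)
          • hopfNormal σ pr γ s ι q := by
  rw [← normalPart_hopfCylinder hΦ hpr hγ hι]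
  symm
  refine Submodule.starProjection_eq_self_iff.2 ?_
  rintro _ ⟨c, rfl⟩
  rw [real_inner_comm]
  exact inner_mapHessian_eq_zero_of_isometry (hι.contMDiff_immersion q) hι.isometric u v c

theorem secondFundamentalForm_eq (hΦ : IsRegularFlow σ Φ) (hpr : IsBoothbyWangFibering σ Φ pr)
    (hγ : IsUnitSpeedCurve T γ) (hι : IsHopfCylinder pr T γ s ι) (q : S)
    (u v : TangentSpace (𝓡 2) q) :
    secondFundamentalForm (𝓡 3) ι q u v
      = mapHessian (EuclideanSpace ℝ (Fin 2)) (EuclideanSpace ℝ (Fin 3)) ι q u v := by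
  rw [secondFundamentalForm, normalConnection, covAlong_mfderiv_extend hι,
    normalPart_hopfCylinder hΦ hpr hγ hι, inner_add_right,
    real_inner_comm (mfderiv (𝓡 2) (𝓡 3) ι q _), inner_immersion_hopfNormal hΦ hpr hγ hι, add_zero,
    ← mapHessian_immersion_eq hΦ hpr hγ hι]

/-- The projection of the second fundamental form of a Hopf cylinder. -/
theorem mapHessian_pr_immersion (hpr : IsBoothbyWangFibering σ Φ pr)
    (hγ : IsUnitSpeedCurve T γ) (hι : IsHopfCylinder pr T γ s ι) (q : S)
    (u v : TangentSpace (𝓡 2) q) :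
    mapHessian (EuclideanSpace ℝ (Fin 3)) (EuclideanSpace ℝ (Fin 2)) pr (ι q)
        (mfderiv (𝓡 2) (𝓡 3) ι q u) (mfderiv (𝓡 2) (𝓡 3) ι q v)
      + mfderiv (𝓡 3) (𝓡 2) pr (ι q)
        (mapHessian (EuclideanSpace ℝ (Fin 2)) (EuclideanSpace ℝ (Fin 3)) ι q u v)
      = scalarHessian s q u v • baseVelocity pr γ s ι q
        + (mvfderiv (𝓡 2) s q u * mvfderiv (𝓡 2) s q v) • baseAcceleration pr γ s ι q := by
  have hV := (contMDiffAlongAt_mfderiv_extend hι q v).mdiff (by simp)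
  have h1 := covAlong_map (hpr.smooth (ι q)) hV u
  have hd := (contMDiffAt_mvfderiv_param_extend hι q v).mdifferentiableAt (by simp)
  have hG := (contMDiffAlongAt_baseVelocity hγ hι q).mdiff (by simp)
  have h2 := covAlong_smul hd hG u
  have h3 : (fun q' => mfderiv (𝓡 3) (𝓡 2) pr (ι q') (mfderiv (𝓡 2) (𝓡 3) ι q'
      (FiberBundle.extend (EuclideanSpace ℝ (Fin 2)) v q')))
      = fun q' => mvfderiv (𝓡 2) s q' (FiberBundle.extend (EuclideanSpace ℝ (Fin 2)) v q')
        • baseVelocity pr γ s ι q' := by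
    funext q'
    exact mfderiv_pr_immersion hpr.smooth hγ hι q' _
  rw [h3, h2, covAlong_mfderiv_extend hι, map_add, mfderiv_pr_immersion hpr.smooth hγ hι,
    FiberBundle.extend_apply_self, covAlong_baseVelocity hγ hι] at h1
  rw [scalarHessian, sub_smul, mul_comm (mvfderiv (𝓡 2) s q u), mul_smul]
  rw [← add_assoc] at h1
  rw [eq_sub_of_add_eq h1.symm]
  abel

variable [T2Space M]

theorem sum_mapHessian_pr_immersion (hΦ : IsRegularFlow σ Φ) (hpr : IsBoothbyWangFibering σ Φ pr)
    (hγ : IsUnitSpeedCurve T γ) (hι : IsHopfCylinder pr T γ s ι) (q : S) :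
    ∑ i, mapHessian (EuclideanSpace ℝ (Fin 3)) (EuclideanSpace ℝ (Fin 2)) pr (ι q)
        (mfderiv (𝓡 2) (𝓡 3) ι q (stdOrthonormalBasis ℝ (TangentSpace (𝓡 2) q) i))
        (mfderiv (𝓡 2) (𝓡 3) ι q (stdOrthonormalBasis ℝ (TangentSpace (𝓡 2) q) i)) = 0 := by
  have hX := eta_hopfLift (γ := γ) (s := s) (ι := ι) hΦ hpr q
  have h (v : TangentSpace (𝓡 2) q) :
      mapHessian (EuclideanSpace ℝ (Fin 3)) (EuclideanSpace ℝ (Fin 2)) pr (ι q)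
        (mfderiv (𝓡 2) (𝓡 3) ι q v) (mfderiv (𝓡 2) (𝓡 3) ι q v)
      = (2 * (mvfderiv (𝓡 2) s q v * σ.η (ι q) (mfderiv (𝓡 2) (𝓡 3) ι q v))) •
        mapHessian (EuclideanSpace ℝ (Fin 3)) (EuclideanSpace ℝ (Fin 2)) pr (ι q)
          (hopfLift σ pr γ s ι q) (σ.ξ (ι q)) := by
    rw [← mapHessian_self_combination (hpr.smooth (ι q)) (mapHessian_pr_horizontal hΦ hpr _ hX hX)
      (mapHessian_pr_reeb hΦ hpr _), ← mfderiv_immersion_eq hΦ hpr hγ hι]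
  simp only [h]
  rw [← Finset.sum_smul, ← Finset.mul_sum, (sum_mvfderiv_param hΦ hpr hγ hι q).2, mul_zero,
    zero_smul]

theorem mfderiv_pr_meanCurvatureVector (hΦ : IsRegularFlow σ Φ)
    (hpr : IsBoothbyWangFibering σ Φ pr)
    (hγ : IsUnitSpeedCurve T γ) (hι : IsHopfCylinder pr T γ s ι) (q : S) :
    mfderiv (𝓡 3) (𝓡 2) pr (ι q) (meanCurvatureVector (𝓡 3) ι q)
      = (1 / 2 : ℝ) • ((∑ i, scalarHessian s q (stdOrthonormalBasis ℝ (TangentSpace (𝓡 2) q) i)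
          (stdOrthonormalBasis ℝ (TangentSpace (𝓡 2) q) i)) • baseVelocity pr γ s ι q
        + baseAcceleration pr γ s ι q) := by
  have h := Finset.sum_congr (Eq.refl Finset.univ) fun i _ => mapHessian_pr_immersion hpr hγ hι q
    (stdOrthonormalBasis ℝ (TangentSpace (𝓡 2) q) i)
    (stdOrthonormalBasis ℝ (TangentSpace (𝓡 2) q) i)
  rw [Finset.sum_add_distrib, Finset.sum_add_distrib, sum_mapHessian_pr_immersion hΦ hpr hγ hι,
    ← Finset.sum_smul, ← Finset.sum_smul, (sum_mvfderiv_param hΦ hpr hγ hι q).1, zero_add, one_smul,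
    ← map_sum] at h
  rw [meanCurvatureVector, map_smul, ← h]
  simp only [secondFundamentalForm_eq hΦ hpr hγ hι]

theorem complexStructure_velocity (hΦ : IsRegularFlow σ Φ)
    (hpr : IsBoothbyWangFibering σ Φ pr) (hι : IsHopfCylinder pr T γ s ι) (q : S) :
    (complexStructure σ pr hpr.surjective (γ (s q)) (velocity γ (s q)) : EuclideanSpace ℝ (Fin 2))
      = mfderiv (𝓡 3) (𝓡 2) pr (ι q) (hopfNormal σ pr γ s ι q) := by
  have h1 := complexStructure_mfderiv_pr hΦ hpr (ι q) (hopfLift σ pr γ s ι q)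
  rw [mfderiv_pr_hopfLift hΦ hpr] at h1
  have h2 {b b' : B} (h : b = b') (u : EuclideanSpace ℝ (Fin 2)) :
      (complexStructure σ pr hpr.surjective b u : EuclideanSpace ℝ (Fin 2))
        = complexStructure σ pr hpr.surjective b' u := by
    subst h
    rfl
  exact (h2 (hι.mem q).2 (velocity γ (s q))).symm.trans h1

/-- The signed curvature of the base curve, computed on the surface. -/
theorem signedCurvature_eq (hΦ : IsRegularFlow σ Φ)
    (hpr : IsBoothbyWangFibering σ Φ pr) (hι : IsHopfCylinder pr T γ s ι) (q : S) :
    signedCurvature (complexStructure σ pr hpr.surjective) γ (s q)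
      = inner ℝ (baseAcceleration pr γ s ι q)
        (mfderiv (𝓡 3) (𝓡 2) pr (ι q) (hopfNormal σ pr γ s ι q)) := by
  refine Eq.trans ?_ (inner_tangent_congr (E := EuclideanSpace ℝ (Fin 2)) (hι.mem q).2.symm _ _)
  exact congrArg (fun w : TangentSpace (𝓡 2) (γ (s q)) => (inner ℝ (acceleration γ (s q)) w : ℝ))
    (complexStructure_velocity hΦ hpr hι q)

theorem inner_mfderiv_pr_hopfNormal_self (hΦ : IsRegularFlow σ Φ)
    (hpr : IsBoothbyWangFibering σ Φ pr) (hγ : IsUnitSpeedCurve T γ)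
    (hι : IsHopfCylinder pr T γ s ι) (q : S) :
    (inner ℝ (mfderiv (𝓡 3) (𝓡 2) pr (ι q) (hopfNormal σ pr γ s ι q))
      (mfderiv (𝓡 3) (𝓡 2) pr (ι q) (hopfNormal σ pr γ s ι q)) : ℝ) = 1 :=
  (inner_mfderiv_pr_phi hΦ hpr _ _ _).trans (inner_hopfNormal_self hΦ hpr hγ hι q)

theorem inner_mfderiv_pr_hopfNormal_baseVelocity (hΦ : IsRegularFlow σ Φ)
    (hpr : IsBoothbyWangFibering σ Φ pr) (q : S) :
    (inner ℝ (mfderiv (𝓡 3) (𝓡 2) pr (ι q) (hopfNormal σ pr γ s ι q))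
      (baseVelocity pr γ s ι q) : ℝ) = 0 := by
  rw [← mfderiv_pr_hopfLift hΦ hpr, hopfNormal, inner_mfderiv_pr_phi hΦ hpr, inner_phi_self]

theorem meanCurvatureVector_eq (hΦ : IsRegularFlow σ Φ)
    (hpr : IsBoothbyWangFibering σ Φ pr)
    (hγ : IsUnitSpeedCurve T γ) (hι : IsHopfCylinder pr T γ s ι) (q : S) :
    (∑ i, scalarHessian s q (stdOrthonormalBasis ℝ (TangentSpace (𝓡 2) q) i)
          (stdOrthonormalBasis ℝ (TangentSpace (𝓡 2) q) i) = 0)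
      ∧ baseAcceleration pr γ s ι q
        = signedCurvature (complexStructure σ pr hpr.surjective) γ (s q)
          • mfderiv (𝓡 3) (𝓡 2) pr (ι q) (hopfNormal σ pr γ s ι q)
      ∧ meanCurvatureVector (𝓡 3) ι q
        = (signedCurvature (complexStructure σ pr hpr.surjective) γ (s q) / 2)
          • hopfNormal σ pr γ s ι q := by
  have h := mfderiv_pr_meanCurvatureVector hΦ hpr hγ hι q
  have hκ := signedCurvature_eq hΦ hpr hι q
  have hNN := inner_mfderiv_pr_hopfNormal_self hΦ hpr hγ hι q
  have hNG := inner_mfderiv_pr_hopfNormal_baseVelocity (γ := γ) (s := s) (ι := ι) hΦ hpr q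
  have hAG := inner_baseAcceleration_baseVelocity hγ hι q
  have hGG := inner_baseVelocity_self hγ hι q
  obtain ⟨c, hc⟩ : ∃ c : ℝ, meanCurvatureVector (𝓡 3) ι q = c • hopfNormal σ pr γ s ι q := by
    refine ⟨1 / 2 * ∑ i, inner ℝ (hopfNormal σ pr γ s ι q)
      (mapHessian (EuclideanSpace ℝ (Fin 2)) (EuclideanSpace ℝ (Fin 3)) ι q
        (stdOrthonormalBasis ℝ (TangentSpace (𝓡 2) q) i)
        (stdOrthonormalBasis ℝ (TangentSpace (𝓡 2) q) i)), ?_⟩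
    rw [meanCurvatureVector, mul_smul, Finset.sum_smul]
    simp only [secondFundamentalForm_eq hΦ hpr hγ hι, ← mapHessian_immersion_eq hΦ hpr hγ hι]
  generalize (∑ i, scalarHessian s q (stdOrthonormalBasis ℝ (TangentSpace (𝓡 2) q) i)
          (stdOrthonormalBasis ℝ (TangentSpace (𝓡 2) q) i)) = d at h ⊢
  rw [hc, map_smul] at h
  rw [hκ, hc]
  generalize mfderiv (𝓡 3) (𝓡 2) pr (ι q) (hopfNormal σ pr γ s ι q) = n at h hNN hNG ⊢
  have hd : d = 0 := by
    have := congrArg (fun w => (inner ℝ w (baseVelocity pr γ s ι q) : ℝ)) h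
    simp only [real_inner_smul_left, inner_add_left, hNG, hAG, hGG] at this
    linarith
  rw [hd, zero_smul, zero_add] at h
  have hA : baseAcceleration pr γ s ι q = (2 * c) • n := by
    rw [mul_smul, h, smul_smul]
    norm_num
  refine ⟨hd, ?_, ?_⟩
  · rw [hA, real_inner_smul_left, hNN, mul_one]
  · rw [hA, real_inner_smul_left, hNN, mul_one, mul_div_cancel_left₀ c two_ne_zero]

end SecondOrder

section HessianComp

variable {E : Type*} [NormedAddCommGroup E] [NormedSpace ℝ E]
  {S : Type*} [TopologicalSpace S] [ChartedSpace E S]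

theorem mvfderiv_comp_real {K : ℝ → ℝ} {s : S → ℝ} {q : S} (hK : DifferentiableAt ℝ K (s q))
    (hs : MDifferentiableAt 𝓘(ℝ, E) 𝓘(ℝ, ℝ) s q) (v : TangentSpace 𝓘(ℝ, E) q) :
    mvfderiv 𝓘(ℝ, E) (fun q' => K (s q')) q v = deriv K (s q) * mvfderiv 𝓘(ℝ, E) s q v := by
  refine (mvfderiv_comp_vector hK.mdifferentiableAt hs v).trans ?_
  have h : (mvfderiv 𝓘(ℝ, ℝ) K (s q) : ℝ →L[ℝ] ℝ) = fderiv ℝ K (s q) := mfderiv_eq_fderiv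
  have h' (r : ℝ) : fderiv ℝ K (s q) r = deriv K (s q) * r := by
    rw [fderiv_eq_smul_deriv, smul_eq_mul, mul_comm]
  exact (DFunLike.congr_fun h (mvfderiv 𝓘(ℝ, E) s q v)).trans (h' _)

variable [FiniteDimensional ℝ E] [IsManifold 𝓘(ℝ, E) ∞ S]
  [RiemannianBundle (fun x : S => TangentSpace 𝓘(ℝ, E) x)]

theorem scalarHessian_comp {K : ℝ → ℝ} {s : S → ℝ} {q : S} (hK : ∀ q, ContDiffAt ℝ ∞ K (s q))
    (hs : ContMDiff 𝓘(ℝ, E) 𝓘(ℝ, ℝ) ∞ s) (u v : TangentSpace 𝓘(ℝ, E) q) :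
    scalarHessian (fun q => K (s q)) q u v
      = deriv (deriv K) (s q) * (mvfderiv 𝓘(ℝ, E) s q u * mvfderiv 𝓘(ℝ, E) s q v)
        + deriv K (s q) * scalarHessian s q u v := by
  have hsd (q) : MDifferentiableAt 𝓘(ℝ, E) 𝓘(ℝ, ℝ) s q := (hs q).mdifferentiableAt (by simp)
  have hKd (q) : DifferentiableAt ℝ K (s q) := (hK q).differentiableAt (by simp)
  have hK' : DifferentiableAt ℝ (deriv K) (s q) :=
    (((hK q).derivWithin (m := ∞) (by simp)).differentiableAt (by simp))
  have h1 : (fun q' => mvfderiv 𝓘(ℝ, E) (fun q => K (s q)) q' (FiberBundle.extend E v q'))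
      = fun q' => deriv K (s q') * mvfderiv 𝓘(ℝ, E) s q' (FiberBundle.extend E v q') :=
    funext fun q' => mvfderiv_comp_real (hKd q') (hsd q') _
  have hd := (contMDiffAt_mvfderiv_apply (hs q)
    (contMDiffAlongAt_extend (n := ∞) q v)).mdifferentiableAt (by simp)
  have hc : MDifferentiableAt 𝓘(ℝ, E) 𝓘(ℝ, ℝ) (fun q' => deriv K (s q')) q :=
    hK'.mdifferentiableAt.comp q (hsd q)
  have h2 := DFunLike.congr_fun (mvfderiv_fun_mul hc hd) u
  have h3 : mvfderiv 𝓘(ℝ, E) (fun q' => deriv K (s q')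
        * mvfderiv 𝓘(ℝ, E) s q' (FiberBundle.extend E v q')) q u
      = deriv K (s q) * mvfderiv 𝓘(ℝ, E) (fun q' => mvfderiv 𝓘(ℝ, E) s q'
          (FiberBundle.extend E v q')) q u
        + mvfderiv 𝓘(ℝ, E) s q (FiberBundle.extend E v q)
          * mvfderiv 𝓘(ℝ, E) (fun q' => deriv K (s q')) q u := h2
  rw [scalarHessian, scalarHessian, h1, h3, mvfderiv_comp_real hK' (hsd q),
    mvfderiv_comp_real (hKd q) (hsd q), FiberBundle.extend_apply_self]
  ring

end HessianComp

section NormalLaplacian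

set_option linter.unusedSectionVars false

variable {M : Type*} [TopologicalSpace M] [ChartedSpace (EuclideanSpace ℝ (Fin 3)) M]
  [IsManifold (𝓡 3) ∞ M] [RiemannianBundle (fun x : M => TangentSpace (𝓡 3) x)]
  [IsContMDiffRiemannianBundle (𝓡 3) ∞ (EuclideanSpace ℝ (Fin 3))
      (fun x : M => TangentSpace (𝓡 3) x)] [T2Space M]
  {B : Type*} [TopologicalSpace B] [ChartedSpace (EuclideanSpace ℝ (Fin 2)) B]
  [IsManifold (𝓡 2) ∞ B] [RiemannianBundle (fun b : B => TangentSpace (𝓡 2) b)]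
  [IsContMDiffRiemannianBundle (𝓡 2) ∞ (EuclideanSpace ℝ (Fin 2))
      (fun b : B => TangentSpace (𝓡 2) b)]
  {S : Type*} [TopologicalSpace S] [ChartedSpace (EuclideanSpace ℝ (Fin 2)) S]
  [IsManifold (𝓡 2) ∞ S] [RiemannianBundle (fun q : S => TangentSpace (𝓡 2) q)]
  [IsContMDiffRiemannianBundle (𝓡 2) ∞ (EuclideanSpace ℝ (Fin 2))
      (fun q : S => TangentSpace (𝓡 2) q)]
  {σ : SasakiStructure M} {Φ : ℝ → M → M} {pr : M → B} {T : Set ℝ} {γ : ℝ → B}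
  {s : S → ℝ} {ι : S → M}

theorem normalConnection_smul_hopfNormal (hΦ : IsRegularFlow σ Φ)
    (hpr : IsBoothbyWangFibering σ Φ pr) (hγ : IsUnitSpeedCurve T γ)
    (hι : IsHopfCylinder pr T γ s ι) {k : S → ℝ} {q : S}
    (hk : MDifferentiableAt (𝓡 2) 𝓘(ℝ, ℝ) k q) (v : TangentSpace (𝓡 2) q) :
    normalConnection (𝓡 3) ι (fun q' => k q' • hopfNormal σ pr γ s ι q') q v
      = mvfderiv (𝓡 2) k q v • hopfNormal σ pr γ s ι q := by
  have hN := (contMDiffAlongAt_hopfNormal hΦ hpr hγ hι q).mdiff (by simp)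
  have hNN := inner_hopfNormal_self hΦ hpr hγ hι
  have h1 := mvfderiv_inner_along hN hN v
  have h0 : mvfderiv (𝓡 2) (fun q' => (inner ℝ (hopfNormal σ pr γ s ι q')
      (hopfNormal σ pr γ s ι q') : ℝ)) q v = 0 :=
    DFunLike.congr_fun (mvfderiv_eventuallyEq_const (Filter.Eventually.of_forall hNN)) v
  rw [h0, real_inner_comm (hopfNormal σ pr γ s ι q)] at h1
  have h2 : (inner ℝ (hopfNormal σ pr γ s ι q)
      (covAlong (𝓡 2) (𝓡 3) ι (hopfNormal σ pr γ s ι) q v) : ℝ) = 0 := by linarith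
  rw [normalConnection, covAlong_smul hk hN, normalPart_hopfCylinder hΦ hpr hγ hι,
    inner_add_right, real_inner_smul_right, real_inner_smul_right, hNN, h2, mul_one, mul_zero,
    add_zero]

theorem normalHessian_smul_hopfNormal (hΦ : IsRegularFlow σ Φ)
    (hpr : IsBoothbyWangFibering σ Φ pr) (hγ : IsUnitSpeedCurve T γ)
    (hι : IsHopfCylinder pr T γ s ι) {k : S → ℝ} (hk : ContMDiff (𝓡 2) 𝓘(ℝ, ℝ) ∞ k) (q : S)
    (u v : TangentSpace (𝓡 2) q) :
    normalHessian (𝓡 3) ι (fun q' => k q' • hopfNormal σ pr γ s ι q') q u v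
      = scalarHessian k q u v • hopfNormal σ pr γ s ι q := by
  have hkd (q) : MDifferentiableAt (𝓡 2) 𝓘(ℝ, ℝ) k q := (hk q).mdifferentiableAt (by simp)
  have h1 : (fun q' => normalConnection (𝓡 3) ι (fun q' => k q' • hopfNormal σ pr γ s ι q') q'
      (FiberBundle.extend (EuclideanSpace ℝ (Fin 2)) v q'))
      = fun q' => mvfderiv (𝓡 2) k q' (FiberBundle.extend (EuclideanSpace ℝ (Fin 2)) v q')
        • hopfNormal σ pr γ s ι q' :=
    funext fun q' => normalConnection_smul_hopfNormal hΦ hpr hγ hι (hkd q') _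
  have hd := (contMDiffAt_mvfderiv_apply (hk q)
    (contMDiffAlongAt_extend (n := ∞) q v)).mdifferentiableAt (by simp)
  rw [normalHessian, h1, normalConnection_smul_hopfNormal hΦ hpr hγ hι hd,
    normalConnection_smul_hopfNormal hΦ hpr hγ hι (hkd q), ← sub_smul]
  rfl

theorem normalLaplacian_smul_hopfNormal (hΦ : IsRegularFlow σ Φ)
    (hpr : IsBoothbyWangFibering σ Φ pr) (hγ : IsUnitSpeedCurve T γ)
    (hι : IsHopfCylinder pr T γ s ι) {K : ℝ → ℝ} (hK : ∀ t ∈ T, ContDiffAt ℝ ∞ K t) (q : S) :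
    normalLaplacian (𝓡 3) ι (fun q' => K (s q') • hopfNormal σ pr γ s ι q') q
      = (-deriv (deriv K) (s q)) • hopfNormal σ pr γ s ι q := by
  have hs := hι.contMDiff_param
  have hKs (q : S) : ContDiffAt ℝ ∞ K (s q) := hK _ (hι.mem q).1
  have hk : ContMDiff (𝓡 2) 𝓘(ℝ, ℝ) ∞ (fun q => K (s q)) := fun q =>
    (hKs q).contMDiffAt.comp q (hs q)
  rw [normalLaplacian, neg_smul]
  simp only [normalHessian_smul_hopfNormal hΦ hpr hγ hι hk, scalarHessian_comp hKs hs]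
  rw [← Finset.sum_smul, Finset.sum_add_distrib, ← Finset.mul_sum, ← Finset.mul_sum,
    (sum_mvfderiv_param hΦ hpr hγ hι q).1, (meanCurvatureVector_eq hΦ hpr hγ hι q).1, mul_one,
    mul_zero, add_zero]

end NormalLaplacian

section PullbackHessian

variable {E : Type*} [NormedAddCommGroup E] [NormedSpace ℝ E]
  {M : Type*} [TopologicalSpace M] [ChartedSpace E M] [IsManifold 𝓘(ℝ, E) ∞ M]
  {E₂ : Type*} [NormedAddCommGroup E₂] [NormedSpace ℝ E₂] [FiniteDimensional ℝ E₂]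
  {B : Type*} [TopologicalSpace B] [ChartedSpace E₂ B] [IsManifold 𝓘(ℝ, E₂) ∞ B]
  [RiemannianBundle (fun x : B => TangentSpace 𝓘(ℝ, E₂) x)]
  {E' : Type*} [NormedAddCommGroup E'] [NormedSpace ℝ E']
  {H' : Type*} [TopologicalSpace H'] {I' : ModelWithCorners ℝ E' H'}
  {N : Type*} [TopologicalSpace N] [ChartedSpace H' N]

variable (E E₂) in
/-- The second derivative of a map, in coordinates of the source. -/
def pullbackHessian (g : M → B) (x : M) (a b : TangentSpace 𝓘(ℝ, E) x) :
    TangentSpace 𝓘(ℝ, E₂) (g x) :=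
  coordHessian E E₂ g x a b
    + christoffel (g x) (mfderiv 𝓘(ℝ, E) 𝓘(ℝ, E₂) g x a) (mfderiv 𝓘(ℝ, E) 𝓘(ℝ, E₂) g x b)

theorem covAlong_map_coord {g : M → B} {f : N → M} {W : ∀ q : N, TangentSpace 𝓘(ℝ, E) (f q)}
    {q : N} (hg : ContMDiffAt 𝓘(ℝ, E) 𝓘(ℝ, E₂) ∞ g (f q)) (hW : MDiffAlongAt I' f W q)
    (v : TangentSpace I' q) :
    covAlong I' 𝓘(ℝ, E₂) (fun q' => g (f q'))
        (fun q' => mfderiv 𝓘(ℝ, E) 𝓘(ℝ, E₂) g (f q') (W q')) q v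
      = pullbackHessian E E₂ g (f q) (mfderiv I' 𝓘(ℝ, E) f q v) (W q)
        + mfderiv 𝓘(ℝ, E) 𝓘(ℝ, E₂) g (f q) (coordDeriv I' f W q v) := by
  have h1 := mfderiv_comp_apply q (hg.mdifferentiableAt (by simp)) hW.1 v
  have h2 : mfderiv I' 𝓘(ℝ, E₂) (fun q' => g (f q')) q v
      = mfderiv 𝓘(ℝ, E) 𝓘(ℝ, E₂) g (f q) (mfderiv I' 𝓘(ℝ, E) f q v) := h1
  have h3 : ContinuousAt (fun q' => g (f q')) q :=
    ContinuousAt.comp (f := f) hg.continuousAt hW.1.continuousAt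
  rw [covAlong_eq h3, coordDeriv_map hg hW, pullbackHessian, h2]
  abel

variable [IsContMDiffRiemannianBundle 𝓘(ℝ, E₂) ∞ E₂ (fun x : B => TangentSpace 𝓘(ℝ, E₂) x)]

theorem pullbackHessian_symm {g : M → B} {x : M} (hg : ContMDiffAt 𝓘(ℝ, E) 𝓘(ℝ, E₂) ∞ g x)
    (a b : TangentSpace 𝓘(ℝ, E) x) :
    pullbackHessian E E₂ g x a b = pullbackHessian E E₂ g x b a := by
  rw [pullbackHessian, pullbackHessian, coordHessian_symm hg, christoffel_symm (g x)]

end PullbackHessian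

section Chart

variable {E : Type*} [NormedAddCommGroup E] [NormedSpace ℝ E] [FiniteDimensional ℝ E]
  {B : Type*} [TopologicalSpace B] [ChartedSpace E B] [IsManifold 𝓘(ℝ, E) ∞ B]
  [RiemannianBundle (fun x : B => TangentSpace 𝓘(ℝ, E) x)]

omit [FiniteDimensional ℝ E] [RiemannianBundle (fun x : B => TangentSpace 𝓘(ℝ, E) x)] in
theorem contMDiffAt_extChartAt_symm' (y : B) {z : E} (hz : z ∈ (extChartAt 𝓘(ℝ, E) y).target) :
    ContMDiffAt 𝓘(ℝ, E) 𝓘(ℝ, E) ∞ (extChartAt 𝓘(ℝ, E) y).symm z :=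
  (contMDiffOn_extChartAt_symm y).contMDiffAt ((isOpen_extChartAt_target y).mem_nhds hz)

variable (E) in
/-- The Riemannian metric in the chart at `y`. -/
def chartMetric (y : B) (z : E) : E →L[ℝ] E →L[ℝ] ℝ :=
  metricCoord E y ((extChartAt 𝓘(ℝ, E) y).symm z)

omit [FiniteDimensional ℝ E] in
theorem chartMetric_apply (y : B) {z : E} (hz : z ∈ (extChartAt 𝓘(ℝ, E) y).target)
    (a b : TangentSpace 𝓘(ℝ, E) z) : chartMetric E y z a b
      = inner ℝ (mfderiv 𝓘(ℝ, E) 𝓘(ℝ, E) (extChartAt 𝓘(ℝ, E) y).symm z a)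
        (mfderiv 𝓘(ℝ, E) 𝓘(ℝ, E) (extChartAt 𝓘(ℝ, E) y).symm z b) := by
  have hs : (extChartAt 𝓘(ℝ, E) y).symm z ∈ (chartAt E y).source := by
    simpa using (extChartAt 𝓘(ℝ, E) y).map_target hz
  have h := coordFrame_eq_mfderiv (E := E) hs
  rw [(extChartAt 𝓘(ℝ, E) y).right_inv hz] at h
  exact congrArg₂ (fun p q : TangentSpace 𝓘(ℝ, E) ((extChartAt 𝓘(ℝ, E) y).symm z) =>
    (inner ℝ p q : ℝ)) (DFunLike.congr_fun h a) (DFunLike.congr_fun h b)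

variable [IsContMDiffRiemannianBundle 𝓘(ℝ, E) ∞ E (fun x : B => TangentSpace 𝓘(ℝ, E) x)]

omit [FiniteDimensional ℝ E] in
theorem contDiffAt_chartMetric (y : B) :
    ContDiffAt ℝ ∞ (chartMetric E y) (extChartAt 𝓘(ℝ, E) y y) := by
  have h : ContMDiffAt 𝓘(ℝ, E) 𝓘(ℝ, E →L[ℝ] E →L[ℝ] ℝ) ∞ (metricCoord E y)
      ((extChartAt 𝓘(ℝ, E) y).symm (extChartAt 𝓘(ℝ, E) y y)) := by
    rw [extChartAt_to_inv]
    exact contMDiffAt_metricCoord y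
  exact (h.comp _ (contMDiffAt_extChartAt_symm' y (mem_extChartAt_target y))).contDiffAt

/-- First Christoffel identity in the chart at `y`. -/
theorem inner_pullbackHessian_chart (y : B) {z : E} (hz : z ∈ (extChartAt 𝓘(ℝ, E) y).target)
    (hG : DifferentiableAt ℝ (chartMetric E y) z) (a b c : E) :
    2 * inner ℝ (pullbackHessian E E (extChartAt 𝓘(ℝ, E) y).symm z a b)
        (mfderiv 𝓘(ℝ, E) 𝓘(ℝ, E) (extChartAt 𝓘(ℝ, E) y).symm z c)
      = fderiv ℝ (chartMetric E y) z a b c + fderiv ℝ (chartMetric E y) z b a c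
        - fderiv ℝ (chartMetric E y) z c a b := by
  have hF := contMDiffAt_extChartAt_symm' y hz
  have hc (e : E) : MDiffAlongAt 𝓘(ℝ, E) (fun z : E => z)
      (fun z => (show TangentSpace 𝓘(ℝ, E) z from e)) z :=
    ((contMDiffAlongAt_vectorSpace (n := ∞)).2 ⟨contMDiffAt_id, contMDiffAt_const⟩).mdiff (by simp)
  have hcov (e a : E) : covAlong 𝓘(ℝ, E) 𝓘(ℝ, E) (extChartAt 𝓘(ℝ, E) y).symm
      (fun z => mfderiv 𝓘(ℝ, E) 𝓘(ℝ, E) (extChartAt 𝓘(ℝ, E) y).symm z e) z a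
      = pullbackHessian E E (extChartAt 𝓘(ℝ, E) y).symm z a e := by
    have h := covAlong_map_coord (f := fun z : E => z) hF (hc e) a
    have h0 : mfderiv 𝓘(ℝ, E) 𝓘(ℝ, E) (fun z : E => z) z a = a := DFunLike.congr_fun mfderiv_id a
    have h1 : coordAlong (fun z : E => z) (fun z => (show TangentSpace 𝓘(ℝ, E) z from e)) z
        = fun _ => e := by
      ext1 z'
      rw [coordAlong, tangentCoord, TangentBundle.continuousLinearMapAt_model_space]
      rfl
    have h2 : coordDeriv 𝓘(ℝ, E) (fun z : E => z)
        (fun z => (show TangentSpace 𝓘(ℝ, E) z from e)) z a = 0 := by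
      have h3 : mvfderiv 𝓘(ℝ, E) (fun _ : E => e) z = 0 := mvfderiv_const e
      rw [coordDeriv, h1]
      exact DFunLike.congr_fun h3 a
    rw [h0, h2, map_zero, add_zero] at h
    exact h
  have key (a b c : E) : fderiv ℝ (chartMetric E y) z a b c
      = inner ℝ (pullbackHessian E E (extChartAt 𝓘(ℝ, E) y).symm z a b)
          (mfderiv 𝓘(ℝ, E) 𝓘(ℝ, E) (extChartAt 𝓘(ℝ, E) y).symm z c)
        + inner ℝ (mfderiv 𝓘(ℝ, E) 𝓘(ℝ, E) (extChartAt 𝓘(ℝ, E) y).symm z b)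
          (pullbackHessian E E (extChartAt 𝓘(ℝ, E) y).symm z a c) := by
    have h1 := mvfderiv_inner_along (MDiffAlongAt.map (f := fun z : E => z) hF (hc b))
      (MDiffAlongAt.map (f := fun z : E => z) hF (hc c)) a
    have h2 : (fun z' => (inner ℝ (mfderiv 𝓘(ℝ, E) 𝓘(ℝ, E) (extChartAt 𝓘(ℝ, E) y).symm z' b)
        (mfderiv 𝓘(ℝ, E) 𝓘(ℝ, E) (extChartAt 𝓘(ℝ, E) y).symm z' c) : ℝ))
        =ᶠ[nhds z] fun z' => chartMetric E y z' b c := by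
      filter_upwards [(isOpen_extChartAt_target (I := 𝓘(ℝ, E)) y).mem_nhds hz] with z' hz'
      exact (chartMetric_apply y hz' b c).symm
    have h3 : fderiv ℝ (fun z' => chartMetric E y z' b c) z a
        = fderiv ℝ (chartMetric E y) z a b c := by
      have h4 := (hG.hasFDerivAt.clm_apply (hasFDerivAt_const b z)).clm_apply
        (hasFDerivAt_const c z)
      rw [h4.fderiv]
      simp
    have h5 : mvfderiv 𝓘(ℝ, E) (fun z' => chartMetric E y z' b c) z a
        = fderiv ℝ (fun z' => chartMetric E y z' b c) z a := by
      refine congrArg (fun L : E →L[ℝ] ℝ => L a) ?_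
      exact mfderiv_eq_fderiv
    have h6 := DFunLike.congr_fun (mvfderiv_congr (I' := 𝓘(ℝ, E)) h2) a
    rw [← h3, ← h5]
    refine (h6.symm.trans h1).trans ?_
    exact congrArg₂ (fun p q : TangentSpace 𝓘(ℝ, E) ((extChartAt 𝓘(ℝ, E) y).symm z) =>
      (inner ℝ p (mfderiv 𝓘(ℝ, E) 𝓘(ℝ, E) (extChartAt 𝓘(ℝ, E) y).symm z c) : ℝ)
        + inner ℝ (mfderiv 𝓘(ℝ, E) 𝓘(ℝ, E) (extChartAt 𝓘(ℝ, E) y).symm z b) q)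
      (hcov b a) (hcov c a)
  have hsymm (a b : E) := pullbackHessian_symm hF a b
  rw [key a b c, key b a c, key c a b, hsymm b a, hsymm c a, hsymm c b,
    real_inner_comm (pullbackHessian E E _ z a c), real_inner_comm (pullbackHessian E E _ z b c)]
  ring

end Chart

theorem contDiffAt_fderiv_apply {E F : Type*} [NormedAddCommGroup E] [NormedSpace ℝ E]
    [NormedAddCommGroup F] [NormedSpace ℝ F] {G : E → F} {u a : ℝ → E} {t : ℝ}
    (hG : ContDiffAt ℝ ∞ G (u t)) (hu : ContDiffAt ℝ ∞ u t) (ha : ContDiffAt ℝ ∞ a t) :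
    ContDiffAt ℝ ∞ (fun t => fderiv ℝ G (u t) (a t)) t :=
  (ContDiffAt.comp t (g := fderiv ℝ G) (hG.fderiv_right (by simp)) hu).clm_apply ha

theorem eventually_differentiableAt {E F : Type*} [NormedAddCommGroup E] [NormedSpace ℝ E]
    [NormedAddCommGroup F] [NormedSpace ℝ F] {f : E → F} {x : E} (hf : ContDiffAt ℝ ∞ f x) :
    ∀ᶠ y in nhds x, DifferentiableAt ℝ f y := by
  filter_upwards [(hf.of_le (m := 1) (by simp)).eventually (by simp)] with y hy
  exact hy.differentiableAt (by simp)

section CurveRegularity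

variable {E : Type*} [NormedAddCommGroup E] [NormedSpace ℝ E]
  {B : Type*} [TopologicalSpace B] [ChartedSpace E B] [IsManifold 𝓘(ℝ, E) ∞ B]

theorem coordAlong_vectorSpace {u w : ℝ → E} {t : ℝ} : coordAlong (E := E) u w t = w := by
  ext1 r
  exact DFunLike.congr_fun
    (TangentBundle.continuousLinearMapAt_model_space (𝕜 := ℝ) (u t) (u r)) (w r)

theorem coordDeriv_vectorSpace {u w : ℝ → E} {t : ℝ} :
    (coordDeriv (E := E) 𝓘(ℝ, ℝ) u w t (1 : ℝ) : E) = deriv w t := by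
  have h1 := congrArg (fun k : ℝ → E => (mvfderiv 𝓘(ℝ, ℝ) k t : ℝ →L[ℝ] E) 1)
    (coordAlong_vectorSpace (u := u) (w := w) (t := t))
  have h2 : (mvfderiv 𝓘(ℝ, ℝ) w t : ℝ →L[ℝ] E) = fderiv ℝ w t := mfderiv_eq_fderiv
  exact h1.trans ((congrArg (fun L : ℝ →L[ℝ] E => L 1) h2).trans fderiv_apply_one_eq_deriv)

theorem mfderiv_symm_coordAlong {γ : ℝ → B} {W : ∀ t, TangentSpace 𝓘(ℝ, E) (γ t)} {t₀ t : ℝ}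
    (ht : γ t ∈ (chartAt E (γ t₀)).source) :
    (mfderiv 𝓘(ℝ, E) 𝓘(ℝ, E) (extChartAt 𝓘(ℝ, E) (γ t₀)).symm (extChartAt 𝓘(ℝ, E) (γ t₀) (γ t))
      (coordAlong (E := E) γ W t₀ t) : E) = W t := by
  rw [← coordFrame_eq_mfderiv ht]
  exact coordFrame_tangentCoord ht (W t)

variable [FiniteDimensional ℝ E] [RiemannianBundle (fun x : B => TangentSpace 𝓘(ℝ, E) x)]
  [IsContMDiffRiemannianBundle 𝓘(ℝ, E) ∞ E (fun x : B => TangentSpace 𝓘(ℝ, E) x)]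

/-- The covariant derivative of a vector field along a curve, in the chart at `γ t₀`. -/
theorem inner_covAlong_curve {γ : ℝ → B} {V W : ∀ t, TangentSpace 𝓘(ℝ, E) (γ t)} {t₀ t : ℝ}
    (hγ : ∀ᶠ r in nhds t, γ r ∈ (chartAt E (γ t₀)).source) (hc : ContinuousAt γ t)
    (hu : DifferentiableAt ℝ (fun r => extChartAt 𝓘(ℝ, E) (γ t₀) (γ r)) t)
    (hw : DifferentiableAt ℝ (coordAlong (E := E) γ W t₀) t)
    (hG : DifferentiableAt ℝ (chartMetric E (γ t₀)) (extChartAt 𝓘(ℝ, E) (γ t₀) (γ t))) :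
    inner ℝ (covAlong 𝓘(ℝ, ℝ) 𝓘(ℝ, E) γ W t (1 : ℝ)) (V t)
      = 1 / 2 * (fderiv ℝ (chartMetric E (γ t₀)) (extChartAt 𝓘(ℝ, E) (γ t₀) (γ t))
            (deriv (fun r => extChartAt 𝓘(ℝ, E) (γ t₀) (γ r)) t)
            (coordAlong (E := E) γ W t₀ t) (coordAlong (E := E) γ V t₀ t)
          + fderiv ℝ (chartMetric E (γ t₀)) (extChartAt 𝓘(ℝ, E) (γ t₀) (γ t))
            (coordAlong (E := E) γ W t₀ t) (deriv (fun r => extChartAt 𝓘(ℝ, E) (γ t₀) (γ r)) t)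
            (coordAlong (E := E) γ V t₀ t)
          - fderiv ℝ (chartMetric E (γ t₀)) (extChartAt 𝓘(ℝ, E) (γ t₀) (γ t))
            (coordAlong (E := E) γ V t₀ t) (deriv (fun r => extChartAt 𝓘(ℝ, E) (γ t₀) (γ r)) t)
            (coordAlong (E := E) γ W t₀ t))
        + chartMetric E (γ t₀) (extChartAt 𝓘(ℝ, E) (γ t₀) (γ t))
            (deriv (coordAlong (E := E) γ W t₀) t) (coordAlong (E := E) γ V t₀ t) := by
  have hs := hγ.self_of_nhds
  have hsrc : γ t ∈ (extChartAt 𝓘(ℝ, E) (γ t₀)).source := by simpa using hs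
  have hz := (extChartAt 𝓘(ℝ, E) (γ t₀)).map_source hsrc
  have hinv : γ t = (extChartAt 𝓘(ℝ, E) (γ t₀)).symm (extChartAt 𝓘(ℝ, E) (γ t₀) (γ t)) :=
    ((extChartAt 𝓘(ℝ, E) (γ t₀)).left_inv hsrc).symm
  have hF := contMDiffAt_extChartAt_symm' (γ t₀) hz
  have hW : MDiffAlongAt (E := E) 𝓘(ℝ, ℝ) (fun r => extChartAt 𝓘(ℝ, E) (γ t₀) (γ r))
      (coordAlong (E := E) γ W t₀) t := by
    refine ⟨hu.mdifferentiableAt, ?_⟩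
    refine hw.mdifferentiableAt.congr_of_eventuallyEq (Filter.Eventually.of_forall fun r => ?_)
    exact congrFun coordAlong_vectorSpace r
  have h1 := covAlong_congr (I' := 𝓘(ℝ, ℝ)) (f := γ) (W := W)
    (g := fun r => (extChartAt 𝓘(ℝ, E) (γ t₀)).symm (extChartAt 𝓘(ℝ, E) (γ t₀) (γ r)))
    (V := fun r => mfderiv 𝓘(ℝ, E) 𝓘(ℝ, E) (extChartAt 𝓘(ℝ, E) (γ t₀)).symm
      (extChartAt 𝓘(ℝ, E) (γ t₀) (γ r)) (coordAlong (E := E) γ W t₀ r)) (q := t) hc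
    (by
      filter_upwards [hγ] with r hr
      exact ((extChartAt 𝓘(ℝ, E) (γ t₀)).left_inv (by simpa using hr)).symm)
    (by
      filter_upwards [hγ] with r hr
      exact (mfderiv_symm_coordAlong hr).symm) (1 : ℝ)
  have h2 := covAlong_map_coord (I' := 𝓘(ℝ, ℝ)) (f := fun r => extChartAt 𝓘(ℝ, E) (γ t₀) (γ r))
    (W := coordAlong (E := E) γ W t₀) hF hW (1 : ℝ)
  have h3 := coordDeriv_vectorSpace (u := fun r => extChartAt 𝓘(ℝ, E) (γ t₀) (γ r))
    (w := coordAlong (E := E) γ W t₀) (t := t)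
  have h4 : (mfderiv 𝓘(ℝ, ℝ) 𝓘(ℝ, E) (fun r => extChartAt 𝓘(ℝ, E) (γ t₀) (γ r)) t (1 : ℝ) : E)
      = deriv (fun r => extChartAt 𝓘(ℝ, E) (γ t₀) (γ r)) t := by
    have h : (mfderiv 𝓘(ℝ, ℝ) 𝓘(ℝ, E) (fun r => extChartAt 𝓘(ℝ, E) (γ t₀) (γ r)) t : ℝ →L[ℝ] E)
      = fderiv ℝ (fun r => extChartAt 𝓘(ℝ, E) (γ t₀) (γ r)) t := mfderiv_eq_fderiv
    exact (congrArg (fun L : ℝ →L[ℝ] E => L 1) h).trans fderiv_apply_one_eq_deriv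
  have h5 := (mfderiv_symm_coordAlong (W := V) hs).symm
  have h6 := inner_tangent_congr (E := E) hinv
    (covAlong 𝓘(ℝ, ℝ) 𝓘(ℝ, E) γ W t (1 : ℝ)) (V t)
  have h7 := inner_pullbackHessian_chart (γ t₀) hz hG
    (deriv (fun r => extChartAt 𝓘(ℝ, E) (γ t₀) (γ r)) t) (coordAlong (E := E) γ W t₀ t)
    (coordAlong (E := E) γ V t₀ t)
  have h8 := chartMetric_apply (γ t₀) hz (deriv (coordAlong (E := E) γ W t₀) t) (coordAlong (E := E) γ V t₀ t)
  have h9 : (covAlong 𝓘(ℝ, ℝ) 𝓘(ℝ, E) γ W t (1 : ℝ) : E)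
      = pullbackHessian E E (extChartAt 𝓘(ℝ, E) (γ t₀)).symm (extChartAt 𝓘(ℝ, E) (γ t₀) (γ t))
          (deriv (fun r => extChartAt 𝓘(ℝ, E) (γ t₀) (γ r)) t) (coordAlong (E := E) γ W t₀ t)
        + mfderiv 𝓘(ℝ, E) 𝓘(ℝ, E) (extChartAt 𝓘(ℝ, E) (γ t₀)).symm
          (extChartAt 𝓘(ℝ, E) (γ t₀) (γ t)) (deriv (coordAlong (E := E) γ W t₀) t) := by
    refine h1.trans (h2.trans ?_)
    rw [h3]
    exact congrArg (fun a : E => (pullbackHessian E E (extChartAt 𝓘(ℝ, E) (γ t₀)).symm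
      (extChartAt 𝓘(ℝ, E) (γ t₀) (γ t)) a (coordAlong (E := E) γ W t₀ t)
        + mfderiv 𝓘(ℝ, E) 𝓘(ℝ, E) (extChartAt 𝓘(ℝ, E) (γ t₀)).symm
          (extChartAt 𝓘(ℝ, E) (γ t₀) (γ t)) (deriv (coordAlong (E := E) γ W t₀) t) : E)) h4
  refine h6.trans ((congrArg₂ (fun p q : TangentSpace 𝓘(ℝ, E) ((extChartAt 𝓘(ℝ, E) (γ t₀)).symm
    (extChartAt 𝓘(ℝ, E) (γ t₀) (γ t))) => (inner ℝ p q : ℝ)) h9 h5).trans ?_)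
  refine (inner_add_left _ _ _).trans ?_
  have h10 : ∀ a b : ℝ, 2 * a = b → a = 1 / 2 * b := fun a b h => by linarith
  exact congrArg₂ (fun a b : ℝ => a + b) (h10 _ _ h7) h8.symm

/-- Scalar products with covariant derivatives along curves are smooth. -/
theorem contDiffAt_inner_covAlong {γ : ℝ → B} {V W : ∀ t, TangentSpace 𝓘(ℝ, E) (γ t)} {t₀ : ℝ}
    (hV : ContMDiffAlongAt 𝓘(ℝ, ℝ) ∞ γ V t₀) (hW : ContMDiffAlongAt 𝓘(ℝ, ℝ) ∞ γ W t₀) :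
    ContDiffAt ℝ ∞ (fun t => (inner ℝ (covAlong 𝓘(ℝ, ℝ) 𝓘(ℝ, E) γ W t (1 : ℝ)) (V t) : ℝ)) t₀ := by
  obtain ⟨hγ, hv⟩ := contMDiffAlongAt_iff.1 hV
  have hw := (contMDiffAlongAt_iff.1 hW).2.contDiffAt
  replace hv := hv.contDiffAt
  have hu : ContDiffAt ℝ ∞ (fun r => extChartAt 𝓘(ℝ, E) (γ t₀) (γ r)) t₀ :=
    (contMDiffAt_extChartAt.comp t₀ hγ).contDiffAt
  have hG := contDiffAt_chartMetric (E := E) (γ t₀)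
  have hGu : ContDiffAt ℝ ∞ (fun r => chartMetric E (γ t₀)
      (extChartAt 𝓘(ℝ, E) (γ t₀) (γ r))) t₀ :=
    ContDiffAt.comp t₀ (g := chartMetric E (γ t₀)) hG hu
  have hu' : ContDiffAt ℝ ∞ (deriv (fun r => extChartAt 𝓘(ℝ, E) (γ t₀) (γ r))) t₀ :=
    hu.derivWithin (by simp)
  have hw' : ContDiffAt ℝ ∞ (deriv (coordAlong (E := E) γ W t₀)) t₀ := hw.derivWithin (by simp)
  refine ContDiffAt.congr_of_eventuallyEq ((contDiffAt_const (c := (1 / 2 : ℝ))).mul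
    (((((contDiffAt_fderiv_apply hG hu hu').clm_apply hw).clm_apply hv).add
      (((contDiffAt_fderiv_apply hG hu hw).clm_apply hu').clm_apply hv)).sub
      (((contDiffAt_fderiv_apply hG hu hv).clm_apply hu').clm_apply hw)) |>.add
    ((hGu.clm_apply hw').clm_apply hv)) ?_
  have hcont : ∀ᶠ t in nhds t₀, ContinuousAt γ t := by
    filter_upwards [(contMDiffAt_iff_contMDiffAt_nhds (n := 1) (by simp)).1
        (hγ.of_le (by simp))] with t ht
    exact ht.continuousAt
  filter_upwards [(eventually_map_mem_chart_source (E := E) hγ.continuousAt).eventually_nhds,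
    hcont, eventually_differentiableAt hu, eventually_differentiableAt hw, hu.continuousAt.eventually (eventually_differentiableAt hG)] with t h1 h2 h3 h4 h5
  exact inner_covAlong_curve h1 h2 h3 h4 h5

end CurveRegularity

section LocalSection

variable {E : Type*} [NormedAddCommGroup E] [NormedSpace ℝ E]
  {S : Type*} [TopologicalSpace S] [ChartedSpace E S] [IsManifold 𝓘(ℝ, E) ∞ S]

/-- A real function with non-zero differential has a local section. -/
theorem exists_local_section {s : S → ℝ} {q : S} (hs : ContMDiffAt 𝓘(ℝ, E) 𝓘(ℝ, ℝ) ∞ s q)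
    {v : TangentSpace 𝓘(ℝ, E) q} (hv : mvfderiv 𝓘(ℝ, E) s q v ≠ 0) :
    ∃ c : ℝ → S, ContMDiffAt 𝓘(ℝ, ℝ) 𝓘(ℝ, E) ∞ c (s q) ∧ c (s q) = q
      ∧ ∀ᶠ t in nhds (s q), s (c t) = t := by
  obtain ⟨e, he⟩ : ∃ e : E, e = v := ⟨v, rfl⟩
  let x := extChartAt 𝓘(ℝ, E) q q
  let l (r : ℝ) : E := x + r • e
  have hl0 : l 0 = x := by simp [l]
  have hl : HasDerivAt l e 0 := by
    have h := ((hasDerivAt_id (0 : ℝ)).smul_const e).const_add x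
    rwa [one_smul] at h
  have hls : ContDiff ℝ ∞ l := contDiff_const.add (contDiff_id.smul contDiff_const)
  have hF : ContMDiffAt 𝓘(ℝ, E) 𝓘(ℝ, E) ∞ (extChartAt 𝓘(ℝ, E) q).symm (l 0) := by
    rw [hl0]
    exact contMDiffAt_extChartAt_symm' q (mem_extChartAt_target q)
  have hc : ContMDiffAt 𝓘(ℝ, ℝ) 𝓘(ℝ, E) ∞ (fun r => (extChartAt 𝓘(ℝ, E) q).symm (l r)) 0 :=
    hF.comp 0 hls.contMDiff.contMDiffAt
  have hc0 : (extChartAt 𝓘(ℝ, E) q).symm (l 0) = q := by rw [hl0, extChartAt_to_inv]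
  have hf : ContDiffAt ℝ ∞ (fun r => s ((extChartAt 𝓘(ℝ, E) q).symm (l r))) 0 := by
    have hs' : ContMDiffAt 𝓘(ℝ, E) 𝓘(ℝ, ℝ) ∞ s ((extChartAt 𝓘(ℝ, E) q).symm (l 0)) := by
      rwa [hc0]
    exact (hs'.comp (0 : ℝ) hc).contDiffAt
  have hd : HasDerivAt (fun r => s ((extChartAt 𝓘(ℝ, E) q).symm (l r)))
      (mvfderiv 𝓘(ℝ, E) s q v) 0 := by
    have h1 := fderiv_comp_extChartAt_symm (hs.mdifferentiableAt (by simp))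
    have h2 : DifferentiableAt ℝ (s ∘ (extChartAt 𝓘(ℝ, E) q).symm) (l 0) := by
      have hs' : ContMDiffAt 𝓘(ℝ, E) 𝓘(ℝ, ℝ) ∞ s ((extChartAt 𝓘(ℝ, E) q).symm (l 0)) := by
        rwa [hc0]
      exact (hs'.comp (l 0) hF).contDiffAt.differentiableAt (by simp)
    have h3 := h2.hasFDerivAt.comp_hasDerivAt (0 : ℝ) hl
    rw [hl0] at h3
    have h4 : fderiv ℝ (s ∘ (extChartAt 𝓘(ℝ, E) q).symm) x e = mvfderiv 𝓘(ℝ, E) s q v :=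
      by
      rw [he]
      exact congrArg (fun L : E →L[ℝ] ℝ => L v) h1
    rw [h4] at h3
    exact h3
  have hfd : HasFDerivAt (fun r => s ((extChartAt 𝓘(ℝ, E) q).symm (l r)))
      (ContinuousLinearEquiv.unitsEquivAut ℝ (Units.mk0 _ hv) : ℝ →L[ℝ] ℝ) 0 := by
    refine hd.hasFDerivAt.congr_fderiv ?_
    ext
    simp
  have hf0 : s ((extChartAt 𝓘(ℝ, E) q).symm (l 0)) = s q := by rw [hc0]
  have hg := hf.to_localInverse hfd (by simp)
  have hst := hf.hasStrictFDerivAt' hfd (by simp)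
  have hright := hst.eventually_right_inverse
  have hg0 := hst.localInverse_apply_image
  rw [hf0] at hg hright hg0
  refine ⟨fun t => (extChartAt 𝓘(ℝ, E) q).symm (l (hf.localInverse hfd (by simp) t)), ?_, ?_, hright⟩
  · have hc' : ContMDiffAt 𝓘(ℝ, ℝ) 𝓘(ℝ, E) ∞ (fun r => (extChartAt 𝓘(ℝ, E) q).symm (l r))
        (hf.localInverse hfd (by simp) (s q)) := by
      refine Eq.mpr (congrArg _ ?_) hc
      exact hg0
    exact hc'.comp (s q) hg.contMDiffAt
  · exact (congrArg (fun r => (extChartAt 𝓘(ℝ, E) q).symm (l r)) hg0).trans hc0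

end LocalSection

theorem exists_linear_iff_deriv_deriv_eq_zero {T : Set ℝ} (hT : IsOpen T) (hT' : T.OrdConnected)
    {K : ℝ → ℝ} (hK : ∀ t ∈ T, ContDiffAt ℝ ∞ K t) :
    (∀ t ∈ T, deriv (deriv K) t = 0) ↔ ∃ a c : ℝ, ∀ t ∈ T, K t = a * t + c := by
  have hd (t) (ht : t ∈ T) : DifferentiableAt ℝ K t := (hK t ht).differentiableAt (by simp)
  have hd' (t) (ht : t ∈ T) : DifferentiableAt ℝ (deriv K) t :=
    (((hK t ht).derivWithin (m := ∞) (by simp)).differentiableAt (by simp))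
  constructor
  · intro h
    rcases T.eq_empty_or_nonempty with rfl | ⟨t₀, ht₀⟩
    · exact ⟨0, 0, by simp⟩
    have hpc := hT'.isPreconnected
    have h1 (t) (ht : t ∈ T) : deriv K t = deriv K t₀ :=
      hT.is_const_of_deriv_eq_zero hpc (fun t ht => (hd' t ht).differentiableWithinAt) h ht ht₀
    have hl (t) : HasDerivAt (fun t => deriv K t₀ * t) (deriv K t₀) t := by
      simpa using (hasDerivAt_id t).const_mul (deriv K t₀)
    have h2 (t) (ht : t ∈ T) : HasDerivAt (fun t => K t - deriv K t₀ * t) 0 t := by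
      have h3 := (hd t ht).hasDerivAt.sub (hl t)
      rwa [h1 t ht, sub_self] at h3
    refine ⟨deriv K t₀, K t₀ - deriv K t₀ * t₀, fun t ht => ?_⟩
    have h3 := hT.is_const_of_deriv_eq_zero hpc
      (fun t ht => (h2 t ht).differentiableAt.differentiableWithinAt)
      (fun t ht => (h2 t ht).deriv) ht ht₀
    linarith
  · rintro ⟨a, c, h⟩ t ht
    have h1 (t) (ht : t ∈ T) : deriv K t = a := by
      have h2 : K =ᶠ[nhds t] fun t => a * t + c := by
        filter_upwards [hT.mem_nhds ht] with r hr using h r hr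
      have h3 : HasDerivAt (fun t => a * t + c) a t := by
        simpa using ((hasDerivAt_id t).const_mul a).add_const c
      rw [h2.deriv_eq, h3.deriv]
    have h2 : deriv K =ᶠ[nhds t] fun _ => a := by
      filter_upwards [hT.mem_nhds ht] with r hr using h1 r hr
    rw [h2.deriv_eq, deriv_const]

section Main

variable {M : Type*} [TopologicalSpace M] [ChartedSpace (EuclideanSpace ℝ (Fin 3)) M]
  [IsManifold (𝓡 3) ∞ M] [RiemannianBundle (fun x : M => TangentSpace (𝓡 3) x)]
  [IsContMDiffRiemannianBundle (𝓡 3) ∞ (EuclideanSpace ℝ (Fin 3))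
      (fun x : M => TangentSpace (𝓡 3) x)] [T2Space M]
  {B : Type*} [TopologicalSpace B] [ChartedSpace (EuclideanSpace ℝ (Fin 2)) B]
  [IsManifold (𝓡 2) ∞ B] [RiemannianBundle (fun b : B => TangentSpace (𝓡 2) b)]
  [IsContMDiffRiemannianBundle (𝓡 2) ∞ (EuclideanSpace ℝ (Fin 2))
      (fun b : B => TangentSpace (𝓡 2) b)]
  {S : Type*} [TopologicalSpace S] [ChartedSpace (EuclideanSpace ℝ (Fin 2)) S]
  [IsManifold (𝓡 2) ∞ S] [RiemannianBundle (fun q : S => TangentSpace (𝓡 2) q)]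
  [IsContMDiffRiemannianBundle (𝓡 2) ∞ (EuclideanSpace ℝ (Fin 2))
      (fun q : S => TangentSpace (𝓡 2) q)]
  {σ : SasakiStructure M} {Φ : ℝ → M → M} {pr : M → B} {T : Set ℝ} {γ : ℝ → B}
  {s : S → ℝ} {ι : S → M}

omit [IsManifold (𝓡 3) ∞ M] [IsManifold (𝓡 2) ∞ S] [T2Space M]
  [IsContMDiffRiemannianBundle (𝓡 3) ∞ (EuclideanSpace ℝ (Fin 3))
      (fun x : M => TangentSpace (𝓡 3) x)]
  [IsContMDiffRiemannianBundle (𝓡 2) ∞ (EuclideanSpace ℝ (Fin 2))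
      (fun q : S => TangentSpace (𝓡 2) q)] in
theorem IsHopfCylinder.exists_param_eq {B : Type*} {pr : M → B} {γ : ℝ → B}
    (hpr : Function.Surjective pr) (hι : IsHopfCylinder pr T γ s ι) {t : ℝ}
    (ht : t ∈ T) : ∃ q, s q = t := by
  obtain ⟨p, hp⟩ := hpr (γ t)
  have h : (t, p) ∈ Set.range (fun q => (s q, ι q)) := by
    rw [hι.range_eq]
    exact ⟨ht, hp⟩
  obtain ⟨q, hq⟩ := h
  exact ⟨q, congrArg Prod.fst hq⟩

theorem contDiffAt_signedCurvature (hΦ : IsRegularFlow σ Φ)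
    (hpr : IsBoothbyWangFibering σ Φ pr) (hγ : IsUnitSpeedCurve T γ)
    (hι : IsHopfCylinder pr T γ s ι) {t : ℝ} (ht : t ∈ T) :
    ContDiffAt ℝ ∞ (signedCurvature (complexStructure σ pr hpr.surjective) γ) t := by
  obtain ⟨q, rfl⟩ := hι.exists_param_eq hpr.surjective ht
  obtain ⟨v, hv⟩ := exists_mvfderiv_param_ne_zero hΦ hpr hγ hι q
  obtain ⟨c, hc, hcq, hcs⟩ := exists_local_section (hι.contMDiff_param q) hv
  refine contDiffAt_inner_covAlong (V := fun t => complexStructure σ pr hpr.surjective (γ t)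
    (velocity γ t)) ?_ (hγ.contMDiffAlongAt_velocity ht)
  have hN : ContMDiffAlongAt (𝓡 2) ∞ (fun q => pr (ι q))
      (fun q => mfderiv (𝓡 3) (𝓡 2) pr (ι q) (hopfNormal σ pr γ s ι q)) (c (s q)) :=
    ContMDiffAlongAt.map (hpr.smooth _) (contMDiffAlongAt_hopfNormal hΦ hpr hγ hι _)
  refine ContMDiffAt.congr_of_eventuallyEq (hN.comp hc) ?_
  filter_upwards [hcs] with t ht
  have h1 := totalSpace_mk_congr (E := EuclideanSpace ℝ (Fin 2)) (hι.mem (c t)).2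
    (mfderiv (𝓡 3) (𝓡 2) pr (ι (c t)) (hopfNormal σ pr γ s ι (c t)))
  refine Eq.trans ?_ h1.symm
  have h2 := complexStructure_velocity hΦ hpr hι (c t)
  refine Eq.trans ?_ (congrArg (fun w : EuclideanSpace ℝ (Fin 2) => (⟨γ (s (c t)), w⟩ :
    TotalSpace (EuclideanSpace ℝ (Fin 2)) (TangentSpace (𝓡 2) (M := B)))) h2)
  exact congrArg (fun t => (⟨γ t, complexStructure σ pr hpr.surjective (γ t) (velocity γ t)⟩ :
    TotalSpace (EuclideanSpace ℝ (Fin 2)) (TangentSpace (𝓡 2) (M := B)))) ht.symm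

theorem isGeodesic_iff (hΦ : IsRegularFlow σ Φ)
    (hpr : IsBoothbyWangFibering σ Φ pr) (hγ : IsUnitSpeedCurve T γ)
    (hι : IsHopfCylinder pr T γ s ι) :
    IsGeodesic T γ
      ↔ ∀ t ∈ T, signedCurvature (complexStructure σ pr hpr.surjective) γ t = 0 := by
  refine forall₂_congr fun t ht => ⟨fun h => ?_, fun h => ?_⟩
  · rw [signedCurvature, h, inner_zero_left]
  · obtain ⟨q, rfl⟩ := hι.exists_param_eq hpr.surjective ht
    have h1 := (meanCurvatureVector_eq hΦ hpr hγ hι q).2.1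
    rw [h, zero_smul] at h1
    exact h1

/-- The normal Laplacian of the mean curvature vector of a Hopf cylinder. -/
theorem normalLaplacian_meanCurvatureVector (hΦ : IsRegularFlow σ Φ)
    (hpr : IsBoothbyWangFibering σ Φ pr) (hγ : IsUnitSpeedCurve T γ)
    (hι : IsHopfCylinder pr T γ s ι) (q : S) :
    normalLaplacian (𝓡 3) ι (meanCurvatureVector (𝓡 3) ι) q
      = (-deriv (deriv fun t =>
          signedCurvature (complexStructure σ pr hpr.surjective) γ t / 2) (s q))
        • hopfNormal σ pr γ s ι q := by
  have h : meanCurvatureVector (𝓡 3) ι = fun q =>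
      (signedCurvature (complexStructure σ pr hpr.surjective) γ (s q) / 2)
        • hopfNormal σ pr γ s ι q :=
    funext fun q => (meanCurvatureVector_eq hΦ hpr hγ hι q).2.2
  rw [h]
  exact normalLaplacian_smul_hopfNormal hΦ hpr hγ hι (K := fun t =>
    signedCurvature (complexStructure σ pr hpr.surjective) γ t / 2)
    (fun t ht => (contDiffAt_signedCurvature hΦ hpr hγ hι ht).div_const 2) q

theorem normalLaplacian_meanCurvatureVector_eq_zero_iff (hΦ : IsRegularFlow σ Φ)
    (hpr : IsBoothbyWangFibering σ Φ pr) (hγ : IsUnitSpeedCurve T γ)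
    (hι : IsHopfCylinder pr T γ s ι) :
    (∀ q : S, normalLaplacian (𝓡 3) ι (meanCurvatureVector (𝓡 3) ι) q = 0)
      ↔ ∃ a c : ℝ, ∀ t ∈ T,
        signedCurvature (complexStructure σ pr hpr.surjective) γ t = a * t + c := by
  have hK (t) (ht : t ∈ T) : ContDiffAt ℝ ∞ (fun t =>
      signedCurvature (complexStructure σ pr hpr.surjective) γ t / 2) t :=
    (contDiffAt_signedCurvature hΦ hpr hγ hι ht).div_const 2
  have hN (q : S) : hopfNormal σ pr γ s ι q ≠ 0 := fun h => by
    have h1 := inner_hopfNormal_self hΦ hpr hγ hι q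
    rw [h, inner_zero_left] at h1
    exact zero_ne_one h1
  have h1 : (∀ q : S, normalLaplacian (𝓡 3) ι (meanCurvatureVector (𝓡 3) ι) q = 0)
      ↔ ∀ t ∈ T, deriv (deriv fun t =>
        signedCurvature (complexStructure σ pr hpr.surjective) γ t / 2) t = 0 := by
    refine ⟨fun h t ht => ?_, fun h q => ?_⟩
    · obtain ⟨q, rfl⟩ := hι.exists_param_eq hpr.surjective ht
      have h2 := h q
      rw [normalLaplacian_meanCurvatureVector hΦ hpr hγ hι] at h2
      exact neg_eq_zero.1 ((smul_eq_zero.1 h2).resolve_right (hN q))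
    · rw [normalLaplacian_meanCurvatureVector hΦ hpr hγ hι, h _ (hι.mem q).1, neg_zero, zero_smul]
  rw [h1, exists_linear_iff_deriv_deriv_eq_zero hγ.isOpen hγ.ordConnected hK]
  constructor
  · rintro ⟨a, c, h⟩
    exact ⟨2 * a, 2 * c, fun t ht => by linarith [h t ht]⟩
  · rintro ⟨a, c, h⟩
    exact ⟨a / 2, c / 2, fun t ht => by rw [h t ht]; ring⟩

end Main

end SasakiHopf

end

theorem mainTheorem5
    {M : Type*} [TopologicalSpace M] [T2Space M] [SecondCountableTopology M]
    [ChartedSpace (EuclideanSpace ℝ (Fin 3)) M] [IsManifold (𝓡 3) ∞ M]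
    [RiemannianBundle (fun x : M => TangentSpace (𝓡 3) x)]
    [IsContMDiffRiemannianBundle (𝓡 3) ∞ (EuclideanSpace ℝ (Fin 3))
      (fun x : M => TangentSpace (𝓡 3) x)]
    {B : Type*} [TopologicalSpace B] [T2Space B] [SecondCountableTopology B]
    [ChartedSpace (EuclideanSpace ℝ (Fin 2)) B] [IsManifold (𝓡 2) ∞ B]
    [RiemannianBundle (fun b : B => TangentSpace (𝓡 2) b)]
    [IsContMDiffRiemannianBundle (𝓡 2) ∞ (EuclideanSpace ℝ (Fin 2))
      (fun b : B => TangentSpace (𝓡 2) b)]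
    (σ : SasakiHopf.SasakiStructure M) (Φ : ℝ → M → M) (hΦ : SasakiHopf.IsRegularFlow σ Φ)
    (pr : M → B) (hpr : SasakiHopf.IsBoothbyWangFibering σ Φ pr)
    (T : Set ℝ) (γ : ℝ → B) (hγ : SasakiHopf.IsUnitSpeedCurve T γ)
    {S : Type*} [TopologicalSpace S]
    [ChartedSpace (EuclideanSpace ℝ (Fin 2)) S] [IsManifold (𝓡 2) ∞ S]
    [RiemannianBundle (fun q : S => TangentSpace (𝓡 2) q)]
    [IsContMDiffRiemannianBundle (𝓡 2) ∞ (EuclideanSpace ℝ (Fin 2))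
      (fun q : S => TangentSpace (𝓡 2) q)]
    (s : S → ℝ) (ι : S → M) (hι : SasakiHopf.IsHopfCylinder pr T γ s ι) :
    (∀ q : S, SasakiHopf.normalLaplacian (𝓡 3) ι
        (SasakiHopf.meanCurvatureVector (𝓡 3) ι) q = 0) ↔
      (SasakiHopf.IsGeodesic T γ ∨
        SasakiHopf.IsRiemannianCircle (SasakiHopf.complexStructure σ pr hpr.surjective) T γ ∨
        SasakiHopf.IsRiemannianClothoid (SasakiHopf.complexStructure σ pr hpr.surjective) T γ) := by
  rw [SasakiHopf.normalLaplacian_meanCurvatureVector_eq_zero_iff hΦ hpr hγ hι,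
    SasakiHopf.isGeodesic_iff hΦ hpr hγ hι]
  constructor
  · rintro ⟨a, c, h⟩
    by_cases ha : a = 0
    · subst ha
      simp only [zero_mul, zero_add] at h
      by_cases hc : c = 0
      · exact Or.inl fun t ht => (h t ht).trans hc
      · exact Or.inr (Or.inl ⟨c, hc, h⟩)
    · exact Or.inr (Or.inr ⟨a, c, ha, h⟩)
  · rintro (h | ⟨c, -, h⟩ | ⟨a, c, -, h⟩)
    · exact ⟨0, 0, fun t ht => by rw [h t ht]; ring⟩
    · exact ⟨0, c, fun t ht => by rw [h t ht]; ring⟩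
    · exact ⟨a, c, h⟩
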